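/- Let $\mathbf q$ be an indeterminate. For a prime power $q$ let $V=\mathbb F_q^n$, $G=GL_n(\mathbb F_q)$, let $\mathcal F$ be the set of complete flags in $V$, and let $\mathcal R_n(q)$ be the $\mathbb C$-algebra of $G$-invariant functions on $\mathcal F\times\mathcal F\times V$ with the product $$(\alpha*\beta)(F,F',v)=\sum_{H\in\mathcal F,\,u\in V}\alpha(F,H,u)\,\beta(H,F',v-u).$$ The $G$-orbits are indexed, independently of $q$, by the pairs $(w,\beta)$ with $w\in S_n$ and $\beta\subseteq\{1,\dots,n\}$ such that for $i\in\beta$ and $j\notin\beta$ one has $i<j$ or $w^{-1}(i)<w^{-1}(j)$; the orbit of $(w,\beta)$ consists of the triples $(F,F',v)$ for which there is a basis $b_1,\dots,b_n$ of $V$ with $F_i=\langle b_1,\dots,b_i\rangle$, $F'_j=\langle b_{w(1)},\dots,b_{w(j)}\rangle$ and $v=\sum_{i\in\beta}b_i$. Let $T_{w,\beta}$ be the characteristic function of this orbit. The structure constants of this basis are polynomials in $q$; let $R_n$ be the resulting $\mathbb C[\mathbf q,\mathbf q^{-1}]$-algebra with basis $T_{w,\beta}$ (equivalently, the $\mathbb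 C[\mathbf q,\mathbf q^{-1}]$-subalgebra of $\prod_q\mathcal R_n(q)$ generated by the families $T_{w,\beta}$, where $\mathbf q$ acts on the factor $\mathcal R_n(q)$ as the number $q$). The generic mirabolic Hecke algebra is $\mathcal R_n=\mathbb C(\mathbf q)\otimes_{\mathbb C[\mathbf q,\mathbf q^{-1}]}R_n$. Put $T_0=T_{1,\{1\}}$, $T_i=T_{s_i,\emptyset}$ for $1\le i\le n-1$, where $s_i=(i\ i+1)$, and $e=\mathbf q^{-1}(T_0+1)$ in $\mathcal R_n$. Let $H_n(1,0)$ be the $\mathbb C[\mathbf q,\mathbf q^{-1}]$-algebra with generators $X,T_1,\dots,T_{n-1}$ and relations $T_i^2=(\mathbf q-1)T_i+\mathbf q$; $T_iT_{i+1}T_i=T_{i+1}T_iT_{i+1}$; $T_iT_j=T_jT_i$ for $|i-j|\ge2$; $XT_i=T_iX$ for $i\ge2$; $XT_1XT_1=T_1XT_1X$; $(X-1)X=0$; and let $\mathcal H_n(1,0)=\mathbb C(\mathbf q)\otimes_{\mathbb C[\mathbf q,\mathbf q^{-1}]}H_n(1,0)$. (1) For $n\ge1$, the $\mathbb C(\mathbf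 q)$-algebra $\mathcal R_n$ has a presentation with generators $e,T_1,\dots,T_{n-1}$ and relations $$\begin{aligned}T_i^2&=(\mathbf q-1)T_i+\mathbf q&&(i\ge1),\\ T_iT_{i+1}T_i&=T_{i+1}T_iT_{i+1}&&(i\ge1),\\ T_iT_j&=T_jT_i&&(i,j\ge1,\ |i-j|\ge2),\\ e^2&=e,\\ eT_i&=T_ie&&(i\ge2),\\ eT_1eT_1&=T_1eT_1e,\\ eT_1eT_1&=T_1eT_1-eT_1e+T_1e+eT_1+e-T_1-1\end{aligned}$$ (relations that involve an index larger than $n-1$ are omitted). (2) These relations are equivalent to Solomon's: if $T_0,T_1,\dots,T_{n-1}$ are elements of a $\mathbb C(\mathbf q)$-algebra and $e=\mathbf q^{-1}(T_0+1)$, then $e,T_1,\dots,T_{n-1}$ satisfy the relations in (1) if and only if $T_0,\dots,T_{n-1}$ satisfy $$\begin{aligned}T_0^2&=(\mathbf q-2)T_0+(\mathbf q-1),\\ T_i^2&=(\mathbf q-1)T_i+\mathbf q&&(i\ge1),\\ T_iT_{i+1}T_i&=T_{i+1}T_iT_{i+1}&&(i\ge1),\\ T_0T_1T_0T_1&=(\mathbf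 q-1)(T_1T_0T_1+T_1T_0)-T_0T_1T_0,\\ T_1T_0T_1T_0&=(\mathbf q-1)(T_1T_0T_1+T_0T_1)-T_0T_1T_0,\\ T_iT_j&=T_jT_i&&(i,j\ge0,\ |i-j|\ge2).\end{aligned}$$ (3) The element $$y_{(\emptyset,2)}=(\mathbf q+1)^{-1}\bigl(1-X+T_1-XT_1-T_1X+XT_1X-T_1XT_1+XT_1XT_1\bigr)$$ of $\mathcal H_2(1,0)$ is the central idempotent that corresponds to the one-dimensional representation $X\mapsto0$, $T_1\mapsto\mathbf q$; that is, it is a nonzero central idempotent with $Xy_{(\emptyset,2)}=0$ and $T_1y_{(\emptyset,2)}=\mathbf q\,y_{(\emptyset,2)}$. (4) For $n\ge2$, let $I_n^{(\emptyset,2)}$ be the two-sided ideal of $\mathcal H_n(1,0)$ generated by the image of $y_{(\emptyset,2)}$ under the map $\mathcal H_2(1,0)\to\mathcal H_n(1,0)$, $X\mapsto X$, $T_1\mapsto T_1$. There is an isomorphism of $\mathbb C(\mathbf q)$-algebras $$\mathcal H_n(1,0)/I_n^{(\emptyset,2)}\;\simeq\;\mathcal R_n,\qquad X\mapsto e,\quad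 T_i\mapsto T_i\ (1\le i\le n-1).$$ -/

import Mathlib

open scoped TensorProduct

noncomputable section

namespace Mirabolic

/-! ## Algebras given by generators and relations -/

section Presentations

/-- Names of the generators: one distinguished generator `X` (which is called `T₀`, `e` or `X`,
depending on the presentation) and generators `T i` for `1 ≤ i ≤ n - 1`. -/
inductive Gen (n : ℕ) : Type
  | X : Gen n
  | T (i : Set.Ico 1 n) : Gen n

/-- The generator `X` of the free algebra. -/
abbrev fX (R : Type*) [CommRing R] (n : ℕ) : FreeAlgebra R (Gen n) :=
  FreeAlgebra.ι R Gen.X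

/-- The generator `T i`, `1 ≤ i ≤ n - 1`, of the free algebra. -/
abbrev fT (R : Type*) [CommRing R] {n : ℕ} (i : Set.Ico 1 n) : FreeAlgebra R (Gen n) :=
  FreeAlgebra.ι R (Gen.T i)

/-- Relations between elements of the free `R`-algebra on the generators. -/
abbrev Relations (R : Type*) [CommRing R] (n : ℕ) : Type _ :=
  FreeAlgebra R (Gen n) → FreeAlgebra R (Gen n) → Prop

/-- The `R`-algebra with generators `Gen n` and relations `r`. -/
abbrev Presented {R : Type*} [CommRing R] {n : ℕ} (r : Relations R n) : Type _ :=
  RingQuot r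

/-- The image of a generator in the algebra with relations `r`. -/
def Presented.gen {R : Type*} [CommRing R] {n : ℕ} (r : Relations R n) (g : Gen n) :
    Presented r :=
  RingQuot.mkAlgHom R r (FreeAlgebra.ι R g)

/-- The family of elements `x, t i` of an `R`-algebra, indexed by the generators. -/
def family {A : Type*} {n : ℕ} (x : A) (t : Set.Ico 1 n → A) : Gen n → A
  | .X => x
  | .T i => t i

/-- The elements `x, t i` of the `R`-algebra `A` satisfy the relations `r`. -/
def Satisfies {R : Type*} [CommRing R] {n : ℕ} (r : Relations R n)
    {A : Type*} [Ring A] [Algebra R A] (x : A) (t : Set.Ico 1 n → A) : Prop :=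
  ∀ a b, r a b → FreeAlgebra.lift R (family x t) a = FreeAlgebra.lift R (family x t) b

variable {R : Type*} [CommRing R]

/-- The relations of the Iwahori-Hecke algebra of the symmetric group, between `T 1, …, T (n-1)`. -/
inductive HeckeRel (q : R) (n : ℕ) : Relations R n
  | quadratic (i : Set.Ico 1 n) :
      HeckeRel q n (fT R i ^ 2) ((q - 1) • fT R i + q • 1)
  | braid (i j : Set.Ico 1 n) (hij : j.1 = i.1 + 1) :
      HeckeRel q n (fT R i * fT R j * fT R i) (fT R j * fT R i * fT R j)
  | comm (i j : Set.Ico 1 n) (hij : i.1 + 2 ≤ j.1 ∨ j.1 + 2 ≤ i.1) :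
      HeckeRel q n (fT R i * fT R j) (fT R j * fT R i)

/-- Solomon's relations between `T₀` (the generator `X`) and `T 1, …, T (n-1)`. -/
inductive SolomonRel (q : R) (n : ℕ) : Relations R n
  | hecke (a b : FreeAlgebra R (Gen n)) (h : HeckeRel q n a b) : SolomonRel q n a b
  | zero_quadratic : SolomonRel q n (fX R n ^ 2) ((q - 2) • fX R n + (q - 1) • 1)
  | zero_one (i : Set.Ico 1 n) (hi : i.1 = 1) :
      SolomonRel q n (fX R n * fT R i * fX R n * fT R i)
        ((q - 1) • (fT R i * fX R n * fT R i + fT R i * fX R n) - fX R n * fT R i * fX R n)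
  | one_zero (i : Set.Ico 1 n) (hi : i.1 = 1) :
      SolomonRel q n (fT R i * fX R n * fT R i * fX R n)
        ((q - 1) • (fT R i * fX R n * fT R i + fX R n * fT R i) - fX R n * fT R i * fX R n)
  | zero_comm (i : Set.Ico 1 n) (hi : 2 ≤ i.1) :
      SolomonRel q n (fX R n * fT R i) (fT R i * fX R n)

/-- The new relations, between `e` (the generator `X`) and `T 1, …, T (n-1)`. -/
inductive NewRel (q : R) (n : ℕ) : Relations R n
  | hecke (a b : FreeAlgebra R (Gen n)) (h : HeckeRel q n a b) : NewRel q n a b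
  | idem : NewRel q n (fX R n ^ 2) (fX R n)
  | e_comm (i : Set.Ico 1 n) (hi : 2 ≤ i.1) :
      NewRel q n (fX R n * fT R i) (fT R i * fX R n)
  | e_braid (i : Set.Ico 1 n) (hi : i.1 = 1) :
      NewRel q n (fX R n * fT R i * fX R n * fT R i) (fT R i * fX R n * fT R i * fX R n)
  | extra (i : Set.Ico 1 n) (hi : i.1 = 1) :
      NewRel q n (fX R n * fT R i * fX R n * fT R i)
        (fT R i * fX R n * fT R i - fX R n * fT R i * fX R n + fT R i * fX R n
          + fX R n * fT R i + fX R n - fT R i - 1)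

/-- The relations of the cyclotomic Hecke (Ariki-Koike) algebra with parameters `q` and
`u 0, …, u (r-1)`. -/
inductive CyclotomicRel (q : R) {r : ℕ} (u : Fin r → R) (n : ℕ) : Relations R n
  | hecke (a b : FreeAlgebra R (Gen n)) (h : HeckeRel q n a b) : CyclotomicRel q u n a b
  | X_comm (i : Set.Ico 1 n) (hi : 2 ≤ i.1) :
      CyclotomicRel q u n (fX R n * fT R i) (fT R i * fX R n)
  | X_braid (i : Set.Ico 1 n) (hi : i.1 = 1) :
      CyclotomicRel q u n (fX R n * fT R i * fX R n * fT R i) (fT R i * fX R n * fT R i * fX R n)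
  | cyclotomic :
      CyclotomicRel q u n
        (List.ofFn fun k : Fin r => fX R n - algebraMap R (FreeAlgebra R (Gen n)) (u k)).prod 0

end Presentations

/-! ## The ground rings -/

/-- The ring `ℂ[𝐪, 𝐪⁻¹]`. -/
abbrev BaseRing : Type := LaurentPolynomial ℂ

/-- The indeterminate `𝐪` in `ℂ[𝐪, 𝐪⁻¹]`. -/
abbrev qBase : BaseRing := LaurentPolynomial.T 1

/-- The field `ℂ(𝐪)`, as the field of fractions of `ℂ[𝐪, 𝐪⁻¹]`. -/
def BaseField : Type := FractionRing BaseRing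

instance : Field BaseField := inferInstanceAs (Field (FractionRing BaseRing))

instance : Algebra BaseRing BaseField := inferInstanceAs (Algebra BaseRing (FractionRing BaseRing))

instance : IsFractionRing BaseRing BaseField :=
  inferInstanceAs (IsFractionRing BaseRing (FractionRing BaseRing))

/-- The indeterminate `𝐪` in `ℂ(𝐪)`. -/
def q : BaseField := algebraMap BaseRing BaseField qBase

/-! ## The cyclotomic Hecke algebra -/

section Cyclotomic

/-- The constants `u k`, as elements of `ℂ[𝐪, 𝐪⁻¹]`. -/
abbrev constants {r : ℕ} (u : Fin r → ℂ) : Fin r → BaseRing :=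
  fun k => algebraMap ℂ BaseRing (u k)

/-- The cyclotomic Hecke algebra `H_n(u₁, …, u_r)` over `ℂ[𝐪, 𝐪⁻¹]`. -/
abbrev CyclotomicHecke {r : ℕ} (u : Fin r → ℂ) (n : ℕ) : Type :=
  Presented (CyclotomicRel qBase (constants u) n)

/-- The generic cyclotomic Hecke algebra `ℋ_n(u₁, …, u_r)` over `ℂ(𝐪)`. -/
def GenericCyclotomicHecke {r : ℕ} (u : Fin r → ℂ) (n : ℕ) : Type :=
  BaseField ⊗[BaseRing] CyclotomicHecke u n

instance {r : ℕ} (u : Fin r → ℂ) (n : ℕ) : Ring (GenericCyclotomicHecke u n) :=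
  inferInstanceAs (Ring (BaseField ⊗[BaseRing] CyclotomicHecke u n))

instance {r : ℕ} (u : Fin r → ℂ) (n : ℕ) : Algebra BaseField (GenericCyclotomicHecke u n) :=
  inferInstanceAs (Algebra BaseField (BaseField ⊗[BaseRing] CyclotomicHecke u n))

/-- `GenericCyclotomicHecke` unfolded to the tensor product that defines it. -/
def GenericCyclotomicHecke.toTensor {r : ℕ} (u : Fin r → ℂ) (n : ℕ) :
    GenericCyclotomicHecke u n ≃ₐ[BaseField] BaseField ⊗[BaseRing] CyclotomicHecke u n :=
  AlgEquiv.refl (R := BaseField) (A₁ := BaseField ⊗[BaseRing] CyclotomicHecke u n)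

/-- A generator of `ℋ_n(u₁, …, u_r)`. -/
def cycGen {r : ℕ} (u : Fin r → ℂ) {n : ℕ} (g : Gen n) : GenericCyclotomicHecke u n :=
  (GenericCyclotomicHecke.toTensor u n).symm
    (1 ⊗ₜ[BaseRing] Presented.gen (CyclotomicRel qBase (constants u) n) g)

/-- The inclusion of the index set of the generators, for `m ≤ n`. -/
def Gen.castLE {m n : ℕ} (h : m ≤ n) : Gen m → Gen n
  | .X => .X
  | .T i => .T ⟨i.1, i.2.1, i.2.2.trans_le h⟩

/-- For `m ≤ n`, the map `H_m(u₁, …, u_r) → H_n(u₁, …, u_r)` with `X ↦ X` and `T i ↦ T i`. -/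
def cycMap {r : ℕ} (u : Fin r → ℂ) {m n : ℕ} (h : m ≤ n) :
    CyclotomicHecke u m →ₐ[BaseRing] CyclotomicHecke u n :=
  RingQuot.liftAlgHom BaseRing
    ⟨FreeAlgebra.lift BaseRing fun g =>
        Presented.gen (CyclotomicRel qBase (constants u) n) (g.castLE h), by
      intro a b hab
      have key : ∀ c, FreeAlgebra.lift BaseRing (fun g =>
          Presented.gen (CyclotomicRel qBase (constants u) n) (g.castLE h)) c
          = RingQuot.mkAlgHom BaseRing (CyclotomicRel qBase (constants u) n)
            (FreeAlgebra.lift BaseRing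
              (fun g : Gen m => FreeAlgebra.ι BaseRing (g.castLE h)) c) := by
        intro c
        rw [← AlgHom.comp_apply]
        congr 1
        ext g
        simp [Presented.gen]
      rw [key, key]
      apply RingQuot.mkAlgHom_rel
      cases hab with
      | hecke _ _ hh =>
        apply CyclotomicRel.hecke
        cases hh with
        | quadratic i => simpa [Gen.castLE] using HeckeRel.quadratic (q := qBase) (n := n) _
        | braid i j hij =>
          simpa [Gen.castLE] using HeckeRel.braid (q := qBase) (n := n)
            ⟨i.1, i.2.1, i.2.2.trans_le h⟩ ⟨j.1, j.2.1, j.2.2.trans_le h⟩ hij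
        | comm i j hij =>
          simpa [Gen.castLE] using HeckeRel.comm (q := qBase) (n := n)
            ⟨i.1, i.2.1, i.2.2.trans_le h⟩ ⟨j.1, j.2.1, j.2.2.trans_le h⟩ hij
      | X_comm i hi =>
        simpa [Gen.castLE] using CyclotomicRel.X_comm (q := qBase) (u := constants u) (n := n)
          ⟨i.1, i.2.1, i.2.2.trans_le h⟩ hi
      | X_braid i hi =>
        simpa [Gen.castLE] using CyclotomicRel.X_braid (q := qBase) (u := constants u) (n := n)
          ⟨i.1, i.2.1, i.2.2.trans_le h⟩ hi
      | cyclotomic =>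
        have := CyclotomicRel.cyclotomic (q := qBase) (u := constants u) (n := n)
        rw [map_list_prod, List.map_ofFn, map_zero]
        have hfun : (FreeAlgebra.lift BaseRing
              (fun g : Gen m => FreeAlgebra.ι BaseRing (g.castLE h))) ∘
            (fun k : Fin r => fX BaseRing m -
              algebraMap BaseRing (FreeAlgebra BaseRing (Gen m)) (constants u k)) =
            fun k : Fin r => fX BaseRing n -
              algebraMap BaseRing (FreeAlgebra BaseRing (Gen n)) (constants u k) := by
          funext k
          simp only [Function.comp_apply, map_sub, FreeAlgebra.lift_ι_apply, AlgHom.commutes]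
          rfl
        exact hfun ▸ this⟩

/-- For `m ≤ n`, the map `ℋ_m(u₁, …, u_r) → ℋ_n(u₁, …, u_r)` with `X ↦ X` and `T i ↦ T i`. -/
def genericCycMap {r : ℕ} (u : Fin r → ℂ) {m n : ℕ} (h : m ≤ n) :
    GenericCyclotomicHecke u m →ₐ[BaseField] GenericCyclotomicHecke u n :=
  ((GenericCyclotomicHecke.toTensor u n).symm.toAlgHom.comp
    (Algebra.TensorProduct.map (AlgHom.id BaseField BaseField) (cycMap u h))).comp
      (GenericCyclotomicHecke.toTensor u m).toAlgHom

/-- The parameters `u₁ = 1`, `u₂ = 0`. -/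
abbrev oneZero : Fin 2 → ℂ := ![1, 0]

/-- The generic algebra `ℋ_n(1, 0)`. -/
abbrev Cyc (n : ℕ) : Type := GenericCyclotomicHecke oneZero n

/-- The generator `X` of `ℋ_n(1, 0)`. -/
def cX (n : ℕ) : Cyc n := cycGen oneZero Gen.X

/-- The generator `T i` of `ℋ_n(1, 0)`, for `1 ≤ i ≤ n - 1`. -/
def cT {n : ℕ} (i : Set.Ico 1 n) : Cyc n := cycGen oneZero (Gen.T i)

/-- The generator `T 1` of `ℋ_2(1, 0)`. -/
abbrev cT₁ : Cyc 2 := cT ⟨1, le_rfl, one_lt_two⟩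

/-- The element `y_{(∅, 2)}` of `ℋ_2(1, 0)`. -/
def yEmptyTwo : Cyc 2 :=
  (q + 1)⁻¹ • (1 - cX 2 + cT₁ - cX 2 * cT₁ - cT₁ * cX 2 + cX 2 * cT₁ * cX 2
    - cT₁ * cX 2 * cT₁ + cX 2 * cT₁ * cX 2 * cT₁)

/-- The two-sided ideal of `ℋ_n(1, 0)` generated by (the image of) `y_{(∅, 2)}`. -/
def idealEmptyTwo (n : ℕ) (hn : 2 ≤ n) : TwoSidedIdeal (Cyc n) :=
  TwoSidedIdeal.span {genericCycMap oneZero hn yEmptyTwo}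

end Cyclotomic

/-! ## The mirabolic Hecke algebra as a convolution algebra, over a finite field -/

section Convolution

/-- The variety of complete flags `0 = F_0 ⊂ F_1 ⊂ ⋯ ⊂ F_n = V` in `V = F^n`. -/
@[ext]
structure CompleteFlag (F : Type*) [Field F] (n : ℕ) where
  /-- The `i`-th subspace of the flag. -/
  sub : Fin (n + 1) → Submodule F (Fin n → F)
  mono : Monotone sub
  finrank_sub : ∀ i, Module.finrank F (sub i) = i.1

set_option linter.unusedSectionVars false

variable (F : Type*) [Field F] [Finite F] (n : ℕ)

instance : Finite (CompleteFlag F n) :=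
  Finite.of_injective CompleteFlag.sub fun _ _ h => CompleteFlag.ext h

instance : Fintype (CompleteFlag F n) := Fintype.ofFinite _

instance : Fintype (Fin n → F) := Fintype.ofFinite _

/-- The action of `GL(V)` on complete flags. -/
def CompleteFlag.map {F : Type*} [Field F] {n : ℕ} (g : (Fin n → F) ≃ₗ[F] (Fin n → F))
    (f : CompleteFlag F n) : CompleteFlag F n where
  sub i := (f.sub i).map (g : (Fin n → F) →ₗ[F] (Fin n → F))
  mono _ _ hij := Submodule.map_mono (f.mono hij)
  finrank_sub i := by
    rw [← f.finrank_sub i]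
    exact LinearEquiv.finrank_map_eq g (f.sub i)

lemma CompleteFlag.map_symm_map {F : Type*} [Field F] {n : ℕ}
    (g : (Fin n → F) ≃ₗ[F] (Fin n → F)) (f : CompleteFlag F n) :
    (f.map g).map g.symm = f := by
  ext i x
  simp [CompleteFlag.map]

lemma CompleteFlag.map_map_symm {F : Type*} [Field F] {n : ℕ}
    (g : (Fin n → F) ≃ₗ[F] (Fin n → F)) (f : CompleteFlag F n) :
    (f.map g.symm).map g = f := by
  ext i x
  simp [CompleteFlag.map]

/-- `g ∈ GL(V)` as a permutation of the set of complete flags. -/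
def CompleteFlag.mapEquiv {F : Type*} [Field F] {n : ℕ} (g : (Fin n → F) ≃ₗ[F] (Fin n → F)) :
    CompleteFlag F n ≃ CompleteFlag F n where
  toFun := CompleteFlag.map g
  invFun := CompleteFlag.map g.symm
  left_inv := CompleteFlag.map_symm_map g
  right_inv := CompleteFlag.map_map_symm g

/-- The space of `GL(V)`-invariant complex functions on triples (flag, flag, vector). -/
def invariantFunctions :
    Submodule ℂ (CompleteFlag F n → CompleteFlag F n → (Fin n → F) → ℂ) where
  carrier := {α | ∀ (g : (Fin n → F) ≃ₗ[F] (Fin n → F)) f f' v,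
    α (f.map g) (f'.map g) (g v) = α f f' v}
  zero_mem' := by intro g f f' v; rfl
  add_mem' := by
    intro α β hα hβ g f f' v
    simp only [Pi.add_apply, hα g f f' v, hβ g f f' v]
  smul_mem' := by
    intro c α hα g f f' v
    simp only [Pi.smul_apply, hα g f f' v]

/-- The underlying space of the algebra `ℛ_n(#F)`. -/
def MirabolicAt : Type _ := invariantFunctions F n

namespace MirabolicAt

variable {F n}

instance : AddCommGroup (MirabolicAt F n) := inferInstanceAs (AddCommGroup (invariantFunctions F n))

instance : Module ℂ (MirabolicAt F n) := inferInstanceAs (Module ℂ (invariantFunctions F n))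

/-- The function on triples given by an element of `ℛ_n(#F)`. -/
def val (α : MirabolicAt F n) : CompleteFlag F n → CompleteFlag F n → (Fin n → F) → ℂ :=
  Subtype.val (p := (· ∈ invariantFunctions F n)) α

@[ext]
lemma ext {α β : MirabolicAt F n} (h : ∀ f f' v, α.val f f' v = β.val f f' v) : α = β :=
  Subtype.ext (by funext f f' v; exact h f f' v)

lemma invariant (α : MirabolicAt F n) (g : (Fin n → F) ≃ₗ[F] (Fin n → F))
    (f f' : CompleteFlag F n) (v : Fin n → F) :
    α.val (f.map g) (f'.map g) (g v) = α.val f f' v :=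
  α.2 g f f' v

/-- The convolution product. -/
instance : Mul (MirabolicAt F n) where
  mul α β :=
    ⟨fun f f' v => ∑ h : CompleteFlag F n, ∑ u : Fin n → F, α.val f h u * β.val h f' (v - u), by
      intro g f f' v
      symm
      refine Fintype.sum_equiv (CompleteFlag.mapEquiv g) _ _ fun h => ?_
      refine Fintype.sum_equiv g.toEquiv _ _ fun u => ?_
      rw [← α.invariant g f h u, ← β.invariant g h f' (v - u), map_sub]
      rfl⟩

open Classical in
/-- The characteristic function of the triples `(f, f, 0)`. -/
instance : One (MirabolicAt F n) where
  one :=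
    ⟨fun f f' v => if f = f' ∧ v = 0 then 1 else 0, by
      intro g f f' v
      simp only [map_eq_zero_iff g g.injective]
      congr 1
      rw [show (f.map g = f'.map g) = (f = f') from
        propext (CompleteFlag.mapEquiv g).injective.eq_iff]⟩

lemma val_add (α β : MirabolicAt F n) (f f' v) :
    (α + β).val f f' v = α.val f f' v + β.val f f' v := rfl

lemma val_zero (f f' v) : (0 : MirabolicAt F n).val f f' v = 0 := rfl

lemma val_smul (c : ℂ) (α : MirabolicAt F n) (f f' v) :
    (c • α).val f f' v = c * α.val f f' v := rfl

open Classical in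
lemma val_one (f f' v) :
    (1 : MirabolicAt F n).val f f' v = if f = f' ∧ v = 0 then 1 else 0 := rfl

lemma val_mul (α β : MirabolicAt F n) (f f' v) :
    (α * β).val f f' v =
      ∑ h : CompleteFlag F n, ∑ u : Fin n → F, α.val f h u * β.val h f' (v - u) := rfl

instance : Ring (MirabolicAt F n) where
  __ := (inferInstance : AddCommGroup (MirabolicAt F n))
  zero_mul α := by ext; simp [val_mul, val_zero]
  mul_zero α := by ext; simp [val_mul, val_zero]
  left_distrib α β γ := by
    ext; simp [val_mul, val_add, mul_add, Finset.sum_add_distrib]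
  right_distrib α β γ := by
    ext; simp [val_mul, val_add, add_mul, Finset.sum_add_distrib]
  one_mul α := by
    ext f f' v
    rw [val_mul, Finset.sum_eq_single f, Finset.sum_eq_single 0]
    · simp [val_one]
    · intro u _ hu; simp [val_one, hu]
    · simp
    · intro h _ hh; simp [val_one, hh.symm]
    · simp
  mul_one α := by
    ext f f' v
    rw [val_mul, Finset.sum_eq_single f', Finset.sum_eq_single v]
    · simp [val_one]
    · intro u _ hu; simp [val_one, sub_eq_zero, hu.symm]
    · simp
    · intro h _ hh; simp [val_one, hh]
    · simp
  mul_assoc α β γ := by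
    ext f f' v
    simp only [val_mul, Finset.sum_mul, Finset.mul_sum]
    have h1 : ∀ h : CompleteFlag F n,
        (∑ u : Fin n → F, ∑ k : CompleteFlag F n, ∑ w : Fin n → F,
          α.val f k w * β.val k h (u - w) * γ.val h f' (v - u))
        = ∑ k : CompleteFlag F n, ∑ w : Fin n → F, ∑ u : Fin n → F,
          α.val f k w * (β.val k h u * γ.val h f' (v - w - u)) := by
      intro h
      rw [Finset.sum_comm]
      refine Finset.sum_congr rfl fun k _ => ?_
      rw [Finset.sum_comm]
      refine Finset.sum_congr rfl fun w _ => ?_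
      refine Fintype.sum_equiv (Equiv.subRight w) _ _ fun u => ?_
      simp [mul_assoc]
    rw [Finset.sum_congr rfl fun h _ => h1 h, Finset.sum_comm]
    refine Finset.sum_congr rfl fun k _ => ?_
    rw [Finset.sum_comm]

instance : Algebra ℂ (MirabolicAt F n) :=
  Algebra.ofModule
    (fun c α β => by
      ext; simp only [val_mul, val_smul, Finset.mul_sum, mul_assoc])
    (fun c α β => by
      ext; simp only [val_mul, val_smul, Finset.mul_sum, mul_left_comm])

/-- Evaluation `ℂ[𝐪, 𝐪⁻¹] → ℂ` at the nonzero number `𝐪 = #F`. -/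
def evalCard (F : Type*) [Field F] [Finite F] : BaseRing →+* ℂ :=
  LaurentPolynomial.eval₂ (RingHom.id ℂ)
    (Units.mk0 (Nat.card F : ℂ) (Nat.cast_ne_zero.mpr Nat.card_pos.ne'))

/-- `ℛ_n(#F)` as a `ℂ[𝐪, 𝐪⁻¹]`-algebra, where `𝐪` acts as the number `#F`. -/
instance : Algebra BaseRing (MirabolicAt F n) :=
  ((algebraMap ℂ (MirabolicAt F n)).comp (evalCard F)).toAlgebra' fun c x =>
    Algebra.commutes (evalCard F c) x

end MirabolicAt

/-- The pairs `(w, β)` that index the `GL(V)`-orbits on triples (flag, flag, vector). -/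
def Admissible {n : ℕ} (w : Equiv.Perm (Fin n)) (β : Finset (Fin n)) : Prop :=
  ∀ i ∈ β, ∀ j ∉ β, i < j ∨ w.symm i < w.symm j

/-- The triple `(f, f', v)` lies in the orbit indexed by `(w, β)`: there is a basis `b` of `V` with
`f_i = ⟨b_1, …, b_i⟩`, `f'_j = ⟨b_{w(1)}, …, b_{w(j)}⟩` and `v = ∑_{i ∈ β} b_i`. -/
def InOrbit {F : Type*} [Field F] {n : ℕ} (w : Equiv.Perm (Fin n)) (β : Finset (Fin n))
    (f f' : CompleteFlag F n) (v : Fin n → F) : Prop :=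
  ∃ b : Module.Basis (Fin n) F (Fin n → F),
    (∀ i : Fin (n + 1), f.sub i = Submodule.span F (b '' {k | k.1 < i.1})) ∧
    (∀ j : Fin (n + 1), f'.sub j = Submodule.span F ((fun k => b (w k)) '' {k | k.1 < j.1})) ∧
    v = ∑ i ∈ β, b i

lemma InOrbit.map {F : Type*} [Field F] {n : ℕ} {w : Equiv.Perm (Fin n)} {β : Finset (Fin n)}
    {f f' : CompleteFlag F n} {v : Fin n → F} (h : InOrbit w β f f' v)
    (g : (Fin n → F) ≃ₗ[F] (Fin n → F)) : InOrbit w β (f.map g) (f'.map g) (g v) := by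
  obtain ⟨b, h1, h2, h3⟩ := h
  refine ⟨b.map g, fun i => ?_, fun j => ?_, ?_⟩
  · simp only [CompleteFlag.map, h1, Submodule.map_span, ← Set.image_comp]
    rfl
  · simp only [CompleteFlag.map, h2, Submodule.map_span, ← Set.image_comp]
    rfl
  · simp [h3]

open Classical in
/-- The characteristic function `T_{w, β}` of the orbit indexed by `(w, β)`. -/
def orbitFunction (w : Equiv.Perm (Fin n)) (β : Finset (Fin n)) : MirabolicAt F n :=
  ⟨fun f f' v => if InOrbit w β f f' v then 1 else 0, by
    intro g f f' v
    have : InOrbit w β (f.map g) (f'.map g) (g v) ↔ InOrbit w β f f' v := by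
      refine ⟨fun h => ?_, fun h => h.map g⟩
      have := h.map g.symm
      rwa [CompleteFlag.map_symm_map, CompleteFlag.map_symm_map, g.symm_apply_apply] at this
    simp only [this]⟩

end Convolution

/-! ## The mirabolic Hecke algebra, with `𝐪` an indeterminate -/

section Generic

/-- The prime powers `p ^ k` with `k ≥ 1`. -/
structure PrimePower where
  /-- The prime. -/
  p : ℕ
  /-- The exponent. -/
  k : ℕ
  prime : p.Prime
  k_pos : 0 < k

instance (s : PrimePower) : Fact s.p.Prime := ⟨s.prime⟩

/-- The finite field with `p ^ k` elements. -/
abbrev PrimePower.field (s : PrimePower) : Type := GaloisField s.p s.k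

/-- The family of all the characteristic functions `T_{w, β}`, one for each prime power. -/
def orbitFamily {n : ℕ} (w : Equiv.Perm (Fin n)) (β : Finset (Fin n)) :
    ∀ s : PrimePower, MirabolicAt s.field n :=
  fun s => orbitFunction s.field n w β

/-- The mirabolic Hecke algebra `R_n` over `ℂ[𝐪, 𝐪⁻¹]`. The structure constants of the basis
`T_{w, β}` of `ℛ_n(q)` are polynomials in `q`, and `R_n` is the `ℂ[𝐪, 𝐪⁻¹]`-algebra with basis
`T_{w, β}` and with these polynomials as structure constants. It is realized here inside the
product of the `ℛ_n(q)` over all prime powers `q`, on which `𝐪` acts as the number `q` on the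
factor `ℛ_n(q)`: the families `T_{w, β}` are linearly independent over `ℂ[𝐪, 𝐪⁻¹]` (a Laurent
polynomial vanishing at all prime powers is zero), and they multiply with the polynomial structure
constants, so that the subalgebra that they generate is their span. -/
def mirabolicHecke (n : ℕ) : Subalgebra BaseRing (∀ s : PrimePower, MirabolicAt s.field n) :=
  Algebra.adjoin BaseRing {x | ∃ w β, Admissible w β ∧ x = orbitFamily w β}

/-- The generic mirabolic Hecke algebra `ℛ_n = ℂ(𝐪) ⊗ R_n`. -/
def Mir (n : ℕ) : Type := BaseField ⊗[BaseRing] mirabolicHecke n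

instance (n : ℕ) : Ring (Mir n) :=
  inferInstanceAs (Ring (BaseField ⊗[BaseRing] mirabolicHecke n))

instance (n : ℕ) : Algebra BaseField (Mir n) :=
  inferInstanceAs (Algebra BaseField (BaseField ⊗[BaseRing] mirabolicHecke n))

/-- `Mir n` unfolded to the tensor product that defines it. -/
def Mir.toTensor (n : ℕ) : Mir n ≃ₐ[BaseField] BaseField ⊗[BaseRing] mirabolicHecke n :=
  AlgEquiv.refl (R := BaseField) (A₁ := BaseField ⊗[BaseRing] mirabolicHecke n)

/-- The element `T_{w, β}` of `ℛ_n`. -/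
def stdBasis {n : ℕ} (w : Equiv.Perm (Fin n)) (β : Finset (Fin n)) (h : Admissible w β) : Mir n :=
  (Mir.toTensor n).symm
    (1 ⊗ₜ[BaseRing] (⟨orbitFamily w β, Algebra.subset_adjoin ⟨w, β, h, rfl⟩⟩ : mirabolicHecke n))

/-- The element `T₀ = T_{1, {1}}` of `ℛ_n`, given by the triples `(f, f, v)` with
`v ∈ f_1 ∖ {0}`. (Positions are counted from `0` in `Fin n`.) -/
def mT₀ (n : ℕ) : Mir n :=
  stdBasis 1 {k | k.1 = 0} (by
    intro i hi j hj
    simp only [Finset.mem_filter, Finset.mem_univ, true_and] at hi hj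
    exact Or.inl (Fin.lt_def.mpr (by omega)))

/-- The element `T_i = T_{s_i, ∅}` of `ℛ_n`, for `1 ≤ i ≤ n - 1`, where `s_i = (i, i + 1)`.
(Positions are counted from `0` in `Fin n`, so that `s_i` exchanges `i - 1` and `i`.) -/
def mT {n : ℕ} (i : Set.Ico 1 n) : Mir n :=
  stdBasis (Equiv.swap ⟨i.1 - 1, (Nat.sub_le _ _).trans_lt i.2.2⟩ ⟨i.1, i.2.2⟩) ∅
    (by intro i hi; simp at hi)

/-- The element `e = 𝐪⁻¹ (T₀ + 1)` of `ℛ_n`. -/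
def mE (n : ℕ) : Mir n := q⁻¹ • (mT₀ n + 1)

end Generic

end Mirabolic

end

/-!
The algebra given by the new relations is mapped onto the mirabolic Hecke algebra, and the two are
compared through one spanning family and one linearly independent family, both indexed by the
orbits `(w, β)`. Write `n = m + 1`, count generators and positions from `0`, and put `a = 𝐪 e`.

On the geometric side the characteristic functions of the orbits are replaced by those of the
*cells* `⋃_{β' ⊆ β} (w, β')` (`cellFn`): a triple `(f, f', v)` lies in the cell of `(w, β)` when
`f, f'` have a common adapted basis `b` in relative position `w` and `v` is in the span of the `b_i`
with `i ∈ β`. Cells multiply in a simple way (`CellSystem`): `T_i` applied on the left to the cell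
of `(w, β)` at an ascent `i` of `w` permutes the index to `(s_i w, s_i β)`, and `a`, which is the
cell of `(1, {0})`, either adjoins `0` to `β` or multiplies by `𝐪`. The new relations follow from
these rules and from one count of the lines in a plane (`cellFn_rank_two`). The cells are related to
the basis of the orbits by a unitriangular matrix, and the orbit functions are linearly
independent over `ℂ[𝐪, 𝐪⁻¹]` because a Laurent polynomial that vanishes at all prime powers is zero,
so the cells are linearly independent over `ℂ(𝐪)` (`linearIndependent_cellMir`).

On the algebraic side, in any algebra with the new relations there are elements `flagElt k`, which
play the part of the cell of `(1, {0, …, k - 1})`, and normal forms `normalElt w β`. A good descent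
of `(w, β)` can be peeled off from the left, and a pair without good descents has for `β` an initial
set. The rules for multiplying normal forms by a generator (`tau_mul_normalElt_of_isDescent`,
`a_mul_normalElt`) show that they span the algebra (`normalSpan_eq_top`). The homomorphism to the
mirabolic Hecke algebra sends the normal form of `(w, β)` to its cell
(`CellSystem.normalElt_eq_cell`). A spanning family is thus sent to a linearly independent one, and
the homomorphism is bijective.

For `e = 𝐪⁻¹ (T₀ + 1)` and Solomon's relations, the difference of the two sides of each relation in
one list is `𝐪` or `𝐪²` times the corresponding difference in the other. Finally, the extra relation
says that `1 - e + T₁ - e T₁ - T₁ e + e T₁ e - T₁ e T₁ + e T₁ e T₁`, which is `(𝐪 + 1)` times the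
image of `y_{(∅, 2)}`, is zero; the other relations are those of `ℋ_n(1, 0)`.
-/

namespace Mirabolic

/-! ### The commuting idempotents in an algebra with the new relations -/

/-- The new relations, written for `a = q e` and for generators `τ i = T_{i+1}` that are indexed
from `0`; only the `τ i` with `i < m` matter. -/
structure MirRel {K A : Type*} [Field K] [Ring A] [Algebra K A] (q : K) (m : ℕ) (a : A)
    (τ : ℕ → A) : Prop where
  q_ne : q ≠ 0
  quad : ∀ i < m, τ i * τ i = (q - 1) • τ i + q • (1 : A)
  braid : ∀ i, i + 1 < m → τ i * τ (i + 1) * τ i = τ (i + 1) * τ i * τ (i + 1)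
  comm : ∀ i j, i + 2 ≤ j → j < m → τ i * τ j = τ j * τ i
  idem : a * a = q • a
  a_comm : ∀ i, 1 ≤ i → i < m → a * τ i = τ i * a
  a_braid : 0 < m → a * τ 0 * a * τ 0 = τ 0 * a * τ 0 * a
  extra : 0 < m → a * τ 0 * a * τ 0 + a * τ 0 * a =
    q • ((τ 0 + 1) * a * (τ 0 + 1)) - q ^ 2 • (τ 0 + 1)

section Elements

variable {K A : Type*} [Field K] [Ring A] [Algebra K A] (q : K) (a : A) (τ : ℕ → A)

/-- The conjugates `τ_{j-1} ⋯ τ_0 a τ_0⁻¹ ⋯ τ_{j-1}⁻¹` of `a`; the inverse of `τ i` is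
`q⁻¹ (τ i - (q - 1))`. -/
def conjA : ℕ → A
  | 0 => a
  | j + 1 => τ j * conjA j * (q⁻¹ • (τ j - (q - 1) • 1))

/-- The product `conjA r * conjA (r + 1) * ⋯` with `d` factors. -/
def conjProd (r : ℕ) : ℕ → A
  | 0 => 1
  | d + 1 => conjA q a τ r * conjProd (r + 1) d

/-- The product `τ r * τ (r + 1) * ⋯` with `d` factors. -/
def tauProd (r : ℕ) : ℕ → A
  | 0 => 1
  | d + 1 => τ r * tauProd (r + 1) d

/-- The element `conjA 0 * ⋯ * conjA (k - 1)`. In the convolution algebra it is the characteristic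
function of the triples `(f, f, v)` with `v ∈ f_k`. -/
def flagElt (k : ℕ) : A := conjProd q a τ 0 k

@[simp] lemma conjA_zero : conjA q a τ 0 = a := rfl

@[simp] lemma flagElt_zero : flagElt q a τ 0 = 1 := rfl

lemma flagElt_one : flagElt q a τ 1 = a := by simp [flagElt, conjProd]

lemma conjProd_succ_right (r d : ℕ) :
    conjProd q a τ r (d + 1) = conjProd q a τ r d * conjA q a τ (r + d) := by
  induction d generalizing r with
  | zero => simp [conjProd]
  | succ d ih => rw [conjProd, ih, conjProd, mul_assoc, add_right_comm r 1 d, add_assoc r d 1]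

lemma flagElt_succ (k : ℕ) : flagElt q a τ (k + 1) = flagElt q a τ k * conjA q a τ k := by
  rw [flagElt, conjProd_succ_right, zero_add, flagElt]

end Elements

namespace MirRel

variable {K A : Type*} [Field K] [Ring A] [Algebra K A] {q : K} {m : ℕ} {a : A} {τ : ℕ → A}

lemma tau_mul_inv (H : MirRel q m a τ) {i : ℕ} (hi : i < m) :
    τ i * (q⁻¹ • (τ i - (q - 1) • 1)) = 1 := by
  rw [mul_smul_comm, mul_sub, H.quad i hi, mul_smul_comm, mul_one, add_sub_cancel_left, smul_smul,
    inv_mul_cancel₀ H.q_ne, one_smul]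

lemma inv_mul_tau (H : MirRel q m a τ) {i : ℕ} (hi : i < m) :
    (q⁻¹ • (τ i - (q - 1) • 1)) * τ i = 1 := by
  rw [smul_mul_assoc, sub_mul, H.quad i hi, smul_mul_assoc, one_mul, add_sub_cancel_left, smul_smul,
    inv_mul_cancel₀ H.q_ne, one_smul]

lemma isUnit_tau (H : MirRel q m a τ) {i : ℕ} (hi : i < m) : IsUnit (τ i) :=
  ⟨⟨τ i, _, H.tau_mul_inv hi, H.inv_mul_tau hi⟩, rfl⟩

lemma conjA_succ_mul (H : MirRel q m a τ) {j : ℕ} (hj : j < m) :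
    conjA q a τ (j + 1) * τ j = τ j * conjA q a τ j := by
  rw [conjA, mul_assoc, H.inv_mul_tau hj, mul_one]

lemma tau_comm_conjA_of_lt (H : MirRel q m a τ) {i j : ℕ} (hj : j < i) (hi : i < m) :
    Commute (τ i) (conjA q a τ j) := by
  induction j with
  | zero => exact (H.a_comm i hj hi).symm
  | succ j ih =>
    have h : Commute (τ i) (τ j) := (H.comm j i hj hi).symm
    exact (h.mul_right (ih (by omega))).mul_right
      ((h.sub_right ((Commute.one_right _).smul_right _)).smul_right _)

lemma tau_comm_conjA_of_le (H : MirRel q m a τ) {i j : ℕ} (hij : i + 2 ≤ j) (hj : j ≤ m) :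
    Commute (τ i) (conjA q a τ j) := by
  induction j, hij using Nat.le_induction with
  | base =>
    have h0 : i + 1 < m := by omega
    have hu := (H.isUnit_tau h0).mul (H.isUnit_tau (i := i) (by omega))
    have h1 : conjA q a τ (i + 2) * (τ (i + 1) * τ i) = τ (i + 1) * τ i * conjA q a τ i := by
      rw [← mul_assoc, H.conjA_succ_mul h0, mul_assoc, H.conjA_succ_mul (by omega), mul_assoc]
    have h2 := (H.tau_comm_conjA_of_lt (Nat.lt_succ_self i) h0).eq
    refine hu.mul_right_cancel ?_
    calc τ i * conjA q a τ (i + 2) * (τ (i + 1) * τ i)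
        = (τ i * τ (i + 1) * τ i) * conjA q a τ i := by rw [mul_assoc, h1]; simp only [mul_assoc]
      _ = τ (i + 1) * τ i * conjA q a τ i * τ (i + 1) := by
          rw [H.braid i h0]; simp only [mul_assoc, h2]
      _ = conjA q a τ (i + 2) * (τ (i + 1) * τ i * τ (i + 1)) := by
          rw [← h1]; simp only [mul_assoc]
      _ = conjA q a τ (i + 2) * τ i * (τ (i + 1) * τ i) := by
          rw [← H.braid i h0]; simp only [mul_assoc]
  | succ j hj' ih =>
    have h : Commute (τ i) (τ j) := H.comm i j hj' hj
    exact (h.mul_right (ih (by omega))).mul_right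
      ((h.sub_right ((Commute.one_right _).smul_right _)).smul_right _)

/-- Conjugation by `τ i * τ (i + 1)` carries the pair `(conjA i, τ i)` to
`(conjA (i + 1), τ (i + 1))`. -/
lemma conj_shift (H : MirRel q m a τ) {i : ℕ} (hi : i + 1 < m) :
    τ i * τ (i + 1) * conjA q a τ i = conjA q a τ (i + 1) * (τ i * τ (i + 1)) ∧
    τ i * τ (i + 1) * τ i = τ (i + 1) * (τ i * τ (i + 1)) := by
  constructor
  · rw [mul_assoc, (H.tau_comm_conjA_of_lt (Nat.lt_succ_self i) hi).eq, ← mul_assoc,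
      ← H.conjA_succ_mul (by omega), mul_assoc]
  · rw [H.braid i hi, mul_assoc]

lemma conjA_braid (H : MirRel q m a τ) {i : ℕ} (hi : i < m) :
    conjA q a τ i * τ i * conjA q a τ i * τ i = τ i * conjA q a τ i * τ i * conjA q a τ i := by
  induction i with
  | zero => exact H.a_braid hi
  | succ i ih =>
    obtain ⟨h1, h2⟩ := H.conj_shift hi
    have hu := (H.isUnit_tau (i := i) (by omega)).mul (H.isUnit_tau hi)
    refine hu.mul_right_cancel ?_
    have h := congrArg (fun z => τ i * τ (i + 1) * z) (ih (by omega))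
    generalize conjA q a τ (i + 1) = M' at *
    generalize τ i * τ (i + 1) = u at *
    simp only [← mul_assoc, h1, h2] at h
    simp only [mul_assoc, h1, h2] at h ⊢
    exact h

lemma conjA_extra (H : MirRel q m a τ) {i : ℕ} (hi : i < m) :
    conjA q a τ i * τ i * conjA q a τ i * τ i + conjA q a τ i * τ i * conjA q a τ i =
      q • ((τ i + 1) * conjA q a τ i * (τ i + 1)) - q ^ 2 • (τ i + 1) := by
  induction i with
  | zero => exact H.extra hi
  | succ i ih =>
    obtain ⟨h1, h2⟩ := H.conj_shift hi
    have hu := (H.isUnit_tau (i := i) (by omega)).mul (H.isUnit_tau hi)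
    refine hu.mul_right_cancel ?_
    have h := congrArg (fun z => τ i * τ (i + 1) * z) (ih (by omega))
    generalize conjA q a τ (i + 1) = M' at *
    generalize τ i * τ (i + 1) = u at *
    simp only [mul_add, add_mul, mul_sub, mul_smul_comm, one_mul, mul_one,
      ← mul_assoc, h1, h2] at h
    simp only [mul_add, add_mul, sub_mul, smul_mul_assoc, one_mul, mul_one, mul_assoc, h1, h2]
      at h ⊢
    exact h

lemma conjA_mul_conjA_succ_mul (H : MirRel q m a τ) {i : ℕ} (hi : i < m) :
    conjA q a τ i * conjA q a τ (i + 1) * τ i = conjA q a τ i * τ i * conjA q a τ i := by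
  rw [mul_assoc, H.conjA_succ_mul hi, mul_assoc]

lemma tau_comm_conjA_mul_conjA (H : MirRel q m a τ) {i : ℕ} (hi : i < m) :
    Commute (τ i) (conjA q a τ i * conjA q a τ (i + 1)) := by
  refine (H.isUnit_tau hi).mul_right_cancel ?_
  rw [mul_assoc, H.conjA_mul_conjA_succ_mul hi, H.conjA_braid hi]
  simp only [mul_assoc]

lemma tau_mul_conjA_mul_tau (H : MirRel q m a τ) {i : ℕ} (hi : i < m) :
    (τ i + 1) * conjA q a τ i * (τ i + 1) =
      (conjA q a τ i * conjA q a τ (i + 1) + q • 1) * (τ i + 1) := by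
  have h1 := H.conjA_extra hi
  have h2 : q • (conjA q a τ i * conjA q a τ (i + 1) * (τ i + 1)) =
      conjA q a τ i * τ i * conjA q a τ i * τ i + conjA q a τ i * τ i * conjA q a τ i := by
    refine (H.isUnit_tau hi).mul_right_cancel ?_
    have h3 := H.conjA_mul_conjA_succ_mul hi
    have h4 := H.quad i hi
    generalize conjA q a τ i * conjA q a τ (i + 1) = N at *
    rw [← h3, smul_mul_assoc, mul_assoc N, add_mul, h4, add_mul]
    simp only [mul_assoc, h4]
    simp only [mul_add, mul_smul_comm, mul_one, one_mul, add_mul, smul_mul_assoc, h4]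
    module
  rw [add_mul (_ * _) (q • (1 : A)), smul_mul_assoc, one_mul]
  have h5 : q • ((τ i + 1) * conjA q a τ i * (τ i + 1)) =
      q • (conjA q a τ i * conjA q a τ (i + 1) * (τ i + 1) + q • (τ i + 1)) := by
    rw [smul_add, h2, h1, smul_smul, ← pow_two, sub_add_cancel]
  exact smul_right_injective A H.q_ne h5

lemma tau_comm_conjProd (H : MirRel q m a τ) {i r d : ℕ} (hi : i + 2 ≤ r) (hd : r + d ≤ m + 1) :
    Commute (τ i) (conjProd q a τ r d) := by
  induction d generalizing r with
  | zero => exact Commute.one_right _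
  | succ d ih =>
    exact (H.tau_comm_conjA_of_le hi (by omega)).mul_right (ih (by omega) (by omega))

lemma tau_comm_flagElt (H : MirRel q m a τ) {i k : ℕ} (hi : i < m) (hk : k ≤ m + 1)
    (hik : i + 1 ≠ k) : Commute (τ i) (flagElt q a τ k) := by
  induction k using Nat.strong_induction_on with
  | _ k ih =>
    match k, ih, hk, hik with
    | 0, _, _, _ => exact Commute.one_right _
    | 1, _, _, hik =>
      rw [flagElt_one]
      exact H.tau_comm_conjA_of_lt (j := 0) (by omega) hi
    | k + 2, ih, hk, hik =>
      rcases eq_or_ne i k with rfl | hne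
      · rw [flagElt_succ, flagElt_succ, mul_assoc]
        exact (ih i (by omega) (by omega) (by omega)).mul_right (H.tau_comm_conjA_mul_conjA hi)
      · rw [flagElt_succ]
        refine (ih (k + 1) (by omega) (by omega) (by omega)).mul_right ?_
        rcases lt_or_gt_of_ne hne with h | h
        · exact H.tau_comm_conjA_of_le (by omega) (by omega)
        · exact H.tau_comm_conjA_of_lt (by omega) hi

lemma a_mul_flagElt (H : MirRel q m a τ) {k : ℕ} (hk : 1 ≤ k) :
    a * flagElt q a τ k = q • flagElt q a τ k := by
  obtain ⟨k, rfl⟩ := Nat.exists_eq_add_of_le' hk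
  rw [flagElt, conjProd, conjA_zero, ← mul_assoc, H.idem, smul_mul_assoc]

/-- The relation `extra`, conjugated to an arbitrary position. In the convolution algebra it counts
the flags that differ from a given flag only in the subspace of dimension `i + 1` and for which
this subspace contains a given vector. -/
lemma tau_mul_flagElt_mul_tau (H : MirRel q m a τ) {i : ℕ} (hi : i < m) :
    (τ i + 1) * flagElt q a τ (i + 1) * (τ i + 1) =
      (flagElt q a τ (i + 2) + q • flagElt q a τ i) * (τ i + 1) := by
  have h1 : Commute (τ i + 1) (flagElt q a τ i) :=
    (H.tau_comm_flagElt hi (by omega) (by omega)).add_left (Commute.one_left _)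
  rw [flagElt_succ, ← mul_assoc, h1.eq, mul_assoc, mul_assoc, ← mul_assoc (τ i + 1),
    H.tau_mul_conjA_mul_tau hi, flagElt_succ, flagElt_succ, ← mul_assoc]
  congr 1
  rw [mul_add, mul_smul_comm, mul_one, mul_assoc]

lemma tauProd_comm_conjA (H : MirRel q m a τ) {j r d : ℕ} (hj : j < r) (hd : r + d ≤ m) :
    Commute (tauProd τ r d) (conjA q a τ j) := by
  induction d generalizing r with
  | zero => exact Commute.one_left _
  | succ d ih =>
    exact (H.tau_comm_conjA_of_lt hj (by omega)).mul_left (ih (by omega) (by omega))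

lemma tauProd_mul_conjProd (H : MirRel q m a τ) {r d : ℕ} (hd : r + d ≤ m) :
    tauProd τ r d * conjProd q a τ r d = conjProd q a τ (r + 1) d * tauProd τ r d := by
  induction d generalizing r with
  | zero => rfl
  | succ d ih =>
    have h1 := (H.tauProd_comm_conjA (Nat.lt_succ_self r) (d := d) (by omega)).eq
    have h2 := (H.tau_comm_conjProd (i := r) (r := r + 2) (d := d) le_rfl (by omega)).eq
    simp only [tauProd, conjProd]
    calc τ r * tauProd τ (r + 1) d * (conjA q a τ r * conjProd q a τ (r + 1) d)
        = τ r * (tauProd τ (r + 1) d * conjA q a τ r) * conjProd q a τ (r + 1) d := by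
          simp only [mul_assoc]
      _ = τ r * conjA q a τ r * (tauProd τ (r + 1) d * conjProd q a τ (r + 1) d) := by
          rw [h1]; simp only [mul_assoc]
      _ = conjA q a τ (r + 1) * (τ r * conjProd q a τ (r + 2) d) * tauProd τ (r + 1) d := by
          rw [ih (by omega), ← H.conjA_succ_mul (by omega)]; simp only [mul_assoc]
      _ = _ := by rw [h2]; simp only [mul_assoc]

/-- The recursion that computes `flagElt (k + 1)` from `flagElt k`. -/
lemma a_mul_tauProd_mul_flagElt (H : MirRel q m a τ) {k : ℕ} (hk : k ≤ m) :
    a * tauProd τ 0 k * flagElt q a τ k = flagElt q a τ (k + 1) * tauProd τ 0 k := by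
  rw [flagElt, mul_assoc, H.tauProd_mul_conjProd (by omega), flagElt, conjProd, conjA_zero,
    mul_assoc]

lemma tauProd_comm_flagElt (H : MirRel q m a τ) {r d k : ℕ} (hd : r + d < k) (hk : k ≤ m + 1) :
    Commute (tauProd τ r d) (flagElt q a τ k) := by
  induction d generalizing r with
  | zero => exact Commute.one_left _
  | succ d ih =>
    exact (H.tau_comm_flagElt (by omega) hk (by omega)).mul_left (ih (by omega))

end MirRel

/-! ### The index set of the orbits and the simple reflections -/

section Combinatorics

variable {m : ℕ}

/-- The simple reflection that exchanges the positions `i` and `i + 1`. -/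
def simpleRefl (i : Fin m) : Equiv.Perm (Fin (m + 1)) := Equiv.swap i.castSucc i.succ

/-- The image of a set of positions under a permutation. -/
def moveSet (g : Equiv.Perm (Fin (m + 1))) (β : Finset (Fin (m + 1))) : Finset (Fin (m + 1)) :=
  β.map g.toEmbedding

/-- The positions `i` and `i + 1` occur in the opposite order in `w(0), w(1), …`. -/
def IsDescent (i : Fin m) (w : Equiv.Perm (Fin (m + 1))) : Prop :=
  w.symm i.succ < w.symm i.castSucc

/-- A descent of `w` at which the pair `(w, β)` arises from the shorter admissible pair
`(s_i w, s_i β)`. -/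
def IsGood (i : Fin m) (w : Equiv.Perm (Fin (m + 1))) (β : Finset (Fin (m + 1))) : Prop :=
  IsDescent i w ∧ (i.castSucc ∈ β → i.succ ∈ β)

/-- A statistic of permutations that decreases when a descent is removed. -/
def weight (w : Equiv.Perm (Fin (m + 1))) : ℕ := ∑ j, (m - j.1) * (w.symm j).1

/-- The set `{0, …, k - 1}` of positions. -/
def initialSet (m k : ℕ) : Finset (Fin (m + 1)) := {j | j.1 < k}

@[simp] lemma mem_moveSet {g : Equiv.Perm (Fin (m + 1))} {β : Finset (Fin (m + 1))}
    {j : Fin (m + 1)} : j ∈ moveSet g β ↔ g.symm j ∈ β := by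
  rw [moveSet, Finset.mem_map_equiv]

@[simp] lemma mem_initialSet {k : ℕ} {j : Fin (m + 1)} : j ∈ initialSet m k ↔ j.1 < k := by
  simp [initialSet]

lemma card_initialSet {k : ℕ} (hk : k ≤ m + 1) : (initialSet m k).card = k := by
  rw [initialSet, Fin.card_filter_val_lt, min_eq_right hk]

@[simp] lemma initialSet_zero : initialSet m 0 = ∅ := by ext; simp

@[simp] lemma moveSet_empty (g : Equiv.Perm (Fin (m + 1))) : moveSet g ∅ = ∅ := rfl

lemma moveSet_moveSet (g h : Equiv.Perm (Fin (m + 1))) (β : Finset (Fin (m + 1))) :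
    moveSet g (moveSet h β) = moveSet (g * h) β := by
  ext; simp [Equiv.Perm.mul_def]

lemma moveSet_insert (g : Equiv.Perm (Fin (m + 1))) (β : Finset (Fin (m + 1))) (j) :
    moveSet g (insert j β) = insert (g j) (moveSet g β) := by
  ext k; simp [Equiv.symm_apply_eq]

lemma moveSet_erase (g : Equiv.Perm (Fin (m + 1))) (β : Finset (Fin (m + 1))) (j) :
    moveSet g (β.erase j) = (moveSet g β).erase (g j) := by
  ext k; simp [Equiv.symm_apply_eq]

@[simp] lemma simpleRefl_symm (i : Fin m) : (simpleRefl i).symm = simpleRefl i :=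
  Equiv.symm_swap _ _

@[simp] lemma simpleRefl_castSucc (i : Fin m) : simpleRefl i i.castSucc = i.succ :=
  Equiv.swap_apply_left _ _

@[simp] lemma simpleRefl_succ (i : Fin m) : simpleRefl i i.succ = i.castSucc :=
  Equiv.swap_apply_right _ _

lemma simpleRefl_of_ne {i : Fin m} {j : Fin (m + 1)} (h1 : j ≠ i.castSucc) (h2 : j ≠ i.succ) :
    simpleRefl i j = j := Equiv.swap_apply_of_ne_of_ne h1 h2

@[simp] lemma simpleRefl_simpleRefl (i : Fin m) (j : Fin (m + 1)) :
    simpleRefl i (simpleRefl i j) = j := Equiv.swap_apply_self _ _ _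

@[simp] lemma simpleRefl_mul_self (i : Fin m) : simpleRefl i * simpleRefl i = 1 :=
  Equiv.swap_mul_self _ _

@[simp] lemma simpleRefl_mul_mul (i : Fin m) (w : Equiv.Perm (Fin (m + 1))) :
    simpleRefl i * (simpleRefl i * w) = w := by rw [← mul_assoc, simpleRefl_mul_self, one_mul]

@[simp] lemma mul_symm_apply (g w : Equiv.Perm (Fin (m + 1))) (j : Fin (m + 1)) :
    (g * w).symm j = w.symm (g.symm j) := rfl

@[simp] lemma moveSet_one (β : Finset (Fin (m + 1))) : moveSet 1 β = β := by
  ext; rw [mem_moveSet]; rfl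

@[simp] lemma moveSet_simpleRefl_twice (i : Fin m) (β : Finset (Fin (m + 1))) :
    moveSet (simpleRefl i) (moveSet (simpleRefl i) β) = β := by
  rw [moveSet_moveSet, simpleRefl_mul_self, moveSet_one]

lemma simpleRefl_far {i j : Fin m} (h : i.1 + 2 ≤ j.1 ∨ j.1 + 2 ≤ i.1) :
    simpleRefl i j.castSucc = j.castSucc ∧ simpleRefl i j.succ = j.succ := by
  constructor <;> apply simpleRefl_of_ne <;> simp only [ne_eq, Fin.ext_iff, Fin.val_castSucc, Fin.val_succ] <;> omega

lemma simpleRefl_mul_comm {i j : Fin m} (h : i.1 + 2 ≤ j.1 ∨ j.1 + 2 ≤ i.1) :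
    simpleRefl i * simpleRefl j = simpleRefl j * simpleRefl i := by
  obtain ⟨h1, h2⟩ := simpleRefl_far h
  conv_lhs => rw [simpleRefl.eq_def j, Equiv.mul_swap_eq_swap_mul, h1, h2]
  rfl

lemma castSucc_eq_succ {i j : Fin m} (h : j.1 = i.1 + 1) : j.castSucc = i.succ := by
  ext; simp [h]

lemma simpleRefl_next_castSucc {i j : Fin m} (h : j.1 = i.1 + 1) :
    simpleRefl j i.castSucc = i.castSucc := by
  apply simpleRefl_of_ne <;> simp only [ne_eq, Fin.ext_iff, Fin.val_castSucc, Fin.val_succ] <;> omega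

lemma simpleRefl_next_succ {i j : Fin m} (h : j.1 = i.1 + 1) :
    simpleRefl j i.succ = j.succ := by
  rw [← castSucc_eq_succ h, simpleRefl_castSucc]

lemma simpleRefl_prev_succ {i j : Fin m} (h : j.1 = i.1 + 1) :
    simpleRefl i j.succ = j.succ := by
  apply simpleRefl_of_ne <;> simp only [ne_eq, Fin.ext_iff, Fin.val_castSucc, Fin.val_succ] <;> omega

lemma simpleRefl_braid {i j : Fin m} (h : j.1 = i.1 + 1) :
    simpleRefl i * simpleRefl j * simpleRefl i = simpleRefl j * simpleRefl i * simpleRefl j := by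
  have h1 : simpleRefl i * simpleRefl j = Equiv.swap i.castSucc j.succ * simpleRefl i := by
    rw [simpleRefl.eq_def j, Equiv.mul_swap_eq_swap_mul, castSucc_eq_succ h, simpleRefl_succ,
      simpleRefl_prev_succ h]
  have h2 : simpleRefl j * simpleRefl i = Equiv.swap i.castSucc j.succ * simpleRefl j := by
    rw [simpleRefl.eq_def i, Equiv.mul_swap_eq_swap_mul, simpleRefl_next_castSucc h,
      simpleRefl_next_succ h]
  rw [h1, h2, mul_assoc, mul_assoc, simpleRefl_mul_self, simpleRefl_mul_self]

lemma weight_lt {i : Fin m} {w : Equiv.Perm (Fin (m + 1))} (h : IsDescent i w) :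
    weight (simpleRefl i * w) < weight w := by
  have h1 : weight (simpleRefl i * w) = ∑ j, (m - (simpleRefl i j).1) * (w.symm j).1 := by
    refine Fintype.sum_equiv (simpleRefl i) _ _ fun j => ?_
    simp
  rw [h1, weight, ← Nat.cast_lt (α := ℤ), ← sub_neg]
  push_cast
  rw [← Finset.sum_sub_distrib, Fintype.sum_eq_add i.castSucc i.succ (Fin.castSucc_lt_succ).ne]
  · have h2 : i.1 < m := i.2
    have h3 : (w.symm i.succ).1 < (w.symm i.castSucc).1 := h
    rw [simpleRefl_castSucc, simpleRefl_succ, Fin.val_castSucc, Fin.val_succ, Nat.cast_sub h2.le,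
      Nat.cast_sub h2]
    push_cast
    nlinarith
  · rintro j ⟨h2, h3⟩
    rw [simpleRefl_of_ne h2 h3, sub_self]

lemma exists_eq_initialSet {β : Finset (Fin (m + 1))}
    (h : ∀ i : Fin m, i.succ ∈ β → i.castSucc ∈ β) : ∃ k ≤ m + 1, β = initialSet m k := by
  by_cases hβ : ∃ k : ℕ, ∃ hk : k < m + 1, (⟨k, hk⟩ : Fin (m + 1)) ∉ β
  · classical
    obtain ⟨hk, hk'⟩ := Nat.find_spec hβ
    refine ⟨Nat.find hβ, hk.le, ?_⟩
    have hup : ∀ j (hj : j < m + 1), Nat.find hβ ≤ j → (⟨j, hj⟩ : Fin (m + 1)) ∉ β := by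
      intro j hj hle
      induction j, hle using Nat.le_induction with
      | base => exact hk'
      | succ j hle ih => exact fun h' => ih (by omega) (h ⟨j, by omega⟩ h')
    ext j
    rw [mem_initialSet]
    refine ⟨fun hj => not_le.mp fun hle => hup j.1 j.2 hle hj, fun hj => ?_⟩
    by_contra h'
    exact Nat.find_min hβ hj ⟨j.2, h'⟩
  · push Not at hβ
    refine ⟨m + 1, le_rfl, ?_⟩
    ext j
    exact iff_of_true (hβ j.1 j.2) (by simp [Nat.lt_succ_iff.mp j.2])

lemma admissible_empty (w : Equiv.Perm (Fin (m + 1))) : Admissible w ∅ := by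
  intro i hi
  simp at hi

lemma Admissible.mem_of_le {n : ℕ} {w : Equiv.Perm (Fin n)} {β : Finset (Fin n)}
    (h : Admissible w β) {i j : Fin n} (hi : i ∈ β) (h1 : j ≤ i) (h2 : w.symm j ≤ w.symm i) :
    j ∈ β := by
  by_contra hj
  rcases h i hi j hj with h3 | h3
  · exact absurd h1 (not_le.mpr h3)
  · exact absurd h2 (not_le.mpr h3)

lemma admissible_iff {n : ℕ} {w : Equiv.Perm (Fin n)} {β : Finset (Fin n)} :
    Admissible w β ↔ ∀ i ∈ β, ∀ j, j ≤ i → w.symm j ≤ w.symm i → j ∈ β := by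
  refine ⟨fun h i hi j h1 h2 => h.mem_of_le hi h1 h2, fun h i hi j hj => ?_⟩
  by_contra hc
  push Not at hc
  exact hj (h i hi j hc.1 hc.2)

lemma admissible_initialSet (w : Equiv.Perm (Fin (m + 1))) (k : ℕ) :
    Admissible w (initialSet m k) := by
  rw [admissible_iff]
  intro i hi j h1 _
  rw [mem_initialSet] at *
  exact lt_of_le_of_lt h1 hi

lemma Admissible.isDescent {w : Equiv.Perm (Fin (m + 1))} {β : Finset (Fin (m + 1))}
    (h : Admissible w β) {i : Fin m} (h1 : i.castSucc ∉ β) (h2 : i.succ ∈ β) :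
    IsDescent i w := by
  rcases h _ h2 _ h1 with h3 | h3
  · exact absurd h3 (not_lt.mpr Fin.castSucc_lt_succ.le)
  · exact h3

/-- A pair of positions in increasing order keeps this order under a simple reflection, unless it
is the pair that the reflection exchanges. -/
lemma simpleRefl_lt_simpleRefl {i : Fin m} {j k : Fin (m + 1)} (h : j < k)
    (hne : ¬ (j = i.castSucc ∧ k = i.succ)) : simpleRefl i j < simpleRefl i k := by
  rw [simpleRefl, Equiv.swap_apply_def, Equiv.swap_apply_def]
  simp only [Fin.ext_iff, Fin.lt_def, Fin.val_castSucc, Fin.val_succ] at *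
  split_ifs <;> (try simp only [Fin.val_castSucc, Fin.val_succ]) <;> omega

lemma Admissible.moveSet {w : Equiv.Perm (Fin (m + 1))} {β : Finset (Fin (m + 1))}
    (h : Admissible w β) {i : Fin m} (hi : i.castSucc ∈ β → i.succ ∈ β) :
    Admissible (simpleRefl i * w) (moveSet (simpleRefl i) β) := by
  rw [admissible_iff]
  intro j hj k h1 h2
  rw [mem_moveSet, simpleRefl_symm] at hj ⊢
  simp only [mul_symm_apply, simpleRefl_symm] at h2
  rcases h1.eq_or_lt with rfl | h1
  · exact hj
  by_cases hne : k = i.castSucc ∧ j = i.succ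
  · obtain ⟨rfl, rfl⟩ := hne
    simp only [simpleRefl_castSucc, simpleRefl_succ] at *
    exact hi hj
  · exact h.mem_of_le hj (simpleRefl_lt_simpleRefl h1 hne).le h2

lemma Admissible.moveSet_of_lt {w : Equiv.Perm (Fin (m + 1))} {β : Finset (Fin (m + 1))}
    (h : Admissible w β) {i : Fin m} (hi : w.symm i.castSucc < w.symm i.succ) :
    Admissible (simpleRefl i * w) (Mirabolic.moveSet (simpleRefl i) β) := by
  rw [admissible_iff]
  intro j hj k h1 h2
  rw [mem_moveSet, simpleRefl_symm] at hj ⊢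
  simp only [mul_symm_apply, simpleRefl_symm] at h2
  rcases h1.eq_or_lt with rfl | h1
  · exact hj
  by_cases hne : k = i.castSucc ∧ j = i.succ
  · obtain ⟨rfl, rfl⟩ := hne
    simp only [simpleRefl_castSucc, simpleRefl_succ] at *
    exact absurd h2 (not_le.mpr hi)
  · exact h.mem_of_le hj (simpleRefl_lt_simpleRefl h1 hne).le h2

/-- If `i` is a descent of `w` with `i ∈ β` and `i + 1 ∉ β`, then `β ∪ {i + 1}`, `β` and `β ∖ {i}`
are admissible for `s_i w`. -/
lemma Admissible.of_isDescent {w : Equiv.Perm (Fin (m + 1))} {β : Finset (Fin (m + 1))}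
    (h : Admissible w β) {i : Fin m} (hd : IsDescent i w) (h1 : i.castSucc ∈ β)
    (h2 : i.succ ∉ β) {δ : Finset (Fin (m + 1))} (hδ : ∀ j, j ≠ i.castSucc → j ≠ i.succ →
      (j ∈ δ ↔ j ∈ β)) (hδ' : i.succ ∈ δ → i.castSucc ∈ δ) : Admissible (simpleRefl i * w) δ := by
  rw [admissible_iff]
  intro j hj k hle hx
  simp only [mul_symm_apply, simpleRefl_symm] at hx
  rcases hle.eq_or_lt with rfl | hlt
  · exact hj
  have hd' : w.symm i.succ < w.symm i.castSucc := hd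
  by_cases hk1 : k = i.castSucc
  · by_cases hj2 : j = i.succ
    · subst hk1 hj2; exact hδ' hj
    have hj1 : j ≠ i.castSucc := fun h' => by subst hk1 h'; exact lt_irrefl _ hlt
    subst hk1
    rw [simpleRefl_castSucc, simpleRefl_of_ne hj1 hj2] at hx
    refine absurd (h.mem_of_le ((hδ j hj1 hj2).mp hj) ?_ hx) h2
    simp only [Fin.lt_def, Fin.le_def, ne_eq, Fin.ext_iff, Fin.val_castSucc, Fin.val_succ] at *
    omega
  by_cases hk2 : k = i.succ
  · subst hk2
    have hj1 : j ≠ i.castSucc := by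
      rintro rfl; exact absurd hlt (not_lt.mpr Fin.castSucc_lt_succ.le)
    rw [simpleRefl_succ, simpleRefl_of_ne hj1 hlt.ne'] at hx
    exact absurd (h.mem_of_le ((hδ j hj1 hlt.ne').mp hj) hle (hd'.le.trans hx)) h2
  rw [hδ k hk1 hk2]
  rw [simpleRefl_of_ne hk1 hk2] at hx
  by_cases hj1 : j = i.castSucc
  · subst hj1
    rw [simpleRefl_castSucc] at hx
    exact h.mem_of_le h1 hle (hx.trans hd'.le)
  by_cases hj2 : j = i.succ
  · subst hj2
    rw [simpleRefl_succ] at hx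
    refine h.mem_of_le h1 ?_ hx
    simp only [Fin.lt_def, Fin.le_def, ne_eq, Fin.ext_iff, Fin.val_castSucc, Fin.val_succ] at *
    omega
  · rw [simpleRefl_of_ne hj1 hj2] at hx
    exact h.mem_of_le ((hδ j hj1 hj2).mp hj) hle hx

end Combinatorics

/-! ### Normal forms indexed by the orbits -/

section NormalForm

variable {K A : Type*} [Field K] [Ring A] [Algebra K A] (q : K) (a : A) (τ : ℕ → A)

open Classical in
/-- The normal form indexed by `(w, β)`. Good descents are peeled off from the left; when none is
left and `β` is admissible, `β` is an initial set, and the normal form is the product of the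
corresponding `flagElt` and the normal form of `(w, ∅)`. In the convolution algebra it is the
characteristic function of the union of the orbits of the `(w, β')` with `β' ⊆ β`. -/
noncomputable def normalElt {m : ℕ} (w : Equiv.Perm (Fin (m + 1))) (β : Finset (Fin (m + 1))) :
    A :=
  if h : ∃ i, IsGood i w β then
    τ h.choose * normalElt (simpleRefl h.choose * w) (moveSet (simpleRefl h.choose) β)
  else if h' : ∃ i, IsDescent i w then
    flagElt q a τ β.card * (τ h'.choose * normalElt (simpleRefl h'.choose * w) ∅)
  else flagElt q a τ β.card
termination_by weight w
decreasing_by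
  · exact weight_lt h.choose_spec.1
  · exact weight_lt h'.choose_spec

variable {q a τ} {m : ℕ}

lemma normalElt_peel_aux (H : MirRel q m a τ) {w : Equiv.Perm (Fin (m + 1))}
    {β : Finset (Fin (m + 1))} {i j : Fin m} (hi : IsGood i w β) (hj : IsGood j w β)
    (hij : i < j)
    (ih : ∀ w' : Equiv.Perm (Fin (m + 1)), weight w' < weight w → ∀ β' k, IsGood k w' β' →
      normalElt q a τ w' β' =
        τ k * normalElt q a τ (simpleRefl k * w') (moveSet (simpleRefl k) β')) :
    τ i * normalElt q a τ (simpleRefl i * w) (moveSet (simpleRefl i) β) =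
      τ j * normalElt q a τ (simpleRefl j * w) (moveSet (simpleRefl j) β) := by
  have hwi := weight_lt hi.1
  have hwj := weight_lt hj.1
  simp only [IsGood, IsDescent] at hi hj
  rcases (Nat.succ_le_of_lt hij).eq_or_lt with h | h
  · have h : j.1 = i.1 + 1 := h.symm
    have e1 := castSucc_eq_succ h
    have e2 := simpleRefl_next_castSucc h
    have e3 := simpleRefl_next_succ h
    have e4 := simpleRefl_prev_succ h
    rw [e1] at hj
    have g1 : IsGood j (simpleRefl i * w) (moveSet (simpleRefl i) β) := by
      simp only [IsGood, IsDescent, mul_symm_apply, mem_moveSet, simpleRefl_symm, e1, e4,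
        simpleRefl_succ]
      exact ⟨hj.1.trans hi.1, fun h => hj.2 (hi.2 h)⟩
    have g2 : IsGood i (simpleRefl j * w) (moveSet (simpleRefl j) β) := by
      simp only [IsGood, IsDescent, mul_symm_apply, mem_moveSet, simpleRefl_symm, e2, e3]
      exact ⟨hj.1.trans hi.1, fun h => hj.2 (hi.2 h)⟩
    have g3 : IsGood i (simpleRefl j * (simpleRefl i * w))
        (moveSet (simpleRefl j * simpleRefl i) β) := by
      simp only [IsGood, IsDescent, mul_symm_apply, mem_moveSet, simpleRefl_symm, e2, e3, e4,
        simpleRefl_castSucc]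
      exact ⟨hj.1, hj.2⟩
    have g4 : IsGood j (simpleRefl i * (simpleRefl j * w))
        (moveSet (simpleRefl i * simpleRefl j) β) := by
      simp only [IsGood, IsDescent, mul_symm_apply, mem_moveSet, simpleRefl_symm, e1, e2, e4,
        simpleRefl_succ]
      exact hi
    rw [ih _ hwi _ _ g1, ih _ hwj _ _ g2, moveSet_moveSet, moveSet_moveSet,
      ih _ ((weight_lt g1.1).trans hwi) _ _ g3, ih _ ((weight_lt g2.1).trans hwj) _ _ g4,
      moveSet_moveSet, moveSet_moveSet]
    have hb := H.braid i.1 (by omega)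
    rw [← h] at hb
    have hs := simpleRefl_braid h
    simp only [← mul_assoc, hb, hs]
  · have h : i.1 + 2 ≤ j.1 := h
    obtain ⟨e1, e2⟩ := simpleRefl_far (Or.inl h)
    obtain ⟨e3, e4⟩ := simpleRefl_far (i := j) (j := i) (Or.inr h)
    have g1 : IsGood j (simpleRefl i * w) (moveSet (simpleRefl i) β) := by
      simpa only [IsGood, IsDescent, mul_symm_apply, mem_moveSet, simpleRefl_symm, e1, e2] using hj
    have g2 : IsGood i (simpleRefl j * w) (moveSet (simpleRefl j) β) := by
      simpa only [IsGood, IsDescent, mul_symm_apply, mem_moveSet, simpleRefl_symm, e3, e4] using hi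
    rw [ih _ hwi _ _ g1, ih _ hwj _ _ g2, moveSet_moveSet, moveSet_moveSet]
    have hb := H.comm i.1 j.1 h j.2
    have hs := simpleRefl_mul_comm (Or.inl h)
    simp only [← mul_assoc, hb, hs]

/-- Every good descent can be peeled off: the normal form does not depend on the choices in its
definition. -/
lemma normalElt_peel (H : MirRel q m a τ) {w : Equiv.Perm (Fin (m + 1))}
    {β : Finset (Fin (m + 1))} {i : Fin m} (hi : IsGood i w β) :
    normalElt q a τ w β =
      τ i * normalElt q a τ (simpleRefl i * w) (moveSet (simpleRefl i) β) := by
  induction hw : weight w using Nat.strong_induction_on generalizing w β i with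
  | _ N ih =>
    subst hw
    have ih' : ∀ w' : Equiv.Perm (Fin (m + 1)), weight w' < weight w → ∀ β' k, IsGood k w' β' →
        normalElt q a τ w' β' =
          τ k * normalElt q a τ (simpleRefl k * w') (moveSet (simpleRefl k) β') :=
      fun w' hlt β' k hk => ih _ hlt hk rfl
    have hex : ∃ i, IsGood i w β := ⟨i, hi⟩
    rw [normalElt, dif_pos hex]
    have hj := hex.choose_spec
    generalize hex.choose = j at hj ⊢
    rcases lt_trichotomy i j with h | rfl | h
    · exact (normalElt_peel_aux H hi hj h ih').symm
    · rfl
    · exact normalElt_peel_aux H hj hi h ih'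

lemma normalElt_ascent (H : MirRel q m a τ) {w : Equiv.Perm (Fin (m + 1))}
    {β : Finset (Fin (m + 1))} {i : Fin m} (hi : w.symm i.castSucc < w.symm i.succ)
    (hβ : i.succ ∈ β → i.castSucc ∈ β) :
    τ i * normalElt q a τ w β =
      normalElt q a τ (simpleRefl i * w) (moveSet (simpleRefl i) β) := by
  have h : IsGood i (simpleRefl i * w) (moveSet (simpleRefl i) β) := by
    simpa [IsGood, IsDescent] using ⟨hi, hβ⟩
  rw [normalElt_peel H h, simpleRefl_mul_mul, moveSet_simpleRefl_twice]

lemma isGood_empty {w : Equiv.Perm (Fin (m + 1))} {i : Fin m} (hi : IsDescent i w) :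
    IsGood i w ∅ := ⟨hi, by simp⟩

lemma moveSet_initialSet {i : Fin m} {k : ℕ} (h : i.1 + 1 ≠ k) :
    moveSet (simpleRefl i) (initialSet m k) = initialSet m k := by
  ext j
  rw [mem_moveSet, simpleRefl_symm, mem_initialSet, mem_initialSet]
  by_cases h1 : j = i.castSucc
  · subst h1; simp only [simpleRefl_castSucc, Fin.val_succ, Fin.val_castSucc]; omega
  by_cases h2 : j = i.succ
  · subst h2; simp only [simpleRefl_succ, Fin.val_succ, Fin.val_castSucc]; omega
  rw [simpleRefl_of_ne h1 h2]

/-- The elements `flagElt k` commute with every descent that is good for an initial set, so that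
they can be collected on the left. -/
lemma flagElt_mul_normalElt_empty (H : MirRel q m a τ) (w : Equiv.Perm (Fin (m + 1))) {k : ℕ}
    (hk : k ≤ m + 1) :
    flagElt q a τ k * normalElt q a τ w ∅ = normalElt q a τ w (initialSet m k) := by
  induction hw : weight w using Nat.strong_induction_on generalizing w with
  | _ N ih =>
    subst hw
    by_cases hex : ∃ i, IsGood i w (initialSet m k)
    · obtain ⟨i, hi⟩ := hex
      have hik : i.1 + 1 ≠ k := by
        rintro rfl
        have := hi.2 (by simp)
        simp at this
      rw [normalElt_peel H hi, normalElt_peel H (isGood_empty hi.1), moveSet_initialSet hik,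
        ← ih _ (weight_lt hi.1) _ rfl, ← mul_assoc, ← mul_assoc,
        (H.tau_comm_flagElt i.2 hk hik).eq, moveSet_empty]
    · rw [normalElt.eq_def (β := initialSet m k), dif_neg hex]
      by_cases hex' : ∃ i, IsDescent i w
      · rw [dif_pos hex', card_initialSet hk]
        have hj := hex'.choose_spec
        generalize hex'.choose = j at hj ⊢
        rw [normalElt_peel H (isGood_empty hj), moveSet_empty]
      · rw [dif_neg hex', card_initialSet hk, normalElt.eq_def,
          dif_neg (fun ⟨i, hi⟩ => hex' ⟨i, hi.1⟩), dif_neg hex', Finset.card_empty, flagElt_zero,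
          mul_one]

lemma not_isDescent_one (i : Fin m) : ¬ IsDescent i 1 :=
  not_lt.mpr (Fin.castSucc_lt_succ (i := i)).le

lemma normalElt_one_empty : normalElt q a τ (1 : Equiv.Perm (Fin (m + 1))) ∅ = 1 := by
  rw [normalElt.eq_def, dif_neg (fun ⟨i, hi⟩ => not_isDescent_one i hi.1),
    dif_neg (fun ⟨i, hi⟩ => not_isDescent_one i hi), Finset.card_empty, flagElt_zero]

end NormalForm

/-! ### The normal forms span -/

section Span

variable {K A : Type*} [Field K] [Ring A] [Algebra K A] {q : K} {a : A} {τ : ℕ → A} {m : ℕ}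

lemma isGood_of_notMem {w : Equiv.Perm (Fin (m + 1))} {i : Fin m} (hi : IsDescent i w)
    {β : Finset (Fin (m + 1))} (h : i.castSucc ∉ β) : IsGood i w β := ⟨hi, fun h' => absurd h' h⟩

lemma isGood_of_mem {w : Equiv.Perm (Fin (m + 1))} {i : Fin m} (hi : IsDescent i w)
    {β : Finset (Fin (m + 1))} (h : i.succ ∈ β) : IsGood i w β := ⟨hi, fun _ => h⟩

/-- The case of `tau_mul_normalElt_of_isDescent` in which `β` is an initial set. -/
lemma tau_mul_normalElt_initialSet (H : MirRel q m a τ) {w : Equiv.Perm (Fin (m + 1))} {i : Fin m}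
    (hi : IsDescent i w) :
    (τ i + 1) * (normalElt q a τ w (initialSet m (i + 1)) +
      normalElt q a τ (simpleRefl i * w) (initialSet m (i + 1))) =
    (τ i + 1) * (normalElt q a τ (simpleRefl i * w) (initialSet m (i + 2)) +
      q • normalElt q a τ (simpleRefl i * w) (initialSet m i)) := by
  have hi' := i.2
  have h1 := H.tau_mul_flagElt_mul_tau hi'
  have c1 : Commute (τ i) (flagElt q a τ (i + 2)) :=
    H.tau_comm_flagElt hi' (by omega) (by omega)
  have c2 : Commute (τ i) (flagElt q a τ i) := H.tau_comm_flagElt hi' (by omega) (by omega)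
  rw [← flagElt_mul_normalElt_empty H _ (by omega), ← flagElt_mul_normalElt_empty H _ (by omega),
    ← flagElt_mul_normalElt_empty H _ (by omega), ← flagElt_mul_normalElt_empty H _ (by omega),
    normalElt_peel H (isGood_empty hi), moveSet_empty]
  generalize normalElt q a τ (simpleRefl i * w) ∅ = y
  calc _ = (τ i + 1) * flagElt q a τ (i + 1) * (τ i + 1) * y := by
        simp only [mul_add, add_mul, mul_assoc, one_mul, mul_one]
    _ = _ := by
      rw [h1]
      simp only [mul_add, add_mul, one_mul, mul_one, smul_mul_assoc, mul_smul_comm, c1.eq, c2.eq,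
        ← mul_assoc, smul_add]
      abel

/-- For neighbouring `i` and `j`, the product `s_i s_j` carries the pair of positions `i, i + 1`
to `j, j + 1`. -/
lemma simpleRefl_adjacent {i j : Fin m} (h : j.1 = i.1 + 1 ∨ i.1 = j.1 + 1) :
    simpleRefl i (simpleRefl j i.castSucc) = j.castSucc ∧
      simpleRefl i (simpleRefl j i.succ) = j.succ ∧
      simpleRefl i * simpleRefl j * simpleRefl i = simpleRefl j * simpleRefl i * simpleRefl j := by
  rcases h with h | h
  · refine ⟨?_, ?_, simpleRefl_braid h⟩
    · rw [simpleRefl_next_castSucc h, simpleRefl_castSucc, castSucc_eq_succ h]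
    · rw [simpleRefl_next_succ h, simpleRefl_prev_succ h]
  · refine ⟨?_, ?_, (simpleRefl_braid h).symm⟩
    · rw [castSucc_eq_succ h, simpleRefl_succ, simpleRefl_next_castSucc h]
    · rw [simpleRefl_prev_succ h, simpleRefl_succ, castSucc_eq_succ h]

/-- The effect of `τ i` on a normal form with a descent at `i` that cannot be peeled off: the
relation for `(τ i + 1) * flagElt (i + 1) * (τ i + 1)`, transported to all admissible pairs. -/
lemma tau_mul_normalElt_of_isDescent (H : MirRel q m a τ) {w : Equiv.Perm (Fin (m + 1))}
    {β : Finset (Fin (m + 1))} (hβ : Admissible w β) {i : Fin m} (hi : IsDescent i w)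
    (h1 : i.castSucc ∈ β) (h2 : i.succ ∉ β) :
    (τ i + 1) * (normalElt q a τ w β + normalElt q a τ (simpleRefl i * w) β) =
    (τ i + 1) * (normalElt q a τ (simpleRefl i * w) (insert i.succ β) +
      q • normalElt q a τ (simpleRefl i * w) (β.erase i.castSucc)) := by
  induction hw : weight w using Nat.strong_induction_on generalizing w β i with
  | _ N ih =>
    subst hw
    by_cases hex : ∃ j : Fin m, j.castSucc ∉ β ∧ j.succ ∈ β
    · obtain ⟨j, hj1, hj2⟩ := hex
      have hj := hβ.isDescent hj1 hj2
      have hgj := isGood_of_mem hj hj2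
      have hβj := hβ.moveSet hgj.2
      have hlt := weight_lt hj
      have hne : i ≠ j := by rintro rfl; exact hj1 h1
      have hne' : i.1 ≠ j.1 := fun h => hne (Fin.ext h)
      have hjs : j.castSucc ≠ i.castSucc := fun h => hne (Fin.castSucc_injective _ h).symm
      have hjs' : j.succ ≠ i.succ := fun h => hne (Fin.succ_injective _ h).symm
      by_cases hfar : i.1 + 2 ≤ j.1 ∨ j.1 + 2 ≤ i.1
      · -- `τ j` commutes with `τ i` and can be peeled off from all four terms
        obtain ⟨e1, e2⟩ := simpleRefl_far hfar
        obtain ⟨e3, e4⟩ := simpleRefl_far hfar.symm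
        have hs := simpleRefl_mul_comm hfar
        have hd : IsDescent j (simpleRefl i * w) := by
          simpa only [IsDescent, mul_symm_apply, simpleRefl_symm, e1, e2] using hj
        have hjs'' : j.castSucc ≠ i.succ := by
          simp only [ne_eq, Fin.ext_iff, Fin.val_castSucc, Fin.val_succ]; omega
        have key := ih _ hlt hβj (i := i)
          (by simpa only [IsDescent, mul_symm_apply, simpleRefl_symm, e3, e4] using hi)
          (by simpa only [mem_moveSet, simpleRefl_symm, e3] using h1)
          (by simpa only [mem_moveSet, simpleRefl_symm, e4] using h2) rfl
        have hc : ∀ z, (τ i + 1) * (τ j * z) = τ j * ((τ i + 1) * z) := by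
          have : τ i * τ j = τ j * τ i := by
            rcases hfar with h | h
            · exact H.comm _ _ h j.2
            · exact (H.comm _ _ h i.2).symm
          intro z
          rw [← mul_assoc, add_mul, this, one_mul, ← mul_assoc, mul_add, mul_one]
        rw [normalElt_peel H hgj, normalElt_peel H (isGood_of_notMem hd hj1),
          normalElt_peel H (isGood_of_notMem (β := insert i.succ β) hd (by simp [hjs'', hj1])),
          normalElt_peel H (isGood_of_notMem (β := β.erase i.castSucc) hd (by simp [hj1])),
          moveSet_insert, moveSet_erase, e3, e4, ← mul_assoc (simpleRefl j), ← hs,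
          mul_assoc (simpleRefl i), ← mul_add, ← mul_smul_comm, ← mul_add, hc, hc, key]
      · -- the braid relation carries `τ i` past `τ j * τ i`, where it becomes `τ j`
        have hadj : j.1 = i.1 + 1 ∨ i.1 = j.1 + 1 := by omega
        obtain ⟨e1, e2, hs⟩ := simpleRefl_adjacent hadj
        have hb : τ i * τ j * τ i = τ j * τ i * τ j := by
          rcases hadj with h | h
          · rw [h]; exact H.braid _ (by omega)
          · rw [h]; exact (H.braid _ (by omega)).symm
        have goods : IsDescent j (simpleRefl i * w) ∧ IsDescent i (simpleRefl j * w) ∧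
            IsDescent i (simpleRefl j * (simpleRefl i * w)) ∧
            IsDescent j (simpleRefl i * (simpleRefl j * w)) ∧
            (∀ δ, (δ = β ∨ δ = insert i.succ β ∨ δ = β.erase i.castSucc) →
              (j.castSucc ∈ δ → j.succ ∈ δ) ∧ (i.castSucc ∈ moveSet (simpleRefl j) δ →
                i.succ ∈ moveSet (simpleRefl j) δ)) := by
          simp only [IsDescent, mul_symm_apply, mem_moveSet, simpleRefl_symm] at hi hj ⊢
          rcases hadj with h | h
          · have f1 := castSucc_eq_succ h
            have f2 := simpleRefl_next_castSucc h
            have f3 := simpleRefl_next_succ h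
            have f4 := simpleRefl_prev_succ h
            rw [f1] at hj
            refine ⟨?_, ?_, ?_, ?_, ?_⟩
            · simpa only [f1, f4, simpleRefl_succ] using hj.trans hi
            · simpa only [f2, f3] using hj.trans hi
            · simpa only [f2, f3, f4, simpleRefl_castSucc] using hj
            · simpa only [f1, f2, f4, simpleRefl_succ, simpleRefl_castSucc] using hi
            · have hne3 : j.succ ≠ i.castSucc := by
                simp only [ne_eq, Fin.ext_iff, Fin.val_castSucc, Fin.val_succ]; omega
              rintro δ (rfl | rfl | rfl) <;> simp [f2, f3, hj2, hne3]
          · have f1 := castSucc_eq_succ h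
            have f2 := simpleRefl_next_castSucc h
            have f3 := simpleRefl_next_succ h
            have f4 := simpleRefl_prev_succ h
            rw [← f1] at hj
            refine ⟨?_, ?_, ?_, ?_, ?_⟩
            · simpa only [f2, f3] using hi.trans hj
            · simpa only [f1, f4, simpleRefl_succ] using hi.trans hj
            · simpa only [f1, f2, f4, simpleRefl_succ, simpleRefl_castSucc] using hj
            · simpa only [f1, f2, f3, f4, simpleRefl_castSucc] using hi
            · have hne3 : j.castSucc ≠ i.succ := by
                simp only [ne_eq, Fin.ext_iff, Fin.val_castSucc, Fin.val_succ]; omega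
              rintro δ (rfl | rfl | rfl) <;> simp [f1, f4, hj1, hne3]
        obtain ⟨d1, d2, d3, d4, gδ⟩ := goods
        have peel : ∀ δ, (δ = β ∨ δ = insert i.succ β ∨ δ = β.erase i.castSucc) →
            normalElt q a τ (simpleRefl i * w) δ = τ j * τ i *
              normalElt q a τ (simpleRefl j * (simpleRefl i * (simpleRefl j * w)))
                (moveSet (simpleRefl i * simpleRefl j) δ) := by
          intro δ hδ
          rw [normalElt_peel H ⟨d1, (gδ δ hδ).1⟩, normalElt_peel H ⟨d3, (gδ δ hδ).2⟩,
            moveSet_moveSet, mul_assoc]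
          simp only [← mul_assoc, hs]
        have hβ2 := hβj.moveSet (gδ β (Or.inl rfl)).2
        rw [moveSet_moveSet] at hβ2
        have key := ih _ ((weight_lt d2).trans hlt) hβ2 d4
          (by
            rw [mem_moveSet, ← e1]
            simpa [Equiv.Perm.mul_def] using h1)
          (by
            rw [mem_moveSet, ← e2]
            simpa [Equiv.Perm.mul_def] using h2) rfl
        have hc : ∀ z, (τ i + 1) * (τ j * τ i * z) = τ j * τ i * ((τ j + 1) * z) := by
          intro z
          rw [← mul_assoc, ← mul_assoc, add_mul, add_mul, one_mul, hb, ← mul_assoc, mul_add,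
            mul_one]
        rw [normalElt_peel H hgj, normalElt_peel H ⟨d2, (gδ β (Or.inl rfl)).2⟩,
          peel β (Or.inl rfl), peel _ (Or.inr (Or.inl rfl)), peel _ (Or.inr (Or.inr rfl)),
          moveSet_moveSet, ← mul_assoc (τ j), ← mul_add, ← mul_smul_comm, ← mul_add, hc, hc,
          key, moveSet_insert, moveSet_erase]
        simp only [Equiv.Perm.mul_apply, e1, e2]
    · push Not at hex
      obtain ⟨k, -, rfl⟩ := exists_eq_initialSet fun i hi => by
        by_contra h; exact hex i h hi
      rw [mem_initialSet, Fin.val_castSucc] at h1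
      rw [mem_initialSet, Fin.val_succ] at h2
      obtain rfl : k = i.1 + 1 := by omega
      have s1 : insert i.succ (initialSet m (i.1 + 1)) = initialSet m (i.1 + 2) := by
        ext j
        simp only [Finset.mem_insert, mem_initialSet, Fin.ext_iff, Fin.val_succ]
        omega
      have s2 : (initialSet m (i.1 + 1)).erase i.castSucc = initialSet m i.1 := by
        ext j
        simp only [Finset.mem_erase, mem_initialSet, ne_eq, Fin.ext_iff, Fin.val_castSucc]
        omega
      rw [s1, s2, tau_mul_normalElt_initialSet H hi]

/-- If position `r` comes after the positions `r + 1, …, k`, it can be moved past them in the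
normal forms for `{0, …, k} ∖ {r}` and for `{0, …, k}` simultaneously. -/
lemma normalElt_cascade (H : MirRel q m a τ) {k : ℕ} (hk : k ≤ m) (d : ℕ)
    (w : Equiv.Perm (Fin (m + 1))) (r : Fin (m + 1)) (hr : r.1 + d = k)
    (hw : ∀ j : Fin (m + 1), r < j → j.1 ≤ k → w.symm j < w.symm r) :
    ∃ y, normalElt q a τ w ((initialSet m (k + 1)).erase r) =
        tauProd τ r d * (flagElt q a τ k * y) ∧
      normalElt q a τ w (initialSet m (k + 1)) =
        tauProd τ r d * (flagElt q a τ (k + 1) * y) := by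
  induction d generalizing w r with
  | zero =>
    refine ⟨normalElt q a τ w ∅, ?_, ?_⟩
    · rw [flagElt_mul_normalElt_empty H _ (by omega), tauProd, one_mul]
      congr 1
      ext j
      simp only [Finset.mem_erase, mem_initialSet, ne_eq, Fin.ext_iff]
      omega
    · rw [flagElt_mul_normalElt_empty H _ (by omega), tauProd, one_mul]
  | succ d ih =>
    have hrm : r.1 < m := by omega
    obtain ⟨i, rfl⟩ : ∃ i : Fin m, r = i.castSucc := ⟨⟨r.1, hrm⟩, rfl⟩
    rw [Fin.val_castSucc] at hr hrm ⊢
    have hd : IsDescent i w := hw _ Fin.castSucc_lt_succ (by rw [Fin.val_succ]; omega)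
    obtain ⟨y, hy1, hy2⟩ := ih (simpleRefl i * w) i.succ (by rw [Fin.val_succ]; omega) (by
      intro j hj1 hj2
      have hj3 : i.castSucc < j := Fin.castSucc_lt_succ.trans hj1
      simp only [mul_symm_apply, simpleRefl_symm, simpleRefl_succ]
      rw [simpleRefl_of_ne hj3.ne' hj1.ne']
      exact hw j hj3 hj2)
    refine ⟨y, ?_, ?_⟩
    · rw [normalElt_peel H (isGood_of_notMem hd (by simp)), moveSet_erase, simpleRefl_castSucc,
        moveSet_initialSet (by omega), hy1, tauProd, mul_assoc, Fin.val_succ]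
    · rw [normalElt_peel H (isGood_of_mem hd (by rw [mem_initialSet, Fin.val_succ]; omega)),
        moveSet_initialSet (by omega), hy2, tauProd, mul_assoc, Fin.val_succ]

/-- For `0 ∉ β`, the descents that bring `β` to the form `{0, …, k} ∖ {0}` commute with `a`, and for
such `β` the claim is the recursion for `flagElt (k + 1)`. -/
lemma a_mul_normalElt (H : MirRel q m a τ) {w : Equiv.Perm (Fin (m + 1))}
    {β : Finset (Fin (m + 1))} (hβ : Admissible w β) :
    a * normalElt q a τ w β =
      if 0 ∈ β then q • normalElt q a τ w β else normalElt q a τ w (insert 0 β) := by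
  induction hw : weight w using Nat.strong_induction_on generalizing w β with
  | _ N ih =>
    subst hw
    by_cases hex : ∃ j : Fin m, 1 ≤ j.1 ∧ j.castSucc ∉ β ∧ j.succ ∈ β
    · obtain ⟨j, hj0, hj1, hj2⟩ := hex
      have hj := hβ.isDescent hj1 hj2
      have hgj := isGood_of_mem hj hj2
      have e0 : simpleRefl j 0 = 0 := by
        apply simpleRefl_of_ne <;>
          simp only [ne_eq, Fin.ext_iff, Fin.val_castSucc, Fin.val_succ, Fin.val_zero] <;> omega
      have hgj' : IsGood j w (insert 0 β) := isGood_of_mem hj (by simp [hj2])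
      rw [normalElt_peel H hgj, normalElt_peel H hgj', moveSet_insert, e0, ← mul_assoc,
        H.a_comm _ hj0 j.2, mul_assoc, ih _ (weight_lt hj) (hβ.moveSet hgj.2) rfl]
      simp only [mem_moveSet, simpleRefl_symm, e0]
      split_ifs
      · rw [mul_smul_comm]
      · rfl
    · push Not at hex
      obtain ⟨k, hk, hk'⟩ : ∃ k ≤ m + 1, insert 0 β = initialSet m k := by
        refine exists_eq_initialSet fun i hi => ?_
        rw [Finset.mem_insert] at hi ⊢
        rcases hi with hi | hi
        · exact absurd hi (Fin.succ_ne_zero i)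
        · by_contra h
          push Not at h
          refine hex i ?_ h.2 hi
          have := h.1
          simp only [ne_eq, Fin.ext_iff, Fin.val_castSucc, Fin.val_zero] at this
          omega
      have hk0 : 1 ≤ k := by
        have h0 : (0 : Fin (m + 1)) ∈ initialSet m k := hk' ▸ Finset.mem_insert_self _ _
        rwa [mem_initialSet, Fin.val_zero] at h0
      by_cases h0 : 0 ∈ β
      · rw [Finset.insert_eq_of_mem h0] at hk'
        subst hk'
        rw [if_pos h0, ← flagElt_mul_normalElt_empty H _ hk, ← mul_assoc, H.a_mul_flagElt hk0,
          smul_mul_assoc]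
      · obtain ⟨k, rfl⟩ := Nat.exists_eq_add_of_le' hk0
        have hβ' : β = (initialSet m (k + 1)).erase 0 := by
          rw [← hk', Finset.erase_insert h0]
        obtain ⟨y, hy1, hy2⟩ := normalElt_cascade H (k := k) (by omega) k w 0 (by simp) (by
          intro j hj1 hj2
          have hj3 : j ∈ β := by
            rw [hβ', Finset.mem_erase, mem_initialSet]
            exact ⟨hj1.ne', by omega⟩
          exact (hβ j hj3 0 h0).resolve_left (not_lt.mpr hj1.le))
        rw [if_neg h0, hk', hy2, hβ', hy1]
        have c := (H.tauProd_comm_flagElt (r := 0) (d := k) (k := k + 1) (by omega) hk).eq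
        have e := H.a_mul_tauProd_mul_flagElt (k := k) (by omega)
        simp only [Fin.val_zero]
        rw [← mul_assoc, ← mul_assoc, e, ← mul_assoc, c]

variable (q a τ m) in
/-- The span of the normal forms of the admissible pairs. -/
def normalSpan : Submodule K A :=
  Submodule.span K {x | ∃ (w : Equiv.Perm (Fin (m + 1))) (β : Finset (Fin (m + 1))),
    Admissible w β ∧ x = normalElt q a τ w β}

lemma normalElt_mem_normalSpan {w : Equiv.Perm (Fin (m + 1))} {β : Finset (Fin (m + 1))}
    (h : Admissible w β) : normalElt q a τ w β ∈ normalSpan q a τ m :=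
  Submodule.subset_span ⟨w, β, h, rfl⟩

lemma normalSpan_le_comap {x : A} (h : ∀ (w : Equiv.Perm (Fin (m + 1)))
    (β : Finset (Fin (m + 1))), Admissible w β → x * normalElt q a τ w β ∈ normalSpan q a τ m)
    {y : A} (hy : y ∈ normalSpan q a τ m) : x * y ∈ normalSpan q a τ m := by
  have h' : normalSpan q a τ m ≤ (normalSpan q a τ m).comap (LinearMap.mulLeft K x) := by
    rw [normalSpan, Submodule.span_le]
    rintro _ ⟨w, β, hβ, rfl⟩
    exact h w β hβ
  exact h' hy

lemma a_mul_mem_normalSpan (H : MirRel q m a τ) {y : A} (hy : y ∈ normalSpan q a τ m) :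
    a * y ∈ normalSpan q a τ m := by
  refine normalSpan_le_comap (fun w β hβ => ?_) hy
  rw [a_mul_normalElt H hβ]
  split_ifs
  · exact Submodule.smul_mem _ _ (normalElt_mem_normalSpan hβ)
  · refine normalElt_mem_normalSpan (admissible_iff.mpr fun i hi j h1 h2 => ?_)
    rw [Finset.mem_insert] at *
    rcases hi with rfl | hi
    · exact Or.inl (Fin.le_zero_iff.mp h1)
    · exact Or.inr (hβ.mem_of_le hi h1 h2)

lemma tau_mul_mem_normalSpan (H : MirRel q m a τ) (i : Fin m) {y : A}
    (hy : y ∈ normalSpan q a τ m) : τ i * y ∈ normalSpan q a τ m := by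
  have asc : ∀ (w : Equiv.Perm (Fin (m + 1))) (β : Finset (Fin (m + 1))), Admissible w β →
      w.symm i.castSucc < w.symm i.succ → τ i * normalElt q a τ w β ∈ normalSpan q a τ m := by
    intro w β hβ h
    rw [normalElt_ascent H h fun h' => hβ.mem_of_le h' Fin.castSucc_lt_succ.le h.le]
    exact normalElt_mem_normalSpan (hβ.moveSet_of_lt h)
  refine normalSpan_le_comap (fun w β hβ => ?_) hy
  rcases lt_trichotomy (w.symm i.castSucc) (w.symm i.succ) with h | h | h
  · exact asc w β hβ h
  · exact absurd (w.symm.injective h) Fin.castSucc_lt_succ.ne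
  · by_cases hg : i.castSucc ∈ β → i.succ ∈ β
    · have hm := normalElt_mem_normalSpan (q := q) (a := a) (τ := τ) hβ
      have hm' := normalElt_mem_normalSpan (q := q) (a := a) (τ := τ) (hβ.moveSet hg)
      have hp := normalElt_peel H (⟨h, hg⟩ : IsGood i w β)
      rw [hp, ← mul_assoc, H.quad i i.2, add_mul, smul_mul_assoc, ← hp, smul_mul_assoc, one_mul]
      exact add_mem (Submodule.smul_mem _ _ hm) (Submodule.smul_mem _ _ hm')
    · push Not at hg
      have hd : IsDescent i w := h
      have hasc : (simpleRefl i * w).symm i.castSucc < (simpleRefl i * w).symm i.succ := by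
        simpa using h
      have hadm := fun {δ} => hβ.of_isDescent hd hg.1 hg.2 (δ := δ)
      have hβ0 : Admissible (simpleRefl i * w) β := hadm (fun _ _ _ => Iff.rfl) (fun _ => hg.1)
      have hβ1 : Admissible (simpleRefl i * w) (insert i.succ β) :=
        hadm (fun j _ h2 => by simp [h2]) (fun _ => by simp [hg.1])
      have hβ2 : Admissible (simpleRefl i * w) (β.erase i.castSucc) :=
        hadm (fun j h1 _ => by simp [h1]) (fun h' => absurd (Finset.mem_of_mem_erase h') hg.2)
      have key := tau_mul_normalElt_of_isDescent H hβ hd hg.1 hg.2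
      have key' : τ i * normalElt q a τ w β =
          τ i * normalElt q a τ (simpleRefl i * w) (insert i.succ β) +
          q • (τ i * normalElt q a τ (simpleRefl i * w) (β.erase i.castSucc)) +
          normalElt q a τ (simpleRefl i * w) (insert i.succ β) +
          q • normalElt q a τ (simpleRefl i * w) (β.erase i.castSucc) -
          τ i * normalElt q a τ (simpleRefl i * w) β -
          normalElt q a τ (simpleRefl i * w) β - normalElt q a τ w β := by
        simp only [mul_add, add_mul, one_mul, mul_smul_comm, smul_add] at key
        rw [← sub_eq_zero] at key ⊢
        rw [← key]
        abel
      rw [key']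
      have m0 := asc _ _ hβ0 hasc
      have m1 := asc _ _ hβ1 hasc
      have m2 := asc _ _ hβ2 hasc
      exact sub_mem (sub_mem (sub_mem (add_mem (add_mem (add_mem m1 (Submodule.smul_mem _ _ m2))
        (normalElt_mem_normalSpan hβ1)) (Submodule.smul_mem _ _ (normalElt_mem_normalSpan hβ2)))
        m0) (normalElt_mem_normalSpan hβ0)) (normalElt_mem_normalSpan hβ)

lemma one_mem_normalSpan : (1 : A) ∈ normalSpan q a τ m := by
  rw [← normalElt_one_empty (q := q) (a := a) (τ := τ) (m := m)]
  exact normalElt_mem_normalSpan (admissible_empty _)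

/-- If `a` and the `τ i` generate the algebra, then it is spanned by the normal forms. -/
lemma normalSpan_eq_top (H : MirRel q m a τ)
    (hgen : Algebra.adjoin K (insert a (Set.range fun i : Fin m => τ i)) = ⊤) :
    normalSpan q a τ m = ⊤ := by
  rw [eq_top_iff]
  intro x hx
  clear hx
  have hx : x ∈ Algebra.adjoin K (insert a (Set.range fun i : Fin m => τ i)) := by
    rw [hgen]; trivial
  suffices h : ∀ y ∈ normalSpan q a τ m, x * y ∈ normalSpan q a τ m by
    simpa using h 1 one_mem_normalSpan
  induction hx using Algebra.adjoin_induction with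
  | mem x hx =>
    rcases hx with rfl | ⟨i, rfl⟩
    · exact fun y hy => a_mul_mem_normalSpan H hy
    · exact fun y hy => tau_mul_mem_normalSpan H i hy
  | algebraMap r =>
    intro y hy
    rw [← Algebra.smul_def]
    exact Submodule.smul_mem _ _ hy
  | add x x' _ _ h h' =>
    intro y hy
    rw [add_mul]
    exact add_mem (h y hy) (h' y hy)
  | mul x x' _ _ h h' =>
    intro y hy
    rw [mul_assoc]
    exact h _ (h' y hy)

end Span

/-! ### Flags and adapted bases -/

section Flags

variable {F : Type*} [Field F] {n : ℕ}

lemma mem_span_image_iff (b : Module.Basis (Fin n) F (Fin n → F)) {S : Set (Fin n)}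
    {v : Fin n → F} : v ∈ Submodule.span F (b '' S) ↔ ∀ k ∉ S, b.repr v k = 0 := by
  rw [Module.Basis.mem_span_image]
  constructor
  · intro h k hk
    by_contra hne
    exact hk (h (Finsupp.mem_support_iff.mpr hne))
  · intro h k hk
    by_contra hk'
    exact Finsupp.mem_support_iff.mp hk (h k hk')

/-- The complete flag that is spanned by the initial segments of a basis. -/
def flagOf (b : Module.Basis (Fin n) F (Fin n → F)) : CompleteFlag F n where
  sub i := Submodule.span F (b '' {k | k.1 < i.1})
  mono i j hij := Submodule.span_mono (Set.image_mono fun k hk =>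
    Set.mem_ofPred.mpr (lt_of_lt_of_le (Set.mem_ofPred.mp hk) hij))
  finrank_sub i := by
    have h := finrank_span_eq_card (b.linearIndependent.comp (fun k : {k : Fin n // k.1 < i.1} => k.1)
      Subtype.val_injective)
    rw [Fintype.card_subtype] at h
    rw [Set.image_eq_range]
    refine h.trans ?_
    rw [Fin.card_filter_val_lt, min_eq_right (Nat.lt_succ_iff.mp i.2)]

lemma flagOf_sub (b : Module.Basis (Fin n) F (Fin n → F)) (i : Fin (n + 1)) :
    (flagOf b).sub i = Submodule.span F (b '' {k | k.1 < i.1}) := rfl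

lemma exists_basis_coe_eq {x : Fin n → Fin n → F} (h : ⊤ ≤ Submodule.span F (Set.range x)) :
    ∃ b : Module.Basis (Fin n) F (Fin n → F), ⇑b = x :=
  ⟨basisOfTopLeSpanOfCardEqFinrank x h (by rw [Module.finrank_fin_fun, Fintype.card_fin]),
    coe_basisOfTopLeSpanOfCardEqFinrank x h _⟩

lemma mem_flagOf (b : Module.Basis (Fin n) F (Fin n → F)) {i : Fin (n + 1)} {v : Fin n → F} :
    v ∈ (flagOf b).sub i ↔ ∀ k : Fin n, i.1 ≤ k.1 → b.repr v k = 0 := by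
  rw [flagOf, mem_span_image_iff]
  simp

lemma flagOf_eq_of_forall_mem {b b' : Module.Basis (Fin n) F (Fin n → F)}
    (h : ∀ i, b' i ∈ Submodule.span F (b '' {k | k ≤ i})) : flagOf b' = flagOf b := by
  ext1
  funext i
  refine Submodule.eq_of_le_of_finrank_eq ?_ ?_
  · refine Submodule.span_le.mpr ?_
    rintro _ ⟨k, hk, rfl⟩
    refine Submodule.span_mono (Set.image_mono fun l hl => ?_) (h k)
    exact Set.mem_ofPred.mpr (lt_of_le_of_lt (Fin.le_def.mp (Set.mem_ofPred.mp hl))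
      (Set.mem_ofPred.mp hk))
  · rw [CompleteFlag.finrank_sub, CompleteFlag.finrank_sub]

lemma basis_mem_flagOf (b : Module.Basis (Fin n) F (Fin n → F)) {k : Fin n} {i : Fin (n + 1)}
    (h : k.1 < i.1) : b k ∈ (flagOf b).sub i :=
  Submodule.subset_span ⟨k, Set.mem_ofPred.mpr h, rfl⟩

lemma exists_flagOf_eq (f : CompleteFlag F n) : ∃ b, flagOf b = f := by
  have hne : ∀ k : Fin n, ∃ x ∈ f.sub k.succ, x ∉ f.sub k.castSucc := by
    intro k
    by_contra h
    push Not at h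
    have h1 := Submodule.finrank_mono (show f.sub k.succ ≤ f.sub k.castSucc from h)
    rw [f.finrank_sub, f.finrank_sub, Fin.val_succ, Fin.val_castSucc] at h1
    omega
  choose x hx1 hx2 using hne
  have hle : ∀ i : Fin (n + 1), Submodule.span F (x '' {k | k.1 < i.1}) ≤ f.sub i := by
    intro i
    refine Submodule.span_le.mpr ?_
    rintro _ ⟨k, hk, rfl⟩
    exact f.mono (show k.succ ≤ i from Fin.le_def.mpr (Set.mem_ofPred.mp hk)) (hx1 k)
  have hge : ∀ i : Fin (n + 1), f.sub i ≤ Submodule.span F (x '' {k | k.1 < i.1}) := by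
    intro i
    induction i using Fin.induction with
    | zero =>
      have h0 : f.sub 0 = ⊥ := Submodule.finrank_eq_zero.mp (f.finrank_sub 0)
      rw [h0]
      exact bot_le
    | succ i ih =>
      have h1 : f.sub i.castSucc ≤ Submodule.span F (x '' {k | k.1 < i.succ.1}) :=
        ih.trans (Submodule.span_mono (Set.image_mono fun k hk => by
          rw [Set.mem_ofPred_eq, Fin.val_castSucc] at hk
          rw [Set.mem_ofPred_eq, Fin.val_succ]; omega))
      have h2 : x i ∈ Submodule.span F (x '' {k | k.1 < i.succ.1}) :=
        Submodule.subset_span ⟨i, by simp, rfl⟩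
      have h3 : f.sub i.castSucc < Submodule.span F (x '' {k | k.1 < i.succ.1}) :=
        lt_of_le_of_ne h1 fun h => hx2 i (h ▸ h2)
      have h4 := Submodule.finrank_lt_finrank_of_lt h3
      refine (Submodule.eq_of_le_of_finrank_le (hle i.succ) ?_).ge
      rw [f.finrank_sub] at h4 ⊢
      rw [Fin.val_castSucc] at h4
      exact h4
  have htop : ⊤ ≤ Submodule.span F (Set.range x) := by
    have h1 : f.sub (Fin.last n) = ⊤ :=
      Submodule.eq_top_of_finrank_eq (by rw [f.finrank_sub, Module.finrank_fin_fun, Fin.val_last])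
    rw [← h1]
    refine (hge _).trans (Submodule.span_mono (Set.image_subset_range _ _))
  obtain ⟨b, rfl⟩ := exists_basis_coe_eq htop
  refine ⟨b, ?_⟩
  ext1
  funext i
  rw [flagOf_sub]
  exact le_antisymm (hle i) (hge i)

/-- A family that is triangular with respect to a basis is again a basis, and it spans the same
flag. -/
lemma exists_basis_of_triangular (b : Module.Basis (Fin n) F (Fin n → F)) (g : Fin n → Fin n → F)
    (h : ∀ i, ∃ d : F, d ≠ 0 ∧ g i - d • b i ∈ Submodule.span F (b '' {k | k < i})) :
    ∃ b' : Module.Basis (Fin n) F (Fin n → F), ⇑b' = g ∧ flagOf b' = flagOf b := by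
  have hb : ∀ i, b i ∈ Submodule.span F (Set.range g) := by
    intro i
    induction i using WellFoundedLT.induction with
    | _ i ih =>
      obtain ⟨d, hd, hr⟩ := h i
      have h1 : Submodule.span F (b '' {k | k < i}) ≤ Submodule.span F (Set.range g) := by
        refine Submodule.span_le.mpr ?_
        rintro _ ⟨k, hk, rfl⟩
        exact ih k (Set.mem_ofPred.mp hk)
      have h2 : d • b i ∈ Submodule.span F (Set.range g) := by
        have := sub_mem (Submodule.subset_span ⟨i, rfl⟩ : g i ∈ Submodule.span F (Set.range g))
          (h1 hr)
        rwa [sub_sub_cancel] at this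
      exact (Submodule.smul_mem_iff _ hd).mp h2
  have htop : ⊤ ≤ Submodule.span F (Set.range g) := by
    rw [← b.span_eq]
    refine Submodule.span_le.mpr ?_
    rintro _ ⟨i, rfl⟩
    exact hb i
  obtain ⟨b', rfl⟩ := exists_basis_coe_eq htop
  refine ⟨b', rfl, flagOf_eq_of_forall_mem fun i => ?_⟩
  obtain ⟨d, -, hr⟩ := h i
  have h1 : b' i - d • b i ∈ Submodule.span F (b '' {k | k ≤ i}) := by
    refine Submodule.span_mono (Set.image_mono fun k hk => ?_) hr
    rw [Set.mem_ofPred_eq] at *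
    exact hk.le
  have h2 : b i ∈ Submodule.span F (b '' {k | k ≤ i}) :=
    Submodule.subset_span ⟨i, Set.mem_ofPred.mpr le_rfl, rfl⟩
  have h3 := add_mem h1 (Submodule.smul_mem _ d h2)
  rwa [sub_add_cancel] at h3

/-- The flags `f` and `f'` are spanned by `b_1, …, b_n` and by `b_{w(1)}, …, b_{w(n)}`. -/
def Adapted (b : Module.Basis (Fin n) F (Fin n → F)) (w : Equiv.Perm (Fin n))
    (f f' : CompleteFlag F n) : Prop :=
  f = flagOf b ∧ f' = flagOf (b.reindex w.symm)

lemma inOrbit_iff {w : Equiv.Perm (Fin n)} {β : Finset (Fin n)} {f f' : CompleteFlag F n}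
    {v : Fin n → F} : InOrbit w β f f' v ↔ ∃ b, Adapted b w f f' ∧ v = ∑ i ∈ β, b i := by
  have h : ∀ b : Module.Basis (Fin n) F (Fin n → F),
      (fun k => b (w k)) = b.reindex w.symm := by
    intro b; ext1 k; simp
  constructor
  · rintro ⟨b, h1, h2, h3⟩
    refine ⟨b, ⟨?_, ?_⟩, h3⟩
    · ext1; funext i; rw [h1 i, flagOf]
    · ext1; funext j; rw [h2 j, h b, flagOf]
  · rintro ⟨b, ⟨rfl, rfl⟩, h3⟩
    exact ⟨b, fun i => rfl, fun j => by rw [h b, flagOf], h3⟩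

lemma Adapted.repr_ne_zero {b b' : Module.Basis (Fin n) F (Fin n → F)} {w w' : Equiv.Perm (Fin n)}
    {f f' : CompleteFlag F n} (h : Adapted b w f f') (h' : Adapted b' w' f f') {i k : Fin n}
    (hk : b.repr (b' i) k ≠ 0) : k ≤ i ∧ w.symm k ≤ w'.symm i := by
  constructor
  · have h1 : b' i ∈ (flagOf b).sub i.succ := by
      rw [← h.1, h'.1]; exact basis_mem_flagOf _ (by simp)
    rw [mem_flagOf] at h1
    by_contra hc
    refine hk (h1 k ?_)
    rw [Fin.val_succ]
    exact not_le.mp hc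
  · have h1 : b' i ∈ (flagOf (b.reindex w.symm)).sub (w'.symm i).succ := by
      rw [← h.2, h'.2]
      have := basis_mem_flagOf (b'.reindex w'.symm) (k := w'.symm i) (i := (w'.symm i).succ)
        (by simp)
      simpa using this
    rw [mem_flagOf] at h1
    by_contra hc
    refine hk ?_
    have h2 := h1 (w.symm k) (by rw [Fin.val_succ]; exact not_le.mp hc)
    simpa using h2

lemma Adapted.repr_self_ne_zero {b b' : Module.Basis (Fin n) F (Fin n → F)}
    {w w' : Equiv.Perm (Fin n)} {f f' : CompleteFlag F n} (h : Adapted b w f f')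
    (h' : Adapted b' w' f f') (i : Fin n) : b.repr (b' i) i ≠ 0 := by
  intro h0
  have h1 : b' i ∈ (flagOf b).sub i.castSucc := by
    rw [mem_flagOf]
    intro k hk
    rcases (show i ≤ k from hk).eq_or_lt with rfl | hlt
    · exact h0
    · by_contra hne
      exact absurd (h.repr_ne_zero h' hne).1 (not_le.mpr hlt)
  rw [← h.1, h'.1, mem_flagOf] at h1
  have h2 := h1 i le_rfl
  simp at h2

/-- The relative position of two flags is unique. -/
lemma Adapted.perm_eq {b b' : Module.Basis (Fin n) F (Fin n → F)} {w w' : Equiv.Perm (Fin n)}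
    {f f' : CompleteFlag F n} (h : Adapted b w f f') (h' : Adapted b' w' f f') : w = w' := by
  have h1 : w.symm = w'.symm := by
    ext i
    exact congrArg Fin.val (le_antisymm (h.repr_ne_zero h' (h.repr_self_ne_zero h' i)).2
      (h'.repr_ne_zero h (h'.repr_self_ne_zero h i)).2)
  simpa using congrArg Equiv.symm h1

/-- A change of basis that is triangular with respect to both orders preserves both flags. -/
lemma Adapted.exists_of_triangular {b : Module.Basis (Fin n) F (Fin n → F)}
    {w : Equiv.Perm (Fin n)} {f f' : CompleteFlag F n} (h : Adapted b w f f')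
    (g : Fin n → Fin n → F) (hg : ∀ i, ∃ d : F, d ≠ 0 ∧
      g i - d • b i ∈ Submodule.span F (b '' {k | k < i ∧ w.symm k < w.symm i})) :
    ∃ b' : Module.Basis (Fin n) F (Fin n → F), ⇑b' = g ∧ Adapted b' w f f' := by
  obtain ⟨b', rfl, hb'⟩ := exists_basis_of_triangular b g fun i => by
    obtain ⟨d, hd, hr⟩ := hg i
    exact ⟨d, hd, Submodule.span_mono (Set.image_mono fun k hk =>
      Set.mem_ofPred.mpr (Set.mem_ofPred.mp hk).1) hr⟩
  refine ⟨b', rfl, h.1.trans hb'.symm, h.2.trans (flagOf_eq_of_forall_mem fun j => ?_).symm⟩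
  obtain ⟨d, -, hr⟩ := hg (w j)
  rw [Module.Basis.reindex_apply, Equiv.symm_symm, ← sub_add_cancel (b' (w j)) (d • b (w j))]
  refine add_mem ?_ (Submodule.smul_mem _ _ (Submodule.subset_span ⟨j, Set.mem_ofPred.mpr le_rfl, by simp⟩))
  refine Submodule.span_mono ?_ hr
  rintro _ ⟨k, hk, rfl⟩
  refine ⟨w.symm k, Set.mem_ofPred.mpr ?_, by simp⟩
  have := (Set.mem_ofPred.mp hk).2
  rw [Equiv.symm_apply_apply] at this
  exact this.le

open Classical in
/-- The order ideal of positions that is generated by the support of `v`. -/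
noncomputable def supportIdeal (b : Module.Basis (Fin n) F (Fin n → F)) (w : Equiv.Perm (Fin n))
    (v : Fin n → F) : Finset (Fin n) :=
  {j | ∃ k, b.repr v k ≠ 0 ∧ j ≤ k ∧ w.symm j ≤ w.symm k}

lemma mem_supportIdeal {b : Module.Basis (Fin n) F (Fin n → F)} {w : Equiv.Perm (Fin n)}
    {v : Fin n → F} {j : Fin n} :
    j ∈ supportIdeal b w v ↔ ∃ k, b.repr v k ≠ 0 ∧ j ≤ k ∧ w.symm j ≤ w.symm k := by
  simp [supportIdeal]

lemma admissible_supportIdeal (b : Module.Basis (Fin n) F (Fin n → F)) (w : Equiv.Perm (Fin n))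
    (v : Fin n → F) : Admissible w (supportIdeal b w v) := by
  rw [admissible_iff]
  intro i hi j h1 h2
  rw [mem_supportIdeal] at *
  obtain ⟨k, hk, h3, h4⟩ := hi
  exact ⟨k, hk, h1.trans h3, h2.trans h4⟩

lemma supportIdeal_subset_iff {b : Module.Basis (Fin n) F (Fin n → F)} {w : Equiv.Perm (Fin n)}
    {v : Fin n → F} {β : Finset (Fin n)} (hβ : Admissible w β) :
    supportIdeal b w v ⊆ β ↔ v ∈ Submodule.span F (b '' β) := by
  rw [mem_span_image_iff]
  constructor
  · intro h k hk
    by_contra hne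
    exact hk (h (mem_supportIdeal.mpr ⟨k, hne, le_rfl, le_rfl⟩))
  · intro h j hj
    obtain ⟨k, hk, h1, h2⟩ := mem_supportIdeal.mp hj
    refine hβ.mem_of_le ?_ h1 h2
    by_contra hk'
    exact hk (h k hk')

/-- The vector `v` can be brought into the normal form `∑_{i ∈ β} b_i` by a change of an adapted
basis, where `β` is the order ideal generated by its support. -/
lemma Adapted.inOrbit_supportIdeal {b : Module.Basis (Fin n) F (Fin n → F)}
    {w : Equiv.Perm (Fin n)} {f f' : CompleteFlag F n} (h : Adapted b w f f') (v : Fin n → F) :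
    InOrbit w (supportIdeal b w v) f f' v := by
  classical
  set β := supportIdeal b w v with hβ
  have hex : ∀ j, ∃ k, j ∈ β → b.repr v k ≠ 0 ∧ j ≤ k ∧ w.symm j ≤ w.symm k := by
    intro j
    by_cases hj : j ∈ β
    · obtain ⟨k, hk⟩ := mem_supportIdeal.mp hj
      exact ⟨k, fun _ => hk⟩
    · exact ⟨j, fun h => absurd h hj⟩
  choose κ hκ using hex
  -- every position of `β` outside the support is absorbed by a position `κ j` of the support
  set g : Fin n → Fin n → F := fun k =>
    if b.repr v k = 0 then b k
    else b.repr v k • b k - ∑ j ∈ β with (b.repr v j = 0 ∧ κ j = k), b j with hg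
  obtain ⟨b', hb', had⟩ := h.exists_of_triangular g (by
    intro k
    by_cases hk : b.repr v k = 0
    · exact ⟨1, one_ne_zero, by simp [hg, hk]⟩
    · refine ⟨b.repr v k, hk, ?_⟩
      simp only [hg, if_neg hk, sub_sub_cancel_left]
      refine neg_mem (Submodule.sum_mem _ fun j hj => Submodule.subset_span ⟨j, ?_, rfl⟩)
      rw [Finset.mem_filter] at hj
      obtain ⟨hj1, hj2, rfl⟩ := hj
      obtain ⟨h1, h2, h3⟩ := hκ j hj1
      have hne : j ≠ κ j := fun h' => h1 (h' ▸ hj2)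
      exact Set.mem_ofPred.mpr ⟨lt_of_le_of_ne h2 hne, lt_of_le_of_ne h3 fun h' => hne (w.symm.injective h')⟩)
  refine inOrbit_iff.mpr ⟨b', had, ?_⟩
  have hsub : ∀ k, b.repr v k ≠ 0 → k ∈ β := fun k hk =>
    mem_supportIdeal.mpr ⟨k, hk, le_rfl, le_rfl⟩
  have h1 : ∑ k ∈ β with ¬ b.repr v k = 0, b.repr v k • b k = v := by
    conv_rhs => rw [← b.sum_repr v]
    refine Finset.sum_subset (Finset.subset_univ _) fun k _ hk => ?_
    rw [Finset.mem_filter] at hk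
    have : b.repr v k = 0 := by
      by_contra hne
      exact hk ⟨hsub k hne, hne⟩
    rw [this, zero_smul]
  have h2 : ∑ k ∈ β with ¬ b.repr v k = 0, ∑ j ∈ β with (b.repr v j = 0 ∧ κ j = k), b j =
      ∑ j ∈ β with b.repr v j = 0, b j := by
    have hmaps : ∀ j ∈ β.filter (fun j => b.repr v j = 0),
        κ j ∈ β.filter (fun k => ¬ b.repr v k = 0) := by
      intro j hj
      have := (hκ j (Finset.mem_filter.mp hj).1).1
      exact Finset.mem_filter.mpr ⟨hsub _ this, this⟩
    rw [← Finset.sum_fiberwise_of_maps_to hmaps]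
    refine Finset.sum_congr rfl fun k _ => ?_
    rw [Finset.filter_filter]
  rw [hb', ← Finset.sum_filter_add_sum_filter_not β (fun k => b.repr v k = 0)]
  have h3 : ∑ k ∈ β with b.repr v k = 0, g k = ∑ k ∈ β with b.repr v k = 0, b k :=
    Finset.sum_congr rfl fun k hk => by simp [hg, (Finset.mem_filter.mp hk).2]
  have h4 : ∑ k ∈ β with ¬ b.repr v k = 0, g k =
      ∑ k ∈ β with ¬ b.repr v k = 0, (b.repr v k • b k -
        ∑ j ∈ β with (b.repr v j = 0 ∧ κ j = k), b j) :=
    Finset.sum_congr rfl fun k hk => by simp [hg, (Finset.mem_filter.mp hk).2]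
  rw [h3, h4, Finset.sum_sub_distrib, h1, h2, add_sub_cancel]

lemma Adapted.inOrbit_iff {b : Module.Basis (Fin n) F (Fin n → F)}
    {w : Equiv.Perm (Fin n)} {f f' : CompleteFlag F n} (h : Adapted b w f f') {v : Fin n → F}
    {β : Finset (Fin n)} (hβ : Admissible w β) :
    InOrbit w β f f' v ↔ supportIdeal b w v = β := by
  refine ⟨fun hv => ?_, fun hv => hv ▸ h.inOrbit_supportIdeal v⟩
  obtain ⟨b', h', hv⟩ := Mirabolic.inOrbit_iff.mp hv
  refine Finset.Subset.antisymm ((supportIdeal_subset_iff hβ).mpr ?_) fun i hi => ?_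
  · rw [hv]
    refine Submodule.sum_mem _ fun i hi => ?_
    rw [mem_span_image_iff]
    intro k hk
    by_contra hne
    obtain ⟨h1, h2⟩ := h.repr_ne_zero h' hne
    exact hk (hβ.mem_of_le hi h1 h2)
  · have h1 : b'.repr v i = 1 := by
      rw [hv]
      simp [Finsupp.single_apply, hi]
    have h2 : b'.repr v i = ∑ k, b.repr v k * b'.repr (b k) i := by
      conv_lhs => rw [← b.sum_repr v]
      simp only [map_sum, map_smul, Finsupp.finsetSum_apply, Finsupp.smul_apply, smul_eq_mul]
    rw [h1] at h2
    obtain ⟨k, -, hk⟩ := Finset.exists_ne_zero_of_sum_ne_zero (h2 ▸ one_ne_zero)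
    obtain ⟨h3, h4⟩ := h'.repr_ne_zero h (right_ne_zero_of_mul hk)
    exact mem_supportIdeal.mpr ⟨k, left_ne_zero_of_mul hk, h3, h4⟩

end Flags

/-! ### Cells in the convolution algebra -/

section Cells

variable (F : Type*) [Field F] {n : ℕ}

open Classical in
/-- The characteristic function of the union of the orbits of the admissible pairs `(w, β')` with
`β' ⊆ β`. -/
noncomputable def cellFn (w : Equiv.Perm (Fin n)) (β : Finset (Fin n)) : MirabolicAt F n :=
  ∑ β' : Finset (Fin n) with β' ⊆ β ∧ Admissible w β', orbitFunction F n w β'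

variable {F}

open Classical in
lemma orbitFunction_val (w : Equiv.Perm (Fin n)) (β : Finset (Fin n)) (f f' v) :
    (orbitFunction F n w β).val f f' v = if InOrbit w β f f' v then 1 else 0 := rfl

lemma cellFn_empty (w : Equiv.Perm (Fin n)) : cellFn F w ∅ = orbitFunction F n w ∅ := by
  classical
  rw [cellFn]
  have h : Finset.univ.filter (fun β' => β' ⊆ (∅ : Finset (Fin n)) ∧ Admissible w β') = {∅} := by
    ext β'
    simp only [Finset.mem_filter, Finset.mem_univ, true_and, Finset.subset_empty,
      Finset.mem_singleton, and_iff_left_iff_imp]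
    rintro rfl
    exact fun i hi => absurd hi (by simp)
  rw [h, Finset.sum_singleton]

variable [Finite F]

lemma MirabolicAt.val_sum {ι : Type*} (s : Finset ι) (α : ι → MirabolicAt F n) (f f' v) :
    (∑ i ∈ s, α i).val f f' v = ∑ i ∈ s, (α i).val f f' v := by
  classical
  induction s using Finset.induction_on with
  | empty => simp [MirabolicAt.val_zero]
  | insert i s hi ih => rw [Finset.sum_insert hi, Finset.sum_insert hi, MirabolicAt.val_add, ih]

open Classical in
lemma cellFn_val_of_adapted {b : Module.Basis (Fin n) F (Fin n → F)} {w : Equiv.Perm (Fin n)}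
    {f f' : CompleteFlag F n} (h : Adapted b w f f') {β : Finset (Fin n)} (hβ : Admissible w β)
    (v : Fin n → F) :
    (cellFn F w β).val f f' v = if v ∈ Submodule.span F (b '' β) then 1 else 0 := by
  rw [cellFn, MirabolicAt.val_sum, ← supportIdeal_subset_iff (w := w) hβ]
  have h1 : ∀ β' ∈ Finset.univ.filter (fun β' => β' ⊆ β ∧ Admissible w β'),
      (orbitFunction F n w β').val f f' v = if supportIdeal b w v = β' then 1 else 0 := by
    intro β' hβ'
    rw [orbitFunction_val]
    exact if_congr (h.inOrbit_iff (Finset.mem_filter.mp hβ').2.2) rfl rfl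
  rw [Finset.sum_congr rfl h1, Finset.sum_ite_eq]
  simp [admissible_supportIdeal b w v]

lemma cellFn_val_of_not_adapted {w : Equiv.Perm (Fin n)} {f f' : CompleteFlag F n}
    (h : ¬ ∃ b, Adapted b w f f') (β : Finset (Fin n)) (v : Fin n → F) :
    (cellFn F w β).val f f' v = 0 := by
  classical
  rw [cellFn, MirabolicAt.val_sum]
  refine Finset.sum_eq_zero fun β' _ => ?_
  rw [orbitFunction_val, if_neg]
  rw [inOrbit_iff]
  exact fun ⟨b, hb, _⟩ => h ⟨b, hb⟩

open Classical in
lemma cellFn_empty_val_of_adapted {b : Module.Basis (Fin n) F (Fin n → F)}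
    {w : Equiv.Perm (Fin n)} {f f' : CompleteFlag F n} (h : Adapted b w f f') (v : Fin n → F) :
    (cellFn F w ∅).val f f' v = if v = 0 then 1 else 0 := by
  rw [cellFn_val_of_adapted h (fun i hi => absurd hi (by simp))]
  simp

end Cells

/-! ### Flags that differ in one subspace -/

section Adjacent

variable {F : Type*} [Field F] {m : ℕ}

lemma exists_shear (b : Module.Basis (Fin (m + 1)) F (Fin (m + 1) → F)) (i : Fin m) (c : F) :
    ∃ b' : Module.Basis (Fin (m + 1)) F (Fin (m + 1) → F),
      ⇑b' = Function.update b i.succ (b i.succ + c • b i.castSucc) ∧ flagOf b' = flagOf b := by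
  refine exists_basis_of_triangular b _ fun k => ⟨1, one_ne_zero, ?_⟩
  by_cases hk : k = i.succ
  · subst hk
    rw [Function.update_self, one_smul, add_sub_cancel_left]
    exact Submodule.smul_mem _ _ (Submodule.subset_span
      ⟨i.castSucc, Set.mem_ofPred.mpr Fin.castSucc_lt_succ, rfl⟩)
  · rw [Function.update_of_ne hk, one_smul, sub_self]
    exact zero_mem _

/-- The basis obtained from `b` by adding `c b_i` to `b_{i+1}`. -/
noncomputable def shear (b : Module.Basis (Fin (m + 1)) F (Fin (m + 1) → F)) (i : Fin m) (c : F) :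
    Module.Basis (Fin (m + 1)) F (Fin (m + 1) → F) := (exists_shear b i c).choose

/-- The basis obtained from `b` by adding `c b_i` to `b_{i+1}` and exchanging the two vectors. -/
noncomputable def stepBasis (b : Module.Basis (Fin (m + 1)) F (Fin (m + 1) → F)) (i : Fin m)
    (c : F) : Module.Basis (Fin (m + 1)) F (Fin (m + 1) → F) :=
  (shear b i c).reindex (simpleRefl i)

variable {b : Module.Basis (Fin (m + 1)) F (Fin (m + 1) → F)} {i : Fin m} {c : F}

lemma coe_shear : ⇑(shear b i c) = Function.update b i.succ (b i.succ + c • b i.castSucc) :=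
  (exists_shear b i c).choose_spec.1

lemma flagOf_shear : flagOf (shear b i c) = flagOf b := (exists_shear b i c).choose_spec.2

lemma shear_zero : shear b i 0 = b := by
  apply DFunLike.coe_injective
  rw [coe_shear, zero_smul, add_zero, Function.update_eq_self]

lemma stepBasis_castSucc : stepBasis b i c i.castSucc = b i.succ + c • b i.castSucc := by
  rw [stepBasis, Module.Basis.reindex_apply, simpleRefl_symm, simpleRefl_castSucc, coe_shear,
    Function.update_self]

lemma stepBasis_succ : stepBasis b i c i.succ = b i.castSucc := by
  rw [stepBasis, Module.Basis.reindex_apply, simpleRefl_symm, simpleRefl_succ, coe_shear,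
    Function.update_of_ne Fin.castSucc_lt_succ.ne]

lemma stepBasis_of_ne {k : Fin (m + 1)} (h1 : k ≠ i.castSucc) (h2 : k ≠ i.succ) :
    stepBasis b i c k = b k := by
  rw [stepBasis, Module.Basis.reindex_apply, simpleRefl_symm, simpleRefl_of_ne h1 h2, coe_shear,
    Function.update_of_ne h2]

/-- At an ascent `i` of `w`, adding a multiple of `b_i` to `b_{i+1}` changes neither flag. -/
lemma Adapted.shear {w : Equiv.Perm (Fin (m + 1))} {f f' : CompleteFlag F (m + 1)}
    (h : Adapted b w f f') (hi : w.symm i.castSucc < w.symm i.succ) :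
    Adapted (shear b i c) w f f' := by
  obtain ⟨b', hb', h'⟩ := h.exists_of_triangular
    (Function.update b i.succ (b i.succ + c • b i.castSucc)) (fun k => ⟨1, one_ne_zero, by
    by_cases hk : k = i.succ
    · subst hk
      rw [Function.update_self, one_smul, add_sub_cancel_left]
      exact Submodule.smul_mem _ _ (Submodule.subset_span
        ⟨i.castSucc, Set.mem_ofPred.mpr ⟨Fin.castSucc_lt_succ, hi⟩, rfl⟩)
    · rw [Function.update_of_ne hk, one_smul, sub_self]
      exact zero_mem _⟩)
  have : Mirabolic.shear b i c = b' := DFunLike.coe_injective (coe_shear.trans hb'.symm)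
  rwa [this]

lemma Adapted.step {w : Equiv.Perm (Fin (m + 1))} {f f' : CompleteFlag F (m + 1)}
    (h : Adapted b w f f') (i : Fin m) :
    Adapted (b.reindex (simpleRefl i)) (simpleRefl i * w) (flagOf (b.reindex (simpleRefl i))) f' := by
  refine ⟨rfl, h.2.trans ?_⟩
  congr 1
  apply Module.Basis.eq_of_apply_eq
  intro k
  simp

lemma Adapted.stepBasis {w : Equiv.Perm (Fin (m + 1))} {f f' : CompleteFlag F (m + 1)}
    (h : Adapted b w f f') (hi : w.symm i.castSucc < w.symm i.succ) :
    Adapted (stepBasis b i c) (simpleRefl i * w) (flagOf (stepBasis b i c)) f' :=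
  (h.shear hi).step i

/-- Two different complete flags that agree except in the subspace of dimension `i + 1`. -/
def Adj (i : Fin m) (f h : CompleteFlag F (m + 1)) : Prop :=
  f ≠ h ∧ ∀ j, j.1 ≠ i.1 + 1 → f.sub j = h.sub j

lemma Adj.symm {f h : CompleteFlag F (m + 1)} (H : Adj i f h) : Adj i h f :=
  ⟨H.1.symm, fun j hj => (H.2 j hj).symm⟩

lemma Adj.trans {f h k : CompleteFlag F (m + 1)} (H : Adj i f h) (H' : Adj i h k) :
    f = k ∨ Adj i f k := by
  by_cases hfk : f = k
  · exact Or.inl hfk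
  · exact Or.inr ⟨hfk, fun j hj => (H.2 j hj).trans (H'.2 j hj)⟩

/-- Being equal or adjacent is an equivalence relation. -/
lemma Adj.eq_or_iff {f h k : CompleteFlag F (m + 1)} (H : Adj i f h) :
    (h = k ∨ Adj i h k) ↔ (f = k ∨ Adj i f k) := by
  constructor
  · rintro (rfl | h')
    · exact Or.inr H
    · exact H.trans h'
  · rintro (rfl | h')
    · exact Or.inr H.symm
    · exact H.symm.trans h'

lemma stepBasis_repr_succ (b : Module.Basis (Fin (m + 1)) F (Fin (m + 1) → F)) (i : Fin m)
    (c d : F) :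
    (stepBasis b i d).repr (stepBasis b i c i.castSucc) i.succ = c - d := by
  have h : stepBasis b i c i.castSucc =
      stepBasis b i d i.castSucc + (c - d) • stepBasis b i d i.succ := by
    rw [stepBasis_castSucc, stepBasis_castSucc, stepBasis_succ, sub_smul]
    abel
  rw [h, map_add, map_smul, Module.Basis.repr_self, Module.Basis.repr_self]
  simp [Fin.castSucc_lt_succ.ne]

lemma flagOf_stepBasis_injective (b : Module.Basis (Fin (m + 1)) F (Fin (m + 1) → F))
    (i : Fin m) : Function.Injective fun c => flagOf (stepBasis b i c) := by
  intro c d h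
  have h1 := basis_mem_flagOf (stepBasis b i c) (k := i.castSucc) (i := i.succ.castSucc) (by simp)
  rw [show flagOf (stepBasis b i c) = flagOf (stepBasis b i d) from h, mem_flagOf] at h1
  have h2 := h1 i.succ (by simp)
  rw [stepBasis_repr_succ] at h2
  exact sub_eq_zero.mp h2

lemma flagOf_stepBasis_sub {j : Fin (m + 2)} (hj : j.1 ≠ i.1 + 1) :
    (flagOf b).sub j = (flagOf (stepBasis b i c)).sub j := by
  rw [← flagOf_shear (b := b) (i := i) (c := c), flagOf_sub, flagOf_sub]
  congr 1
  have key : ∀ k : Fin (m + 1), k.1 < j.1 → (simpleRefl i k).1 < j.1 := by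
    intro k hk
    by_cases h1 : k = i.castSucc
    · subst h1
      rw [simpleRefl_castSucc, Fin.val_succ]
      rw [Fin.val_castSucc] at hk
      omega
    by_cases h2 : k = i.succ
    · subst h2
      rw [simpleRefl_succ, Fin.val_castSucc]
      rw [Fin.val_succ] at hk
      omega
    rwa [simpleRefl_of_ne h1 h2]
  apply Set.Subset.antisymm
  · rintro _ ⟨k, hk, rfl⟩
    exact ⟨simpleRefl i k, Set.mem_ofPred.mpr (key k hk), by simp [stepBasis]⟩
  · rintro _ ⟨k, hk, rfl⟩
    exact ⟨simpleRefl i k, Set.mem_ofPred.mpr (key k hk), by simp [stepBasis]⟩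

lemma adj_stepBasis (b : Module.Basis (Fin (m + 1)) F (Fin (m + 1) → F)) (i : Fin m) (c : F) :
    Adj i (flagOf b) (flagOf (stepBasis b i c)) := by
  refine ⟨fun h => ?_, fun j hj => flagOf_stepBasis_sub hj⟩
  have h1 := basis_mem_flagOf (stepBasis b i c) (k := i.castSucc) (i := i.succ.castSucc) (by simp)
  rw [← h, mem_flagOf] at h1
  have h2 := h1 i.succ (by simp)
  rw [stepBasis_castSucc] at h2
  simp [Fin.castSucc_lt_succ.ne] at h2

lemma Adj.exists_stepBasis {h : CompleteFlag F (m + 1)} (H : Adj i (flagOf b) h) :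
    ∃ c, h = flagOf (stepBasis b i c) := by
  obtain ⟨b', rfl⟩ := exists_flagOf_eq h
  set x := b' i.castSucc with hx
  have hx1 : x ∈ (flagOf b').sub i.succ.castSucc := basis_mem_flagOf b' (by simp)
  have hx2 : x ∈ (flagOf b).sub i.succ.succ := by
    rw [H.2 _ (by simp)]
    exact (flagOf b').mono (Fin.castSucc_lt_succ).le hx1
  have hx3 : b.repr x i.succ ≠ 0 := by
    intro h0
    refine H.1 ?_
    ext1
    funext j
    by_cases hj : j.1 = i.1 + 1
    · obtain rfl : j = i.succ.castSucc := Fin.ext (by simp [hj])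
      refine (Submodule.eq_of_le_of_finrank_eq ?_ ?_).symm
      · rw [flagOf_sub b']
        refine Submodule.span_le.mpr ?_
        rintro _ ⟨k, hk, rfl⟩
        have hk : k.1 < i.1 + 1 := by simpa using hk
        rcases (Nat.lt_succ_iff.mp hk).lt_or_eq with hlt | heq
        · refine (flagOf b).mono (show i.castSucc.castSucc ≤ i.succ.castSucc by
            simp [Fin.le_def]) ?_
          rw [H.2 _ (by simp)]
          exact basis_mem_flagOf _ (by simpa using hlt)
        · obtain rfl : k = i.castSucc := Fin.ext heq
          rw [SetLike.mem_coe, mem_flagOf] at *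
          intro k hk
          rcases (show i.succ ≤ k by simpa [Fin.le_def] using hk).eq_or_lt with rfl | hlt
          · exact h0
          · exact hx2 k (by simpa [Fin.lt_def] using hlt)
      · rw [CompleteFlag.finrank_sub, CompleteFlag.finrank_sub]
    · exact H.2 j hj
  refine ⟨(b.repr x i.succ)⁻¹ * b.repr x i.castSucc, flagOf_eq_of_forall_mem fun k => ?_⟩
  set c := (b.repr x i.succ)⁻¹ * b.repr x i.castSucc with hc
  by_cases hk : k = i.castSucc
  · subst hk
    -- up to lower terms, `x` is a multiple of `b_{i+1} + c b_i`
    have h1 : x - b.repr x i.succ • stepBasis b i c i.castSucc ∈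
        (flagOf (stepBasis b i c)).sub i.castSucc.castSucc := by
      rw [← flagOf_stepBasis_sub (by simp), mem_flagOf]
      intro l hl
      have hl : i.castSucc ≤ l := by simpa [Fin.le_def] using hl
      rw [stepBasis_castSucc]
      rcases hl.eq_or_lt with rfl | hl
      · simp [Fin.castSucc_lt_succ.ne', hc, mul_inv_cancel_left₀ hx3]
      rcases (show i.succ ≤ l from hl).eq_or_lt with rfl | hl'
      · simp [Fin.castSucc_lt_succ.ne]
      · have := (mem_flagOf b).mp hx2 l (by simpa [Fin.lt_def] using hl')
        simp [this, hl.ne, hl'.ne]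
    rw [flagOf_sub] at h1
    have h2 : x - b.repr x i.succ • stepBasis b i c i.castSucc ∈
        Submodule.span F (stepBasis b i c '' {k | k ≤ i.castSucc}) := by
      refine Submodule.span_mono (Set.image_mono fun l hl => ?_) h1
      rw [Set.mem_ofPred_eq] at *
      exact le_of_lt hl
    have h3 : stepBasis b i c i.castSucc ∈
        Submodule.span F (stepBasis b i c '' {k | k ≤ i.castSucc}) :=
      Submodule.subset_span ⟨i.castSucc, Set.mem_ofPred.mpr le_rfl, rfl⟩
    have h4 := add_mem h2 (Submodule.smul_mem _ (b.repr x i.succ) h3)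
    rwa [sub_add_cancel] at h4
  · have h1 : b' k ∈ (flagOf (stepBasis b i c)).sub k.succ := by
      have hne : k.succ.1 ≠ i.1 + 1 := by
        rw [Fin.val_succ]
        intro h'
        exact hk (Fin.ext (by simpa using h'))
      rw [← flagOf_stepBasis_sub hne, H.2 _ hne]
      exact basis_mem_flagOf _ (by simp)
    rw [flagOf_sub] at h1
    refine Submodule.span_mono (Set.image_mono fun l hl => ?_) h1
    rw [Set.mem_ofPred_eq, Fin.val_succ] at *
    exact Fin.le_def.mpr (Nat.lt_succ_iff.mp hl)

end Adjacent

/-! ### Products of cells over a finite field -/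

section Products

variable {F : Type*} [Field F] {m : ℕ}

open Classical in
lemma cellFn_simpleRefl_val [Finite F] (i : Fin m) (f h : CompleteFlag F (m + 1))
    (u : Fin (m + 1) → F) :
    (cellFn F (simpleRefl i) ∅).val f h u = if u = 0 ∧ Adj i f h then 1 else 0 := by
  obtain ⟨b, rfl⟩ := exists_flagOf_eq f
  by_cases H : Adj i (flagOf b) h
  · obtain ⟨c, rfl⟩ := H.exists_stepBasis
    have had : Adapted (shear b i c) (simpleRefl i) (flagOf b) (flagOf (stepBasis b i c)) := by
      refine ⟨flagOf_shear.symm, ?_⟩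
      rw [stepBasis, simpleRefl_symm]
    rw [cellFn_empty_val_of_adapted had]
    simp [H]
  · rw [cellFn_val_of_not_adapted, if_neg (fun h' => H h'.2)]
    rintro ⟨b', h1, h2⟩
    refine H ?_
    rw [h1, h2]
    have := adj_stepBasis b' i 0
    rwa [stepBasis, shear_zero, ← simpleRefl_symm] at this

lemma adapted_one_iff {f h : CompleteFlag F (m + 1)} :
    (∃ b, Adapted b 1 f h) ↔ f = h := by
  constructor
  · rintro ⟨b, rfl, rfl⟩
    congr 1
    apply Module.Basis.eq_of_apply_eq
    intro k
    simp [← Equiv.Perm.inv_def]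
  · rintro rfl
    obtain ⟨b, rfl⟩ := exists_flagOf_eq f
    refine ⟨b, rfl, ?_⟩
    congr 1
    apply Module.Basis.eq_of_apply_eq
    intro k
    simp [← Equiv.Perm.inv_def]

open Classical in
lemma cellFn_one_val [Finite F] {k : ℕ} (hk : k < m + 2) (f h : CompleteFlag F (m + 1))
    (u : Fin (m + 1) → F) :
    (cellFn F 1 (initialSet m k)).val f h u =
      if f = h ∧ u ∈ f.sub ⟨k, hk⟩ then 1 else 0 := by
  by_cases H : ∃ b, Adapted b 1 f h
  · obtain ⟨b, hb⟩ := H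
    rw [cellFn_val_of_adapted hb (admissible_initialSet _ _)]
    refine if_congr ?_ rfl rfl
    rw [and_iff_right (adapted_one_iff.mp ⟨b, hb⟩), hb.1, flagOf_sub]
    have : (initialSet m k : Set (Fin (m + 1))) = {j | j.1 < k} := by ext; simp
    rw [this]
  · rw [cellFn_val_of_not_adapted H, if_neg]
    exact fun h' => H (adapted_one_iff.mpr h'.1)

lemma span_image_reindex (b : Module.Basis (Fin (m + 1)) F (Fin (m + 1) → F)) (i : Fin m)
    (β : Finset (Fin (m + 1))) :
    b.reindex (simpleRefl i) '' β = b '' (moveSet (simpleRefl i) β) := by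
  ext x
  constructor
  · rintro ⟨k, hk, rfl⟩
    exact ⟨simpleRefl i k, by simpa using hk, by simp⟩
  · rintro ⟨k, hk, rfl⟩
    exact ⟨simpleRefl i k, by simpa using hk, by simp⟩

lemma mem_flagOf_one {b : Module.Basis (Fin (m + 1)) F (Fin (m + 1) → F)} {u : Fin (m + 1) → F} :
    u ∈ (flagOf b).sub ⟨1, by omega⟩ ↔ ∃ c : F, c • b 0 = u := by
  rw [flagOf_sub, ← Submodule.mem_span_singleton]
  have : {k : Fin (m + 1) | k.1 < 1} = {0} := by
    ext k
    rw [Set.mem_ofPred_eq, Set.mem_singleton_iff, Fin.ext_iff, Fin.val_zero]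
    omega
  rw [this, Set.image_singleton]

lemma admissible_insert_zero {w : Equiv.Perm (Fin (m + 1))} {β : Finset (Fin (m + 1))}
    (hβ : Admissible w β) : Admissible w (insert 0 β) := by
  refine admissible_iff.mpr fun i hi j h1 h2 => ?_
  rw [Finset.mem_insert] at *
  rcases hi with rfl | hi
  · exact Or.inl (Fin.le_zero_iff.mp h1)
  · exact Or.inr (hβ.mem_of_le hi h1 h2)

variable [Finite F]

lemma cellFn_one_empty : cellFn F (1 : Equiv.Perm (Fin (m + 1))) ∅ = 1 := by
  classical
  ext f h u
  rw [← initialSet_zero, cellFn_one_val (by omega), MirabolicAt.val_one]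
  refine if_congr (and_congr_right fun _ => ?_) rfl rfl
  have : f.sub ⟨0, by omega⟩ = ⊥ := Submodule.finrank_eq_zero.mp (f.finrank_sub _)
  rw [this, Submodule.mem_bot]

open Classical in
lemma cellFn_one_mul_val {k : ℕ} (hk : k < m + 2) (α : MirabolicAt F (m + 1)) (f f' v) :
    (cellFn F 1 (initialSet m k) * α).val f f' v =
      ∑ u : Fin (m + 1) → F, if u ∈ f.sub ⟨k, hk⟩ then α.val f f' (v - u) else 0 := by
  rw [MirabolicAt.val_mul, Finset.sum_eq_single f]
  · refine Finset.sum_congr rfl fun u _ => ?_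
    rw [cellFn_one_val hk, ite_mul, one_mul, zero_mul]
    simp
  · intro h _ hne
    refine Finset.sum_eq_zero fun u _ => ?_
    rw [cellFn_one_val hk, if_neg (fun h' => hne h'.1.symm), zero_mul]
  · simp

/-- The flags adjacent to `flagOf b` at `i` are parametrized by `c : F` through `stepBasis b i c`. -/
lemma cellFn_simpleRefl_mul_val [Fintype F] (i : Fin m) (α : MirabolicAt F (m + 1))
    (b : Module.Basis (Fin (m + 1)) F (Fin (m + 1) → F)) (f' v) :
    (cellFn F (simpleRefl i) ∅ * α).val (flagOf b) f' v =
      ∑ c : F, α.val (flagOf (stepBasis b i c)) f' v := by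
  classical
  rw [MirabolicAt.val_mul]
  have h1 : ∀ h : CompleteFlag F (m + 1), ∑ u : Fin (m + 1) → F,
      (cellFn F (simpleRefl i) ∅).val (flagOf b) h u * α.val h f' (v - u) =
      if Adj i (flagOf b) h then α.val h f' v else 0 := by
    intro h
    rw [Finset.sum_eq_single 0]
    · rw [cellFn_simpleRefl_val, sub_zero]
      simp
    · intro u _ hu
      rw [cellFn_simpleRefl_val, if_neg (fun h' => hu h'.1), zero_mul]
    · simp
  rw [Finset.sum_congr rfl fun h _ => h1 h, ← Finset.sum_filter]
  symm
  refine Finset.sum_bij (fun c _ => flagOf (stepBasis b i c)) ?_ ?_ ?_ ?_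
  · intro c _
    exact Finset.mem_filter.mpr ⟨Finset.mem_univ _, adj_stepBasis b i c⟩
  · intro c _ d _ h
    exact flagOf_stepBasis_injective b i h
  · intro h hh
    obtain ⟨c, rfl⟩ := (Finset.mem_filter.mp hh).2.exists_stepBasis
    exact ⟨c, Finset.mem_univ _, rfl⟩
  · intro c _
    rfl

lemma cellFn_simpleRefl_mul_self (i : Fin m) :
    cellFn F (simpleRefl i) ∅ * cellFn F (simpleRefl i) ∅ =
      ((Nat.card F : ℂ) - 1) • cellFn F (simpleRefl i) ∅ + (Nat.card F : ℂ) • 1 := by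
  classical
  have := Fintype.ofFinite F
  ext f f' v
  obtain ⟨b, rfl⟩ := exists_flagOf_eq f
  rw [cellFn_simpleRefl_mul_val, MirabolicAt.val_add, MirabolicAt.val_smul, MirabolicAt.val_smul,
    MirabolicAt.val_one, cellFn_simpleRefl_val]
  simp only [cellFn_simpleRefl_val]
  by_cases hv : v = 0
  swap
  · simp [hv]
  by_cases hf : flagOf b = f'
  · subst hf
    have h1 : ¬ Adj i (flagOf b) (flagOf b) := fun h => h.1 rfl
    simp [hv, h1, (adj_stepBasis b i _).symm, Nat.card_eq_fintype_card]
  by_cases H : Adj i (flagOf b) f'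
  · obtain ⟨d, rfl⟩ := H.exists_stepBasis
    have h1 : ∀ c, Adj i (flagOf (stepBasis b i c)) (flagOf (stepBasis b i d)) ↔ c ≠ d := by
      intro c
      refine ⟨?_, fun hne => ?_⟩
      · rintro h rfl
        exact h.1 rfl
      · exact ((adj_stepBasis b i c).symm.trans (adj_stepBasis b i d)).resolve_left
          fun h => hne (flagOf_stepBasis_injective b i h)
    simp only [h1, hv, H, hf, true_and, and_true, if_true, if_false, mul_one, mul_zero, add_zero]
    rw [Finset.sum_boole, Finset.filter_ne', Finset.card_erase_of_mem (Finset.mem_univ _),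
      Finset.card_univ, Nat.card_eq_fintype_card, Nat.cast_sub Fintype.card_pos, Nat.cast_one]
  · have h1 : ∀ c, ¬ Adj i (flagOf (stepBasis b i c)) f' := by
      intro c h
      rcases (adj_stepBasis b i c).trans h with h | h
      · exact hf h
      · exact H h
    simp [h1, H, hf]

/-- If `(f, f')` is in relative position `s_i w`, exactly one flag adjacent to `f` at `i` is in relative
position `w` to `f'`. -/
lemma cellFn_simpleRefl_mul_cellFn (i : Fin m) {w : Equiv.Perm (Fin (m + 1))}
    {β : Finset (Fin (m + 1))} (hβ : Admissible w β) (hi : w.symm i.castSucc < w.symm i.succ) :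
    cellFn F (simpleRefl i) ∅ * cellFn F w β =
      cellFn F (simpleRefl i * w) (moveSet (simpleRefl i) β) := by
  classical
  have := Fintype.ofFinite F
  ext f f' v
  by_cases H : ∃ b, Adapted b (simpleRefl i * w) f f'
  · obtain ⟨b, hb⟩ := H
    have hb0 : Adapted (stepBasis b i 0) w (flagOf (stepBasis b i 0)) f' := by
      have := hb.step i
      rw [simpleRefl_mul_mul] at this
      rwa [stepBasis, shear_zero]
    rw [cellFn_val_of_adapted hb (hβ.moveSet_of_lt hi), hb.1, cellFn_simpleRefl_mul_val,
      Finset.sum_eq_single 0]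
    · rw [cellFn_val_of_adapted hb0 hβ, stepBasis, shear_zero, span_image_reindex]
    · -- for `c ≠ 0` the flag of `stepBasis b i c` is in the position `s_i w`, not `w`
      intro c _ hc
      refine cellFn_val_of_not_adapted ?_ _ _
      rintro ⟨b', hb'⟩
      obtain ⟨g, hg, hgf⟩ := exists_basis_of_triangular (stepBasis b i c)
        (Function.update b i.castSucc (b i.castSucc + c⁻¹ • b i.succ)) (fun k => by
          by_cases h1 : k = i.castSucc
          · subst h1
            refine ⟨c⁻¹, inv_ne_zero hc, ?_⟩
            rw [Function.update_self, stepBasis_castSucc, smul_add, smul_smul,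
              inv_mul_cancel₀ hc, one_smul, add_comm (b i.castSucc), sub_self]
            exact zero_mem _
          by_cases h2 : k = i.succ
          · subst h2
            refine ⟨-c, neg_ne_zero.mpr hc, ?_⟩
            have h3 : b i.succ - (-c) • stepBasis b i c i.succ = stepBasis b i c i.castSucc := by
              rw [stepBasis_succ, stepBasis_castSucc, neg_smul, sub_neg_eq_add]
            rw [Function.update_of_ne h1, h3]
            exact Submodule.subset_span
              ⟨i.castSucc, Set.mem_ofPred.mpr Fin.castSucc_lt_succ, rfl⟩
          · refine ⟨1, one_ne_zero, ?_⟩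
            rw [Function.update_of_ne h1, stepBasis_of_ne h1 h2, one_smul, sub_self]
            exact zero_mem _)
      have hgw : Adapted g (simpleRefl i * w) (flagOf (stepBasis b i c)) f' := by
        refine ⟨hgf.symm, hb.2.trans (flagOf_eq_of_forall_mem fun k => ?_).symm⟩
        rw [Module.Basis.reindex_apply, Equiv.symm_symm, hg]
        have hmem : ∀ l : Fin (m + 1), (simpleRefl i * w).symm l ≤ k →
            b l ∈ Submodule.span F (b.reindex (simpleRefl i * w).symm '' {j | j ≤ k}) := by
          intro l hl
          refine Submodule.subset_span ⟨(simpleRefl i * w).symm l, Set.mem_ofPred.mpr hl, ?_⟩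
          rw [Module.Basis.reindex_apply, Equiv.symm_symm, Equiv.apply_symm_apply]
        by_cases h1 : (simpleRefl i * w) k = i.castSucc
        · rw [h1, Function.update_self]
          have h2 : k = w.symm i.succ := by
            simpa using (Equiv.eq_symm_apply _).mpr h1
          subst h2
          refine add_mem (hmem _ (by simp)) (Submodule.smul_mem _ _ (hmem _ ?_))
          simpa using hi.le
        · rw [Function.update_of_ne h1]
          exact hmem _ (by rw [Equiv.symm_apply_apply])
      have h1 := congrArg (fun g : Equiv.Perm (Fin (m + 1)) => g.symm i.castSucc)
        (hb'.perm_eq hgw)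
      simp only [mul_symm_apply, simpleRefl_symm, simpleRefl_castSucc] at h1
      exact hi.ne h1
    · simp
  · rw [cellFn_val_of_not_adapted H]
    obtain ⟨b, rfl⟩ := exists_flagOf_eq f
    rw [cellFn_simpleRefl_mul_val]
    refine Finset.sum_eq_zero fun c _ => cellFn_val_of_not_adapted ?_ _ _
    rintro ⟨b', hb'⟩
    have h1 := (adj_stepBasis b i c).symm
    rw [hb'.1] at h1
    obtain ⟨d, hd⟩ := h1.exists_stepBasis
    have h2 := hb'.stepBasis (c := d) hi
    rw [← hd] at h2
    exact H ⟨_, h2⟩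

open Classical in
lemma cellFn_initialSet_mul (w : Equiv.Perm (Fin (m + 1))) {k : ℕ} (hk : k ≤ m + 1) :
    cellFn F 1 (initialSet m k) * cellFn F w ∅ = cellFn F w (initialSet m k) := by
  ext f f' v
  rw [cellFn_one_mul_val (by omega)]
  by_cases H : ∃ b, Adapted b w f f'
  · obtain ⟨b, hb⟩ := H
    rw [cellFn_val_of_adapted hb (admissible_initialSet _ _), Finset.sum_eq_single v]
    · rw [cellFn_empty_val_of_adapted hb, sub_self, if_pos rfl, hb.1, flagOf_sub]
      have : (initialSet m k : Set (Fin (m + 1))) = {j | j.1 < k} := by ext; simp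
      rw [this]
    · intro u _ hu
      rw [cellFn_empty_val_of_adapted hb, if_neg (fun h => hu (sub_eq_zero.mp h).symm), ite_self]
    · simp
  · rw [cellFn_val_of_not_adapted H]
    exact Finset.sum_eq_zero fun u _ => by rw [cellFn_val_of_not_adapted H, ite_self]

/-- The product sums over the translates of the vector by the line `f_1`: either all of them lie in
the span that belongs to `β`, or exactly one does. -/
lemma cellFn_one_one_mul {w : Equiv.Perm (Fin (m + 1))} {β : Finset (Fin (m + 1))}
    (hβ : Admissible w β) :
    cellFn F 1 (initialSet m 1) * cellFn F w β =
      if 0 ∈ β then (Nat.card F : ℂ) • cellFn F w β else cellFn F w (insert 0 β) := by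
  classical
  have := Fintype.ofFinite F
  ext f f' v
  rw [cellFn_one_mul_val (by omega)]
  by_cases H : ∃ b, Adapted b w f f'
  · obtain ⟨b, hb⟩ := H
    have hinj : Function.Injective fun c : F => c • b 0 := smul_left_injective F (b.ne_zero 0)
    have h1 : ∑ u : Fin (m + 1) → F, (if u ∈ f.sub ⟨1, by omega⟩
        then (cellFn F w β).val f f' (v - u) else 0) =
        ∑ c : F, (cellFn F w β).val f f' (v - c • b 0) := by
      rw [← Finset.sum_filter]
      symm
      refine Finset.sum_bij (fun c _ => c • b 0) ?_ (fun c _ d _ h => hinj h) ?_ fun _ _ => rfl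
      · intro c _
        rw [Finset.mem_filter, hb.1, mem_flagOf_one]
        exact ⟨Finset.mem_univ _, c, rfl⟩
      · intro u hu
        rw [Finset.mem_filter, hb.1, mem_flagOf_one] at hu
        obtain ⟨c, hc⟩ := hu.2
        exact ⟨c, Finset.mem_univ _, hc⟩
    rw [h1]
    simp only [cellFn_val_of_adapted hb hβ]
    split_ifs with h0
    · rw [MirabolicAt.val_smul, cellFn_val_of_adapted hb hβ]
      have h2 : ∀ c : F, v - c • b 0 ∈ Submodule.span F (b '' β) ↔
          v ∈ Submodule.span F (b '' β) := fun c =>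
        Submodule.sub_mem_iff_left _ (Submodule.smul_mem _ _ (Submodule.subset_span ⟨0, h0, rfl⟩))
      simp only [h2, Finset.sum_const, Finset.card_univ, nsmul_eq_mul, Nat.card_eq_fintype_card]
    · rw [cellFn_val_of_adapted hb (admissible_insert_zero hβ)]
      have h2 : ∀ c : F, v - c • b 0 ∈ Submodule.span F (b '' β) ↔
          v ∈ Submodule.span F (b '' (insert 0 β : Finset (Fin (m + 1)))) ∧ c = b.repr v 0 := by
        intro c
        rw [mem_span_image_iff, mem_span_image_iff]
        constructor
        · intro h
          refine ⟨fun k hk => ?_, ?_⟩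
          · rw [Finset.mem_coe, Finset.mem_insert, not_or] at hk
            have := h k hk.2
            simpa [Finsupp.single_apply, Ne.symm hk.1] using this
          · have := h 0 h0
            simp only [map_sub, map_smul, Module.Basis.repr_self, Finsupp.coe_sub, Pi.sub_apply,
              Finsupp.smul_single, Finsupp.single_eq_same, smul_eq_mul, mul_one] at this
            exact (sub_eq_zero.mp this).symm
        · rintro ⟨h, rfl⟩ k hk
          by_cases hk0 : k = 0
          · subst hk0
            simp
          · have := h k (by
              rw [Finset.mem_coe, Finset.mem_insert, not_or]
              exact ⟨hk0, hk⟩)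
            simp [this, hk0]
      simp only [h2, ite_and]
      by_cases h3 : v ∈ Submodule.span F (b '' (insert 0 β : Finset (Fin (m + 1))))
      · simp only [h3, if_true]
        rw [Finset.sum_ite_eq' Finset.univ (b.repr v 0), if_pos (Finset.mem_univ _)]
      · simp only [h3, if_false, Finset.sum_const_zero]
  · rw [Finset.sum_eq_zero fun u _ => by rw [cellFn_val_of_not_adapted H, ite_self]]
    split_ifs
    · rw [MirabolicAt.val_smul, cellFn_val_of_not_adapted H, mul_zero]
    · rw [cellFn_val_of_not_adapted H]

end Products

section RankTwo

variable {F : Type*} [Field F] {m : ℕ}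

open Classical in
lemma cellFn_add_one_val [Finite F] (i : Fin m) (f f' : CompleteFlag F (m + 1))
    (v : Fin (m + 1) → F) :
    (cellFn F (simpleRefl i) ∅ + 1).val f f' v =
      if v = 0 ∧ (f = f' ∨ Adj i f f') then 1 else 0 := by
  rw [MirabolicAt.val_add, cellFn_simpleRefl_val, MirabolicAt.val_one]
  by_cases hf : f = f'
  · subst hf
    have h1 : ¬ Adj i f f := fun h => h.1 rfl
    simp [h1]
  · simp [hf]

open Classical in
lemma cellFn_initialSet_mul_add_one_val [Finite F] (i : Fin m) {k : ℕ} (hk : k < m + 2)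
    (f f' : CompleteFlag F (m + 1)) (v : Fin (m + 1) → F) :
    (cellFn F 1 (initialSet m k) * (cellFn F (simpleRefl i) ∅ + 1)).val f f' v =
      if v ∈ f.sub ⟨k, hk⟩ ∧ (f = f' ∨ Adj i f f') then 1 else 0 := by
  rw [cellFn_one_mul_val hk, Finset.sum_eq_single v]
  · rw [cellFn_add_one_val, sub_self]
    by_cases h1 : v ∈ f.sub ⟨k, hk⟩ <;> simp [h1]
  · intro u _ hu
    have h1 : ¬ (v - u = 0 ∧ (f = f' ∨ Adj i f f')) :=
      fun h => hu (sub_eq_zero.mp h.1).symm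
    rw [cellFn_add_one_val, if_neg h1, ite_self]
  · simp

/-- The lines `⟨b_1 + c b_0⟩` together with `⟨b_0⟩` cover every nonzero vector of the plane
`⟨b_0, b_1⟩` once. -/
lemma sum_lines [Fintype F] [DecidableEq F] (x y : F) :
    (∑ c : F, if x = c * y then (1 : ℂ) else 0) + (if y = 0 then 1 else 0) =
      1 + (Nat.card F : ℂ) * (if x = 0 ∧ y = 0 then 1 else 0) := by
  by_cases hy : y = 0
  · subst hy
    by_cases hx : x = 0
    · simp [hx, Nat.card_eq_fintype_card, add_comm]
    · simp [hx]
  · have h : ∀ c : F, x = c * y ↔ x / y = c := fun c => (div_eq_iff hy).symm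
    simp only [h, Finset.sum_ite_eq]
    simp [hy]

lemma mem_flagOf_stepBasis_one {i : Fin m} (hi : i.1 = 0)
    {b : Module.Basis (Fin (m + 1)) F (Fin (m + 1) → F)} {c : F} {v : Fin (m + 1) → F} :
    v ∈ (flagOf (stepBasis b i c)).sub ⟨1, by omega⟩ ↔
      v ∈ (flagOf b).sub ⟨2, by omega⟩ ∧ b.repr v i.castSucc = c * b.repr v i.succ := by
  have h1 : {k : Fin (m + 1) | k.1 < 1} = {i.castSucc} := by
    ext k
    rw [Set.mem_ofPred_eq, Set.mem_singleton_iff, Fin.ext_iff, Fin.val_castSucc]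
    omega
  rw [flagOf_sub, h1, Set.image_singleton, Submodule.mem_span_singleton, stepBasis_castSucc,
    mem_flagOf]
  constructor
  · rintro ⟨t, rfl⟩
    constructor
    · intro k hk
      change 2 ≤ k.1 at hk
      have h2 : i.castSucc ≠ k := by
        intro h
        have := congrArg Fin.val h
        rw [Fin.val_castSucc] at this
        omega
      have h3 : i.succ ≠ k := by
        intro h
        have := congrArg Fin.val h
        rw [Fin.val_succ] at this
        omega
      simp [h2, h3]
    · simp [Fin.castSucc_lt_succ.ne, mul_comm]
  · rintro ⟨h2, h3⟩
    refine ⟨b.repr v i.succ, b.ext_elem fun k => ?_⟩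
    by_cases hk1 : k = i.castSucc
    · subst hk1
      simp [h3, mul_comm, Fin.castSucc_lt_succ.ne']
    by_cases hk2 : k = i.succ
    · subst hk2
      simp [Fin.castSucc_lt_succ.ne]
    · rw [h2 k]
      · simp [Ne.symm hk1, Ne.symm hk2]
      · rw [Fin.ext_iff, Fin.val_castSucc] at hk1
        rw [Fin.ext_iff, Fin.val_succ] at hk2
        show 2 ≤ k.1
        omega

/-- The only relation beyond those of the cyclotomic Hecke algebra: a sum over the lines of a
plane. -/
lemma cellFn_rank_two [Finite F] {i : Fin m} (hi : i.1 = 0) :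
    (cellFn F (simpleRefl i) ∅ + 1) * cellFn F 1 (initialSet m 1) *
        (cellFn F (simpleRefl i) ∅ + 1) =
      (cellFn F 1 (initialSet m 2) + (Nat.card F : ℂ) • 1) *
        (cellFn F (simpleRefl i) ∅ + 1) := by
  classical
  have := Fintype.ofFinite F
  have him := i.2
  rw [mul_assoc, add_mul, one_mul, add_mul _ ((Nat.card F : ℂ) • 1), smul_mul_assoc, one_mul]
  ext f f' v
  obtain ⟨b, rfl⟩ := exists_flagOf_eq f
  rw [MirabolicAt.val_add, MirabolicAt.val_add, MirabolicAt.val_smul, cellFn_simpleRefl_mul_val,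
    cellFn_initialSet_mul_add_one_val i (by omega), cellFn_initialSet_mul_add_one_val i (by omega),
    cellFn_add_one_val]
  simp only [cellFn_initialSet_mul_add_one_val i (show 1 < m + 2 by omega),
    (adj_stepBasis b i _).eq_or_iff, mem_flagOf_stepBasis_one hi]
  by_cases hf : flagOf b = f' ∨ Adj i (flagOf b) f'
  swap
  · simp [hf]
  simp only [hf, and_true]
  have h0 : i.castSucc = 0 := Fin.ext (by simp [hi])
  by_cases h2 : v ∈ (flagOf b).sub ⟨2, by omega⟩
  · have h3 : v ∈ (flagOf b).sub ⟨1, by omega⟩ ↔ b.repr v i.succ = 0 := by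
      rw [mem_flagOf] at h2 ⊢
      refine ⟨fun h => h _ (by simp), fun h k hk => ?_⟩
      by_cases hk' : k = i.succ
      · rw [hk', h]
      · rw [Fin.ext_iff, Fin.val_succ] at hk'
        exact h2 k (by
          change 1 ≤ k.1 at hk
          show 2 ≤ k.1
          omega)
    have h4 : v = 0 ↔ b.repr v i.castSucc = 0 ∧ b.repr v i.succ = 0 := by
      rw [mem_flagOf] at h2
      refine ⟨by rintro rfl; simp, fun h => b.ext_elem fun k => ?_⟩
      by_cases hk1 : k = i.castSucc
      · rw [hk1, h.1]; simp
      by_cases hk2 : k = i.succ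
      · rw [hk2, h.2]; simp
      rw [Fin.ext_iff, Fin.val_castSucc] at hk1
      rw [Fin.ext_iff, Fin.val_succ] at hk2
      rw [h2 k (by show 2 ≤ k.1; omega)]
      simp
    simp only [h2, h3, h4, true_and, if_true]
    exact sum_lines _ _
  · have h3 : v ∉ (flagOf b).sub ⟨1, by omega⟩ := fun h =>
      h2 ((flagOf b).mono (by simp [Fin.le_def]) h)
    have h4 : v ≠ 0 := by
      rintro rfl
      exact h2 (zero_mem _)
    simp only [h2, h3, h4, false_and, if_false, Finset.sum_const_zero, mul_zero, add_zero]

end RankTwo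

/-! ### From the multiplication rules for cells to the relations and the normal forms -/

section CellSystem

variable {K A : Type*} [Field K] [Ring A] [Algebra K A]

/-- The multiplication rules that the characteristic functions of the cells satisfy. -/
structure CellSystem (q : K) {m : ℕ}
    (cell : Equiv.Perm (Fin (m + 1)) → Finset (Fin (m + 1)) → A) : Prop where
  q_ne : q ≠ 0
  one : cell 1 ∅ = 1
  quad : ∀ i, cell (simpleRefl i) ∅ * cell (simpleRefl i) ∅ =
    (q - 1) • cell (simpleRefl i) ∅ + q • 1
  asc : ∀ (i : Fin m) (w : Equiv.Perm (Fin (m + 1))) (β : Finset (Fin (m + 1))), Admissible w β →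
    w.symm i.castSucc < w.symm i.succ →
    cell (simpleRefl i) ∅ * cell w β = cell (simpleRefl i * w) (moveSet (simpleRefl i) β)
  a_mul : ∀ (w : Equiv.Perm (Fin (m + 1))) (β : Finset (Fin (m + 1))), Admissible w β →
    cell 1 (initialSet m 1) * cell w β = if 0 ∈ β then q • cell w β else cell w (insert 0 β)
  initial_mul : ∀ (w : Equiv.Perm (Fin (m + 1))) (k : ℕ), k ≤ m + 1 →
    cell 1 (initialSet m k) * cell w ∅ = cell w (initialSet m k)
  rank_two : ∀ i : Fin m, i.1 = 0 →
    (cell (simpleRefl i) ∅ + 1) * cell 1 (initialSet m 1) * (cell (simpleRefl i) ∅ + 1) =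
      (cell 1 (initialSet m 2) + q • 1) * (cell (simpleRefl i) ∅ + 1)

/-- The generators `τ i` of a system of cells, with the value `0` for `i ≥ m`. -/
def cellTau {m : ℕ} (cell : Equiv.Perm (Fin (m + 1)) → Finset (Fin (m + 1)) → A) (i : ℕ) : A :=
  if h : i < m then cell (simpleRefl ⟨i, h⟩) ∅ else 0

namespace CellSystem

variable {q : K} {m : ℕ} {cell : Equiv.Perm (Fin (m + 1)) → Finset (Fin (m + 1)) → A}

lemma cellTau_coe (cell : Equiv.Perm (Fin (m + 1)) → Finset (Fin (m + 1)) → A) (i : Fin m) :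
    cellTau cell i = cell (simpleRefl i) ∅ := by
  rw [cellTau, dif_pos i.2]

lemma tau_mul_tau (C : CellSystem q cell) {i j : Fin m} (hij : i ≠ j) :
    cellTau cell i * cellTau cell j = cell (simpleRefl i * simpleRefl j) ∅ := by
  rw [cellTau_coe, cellTau_coe, C.asc _ _ _ (admissible_empty _), moveSet_empty]
  rw [simpleRefl_symm]
  refine simpleRefl_lt_simpleRefl Fin.castSucc_lt_succ fun h => hij ?_
  exact Fin.castSucc_injective _ h.1

lemma a_tau_a (C : CellSystem q cell) (hm : 0 < m) :
    cell 1 (initialSet m 1) * cellTau cell 0 * cell 1 (initialSet m 1) =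
        cell 1 (initialSet m 2) * cellTau cell 0 ∧
      cell 1 (initialSet m 1) * cellTau cell 0 * cell 1 (initialSet m 1) =
        cellTau cell 0 * cell 1 (initialSet m 2) := by
  have hs := moveSet_initialSet (i := ⟨0, hm⟩) (k := 2) (by simp)
  have h1 : initialSet m 1 = insert 0 ∅ := by
    ext x
    rw [mem_initialSet, Finset.mem_insert, Fin.ext_iff, Fin.val_zero]
    simp
  have h2 : simpleRefl ⟨0, hm⟩ 0 = Fin.succ ⟨0, hm⟩ := simpleRefl_castSucc _
  have h3 : initialSet m 2 = insert 0 {Fin.succ ⟨0, hm⟩} := by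
    ext x
    rw [mem_initialSet, Finset.mem_insert, Finset.mem_singleton, Fin.ext_iff, Fin.ext_iff,
      Fin.val_zero, Fin.val_succ]
    simp only
    omega
  have h4 : cell 1 (initialSet m 1) * cellTau cell 0 * cell 1 (initialSet m 1) =
      cell (simpleRefl ⟨0, hm⟩) (initialSet m 2) := by
    have h5 := C.asc ⟨0, hm⟩ 1 (initialSet m 1) (admissible_initialSet _ _) Fin.castSucc_lt_succ
    rw [mul_one, h1, moveSet_insert, moveSet_empty, h2] at h5
    have h6 := (admissible_initialSet (1 : Equiv.Perm (Fin (m + 1))) 1).moveSet_of_lt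
      (i := ⟨0, hm⟩) Fin.castSucc_lt_succ
    rw [mul_one, h1, moveSet_insert, moveSet_empty, h2] at h6
    rw [cellTau, dif_pos hm, mul_assoc]
    nth_rw 2 [h1]
    have h7 : (0 : Fin (m + 1)) ∉ insert (Fin.succ ⟨0, hm⟩) (∅ : Finset (Fin (m + 1))) := by
      rw [Finset.mem_insert, Fin.ext_iff, Fin.val_succ]
      simp
    rw [h5, C.a_mul _ _ h6, if_neg h7, h3]
    rfl
  rw [h4, cellTau, dif_pos hm, C.initial_mul _ _ (by omega),
    C.asc ⟨0, hm⟩ 1 (initialSet m 2) (admissible_initialSet _ _) Fin.castSucc_lt_succ, mul_one, hs]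
  exact ⟨rfl, rfl⟩

/-- The multiplication rules for the cells imply the new relations. -/
theorem mirRel (C : CellSystem q cell) :
    MirRel q m (cell 1 (initialSet m 1)) (cellTau cell) where
  q_ne := C.q_ne
  quad i hi := by
    rw [cellTau, dif_pos hi]
    exact C.quad _
  braid i hi := by
    have h : (⟨i + 1, hi⟩ : Fin m).1 = (⟨i, by omega⟩ : Fin m).1 + 1 := rfl
    generalize hj : (⟨i + 1, hi⟩ : Fin m) = j at h
    generalize hi' : (⟨i, by omega⟩ : Fin m) = i' at h
    have e1 : i + 1 = j.1 := by rw [← hj]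
    have e2 : i = i'.1 := by rw [← hi']
    have f1 := castSucc_eq_succ h
    have f2 := simpleRefl_next_castSucc h
    have f3 := simpleRefl_next_succ h
    have f4 := simpleRefl_prev_succ h
    have hlt : i'.castSucc < i'.succ := Fin.castSucc_lt_succ
    have hlt' : i'.succ < j.succ := f1 ▸ Fin.castSucc_lt_succ
    have hne : i' ≠ j := by rintro rfl; omega
    rw [e1, e2, mul_assoc, mul_assoc, C.tau_mul_tau hne, C.tau_mul_tau hne.symm, cellTau_coe,
      cellTau_coe, C.asc _ _ _ (admissible_empty _), C.asc _ _ _ (admissible_empty _),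
      ← mul_assoc, ← mul_assoc, simpleRefl_braid h, moveSet_empty, moveSet_empty]
    · simp only [mul_symm_apply, simpleRefl_symm, f1, f4, simpleRefl_succ, f2]
      exact hlt
    · simp only [mul_symm_apply, simpleRefl_symm, f2, f3, f4, simpleRefl_castSucc]
      exact hlt'
  comm i j hij hj := by
    have hne : (⟨i, by omega⟩ : Fin m) ≠ ⟨j, hj⟩ := by
      intro h
      have := congrArg Fin.val h
      simp only at this
      omega
    have h1 := C.tau_mul_tau hne
    have h2 := C.tau_mul_tau hne.symm
    rw [simpleRefl_mul_comm (Or.inl hij)] at h1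
    exact h1.trans h2.symm
  idem := by
    rw [C.a_mul _ _ (admissible_initialSet _ _), if_pos (by simp)]
  a_comm i h1 hi := by
    have hs := moveSet_initialSet (i := ⟨i, hi⟩) (k := 1) (by simp only; omega)
    rw [cellTau, dif_pos hi, C.initial_mul _ _ (by omega),
      C.asc ⟨i, hi⟩ 1 (initialSet m 1) (admissible_initialSet _ _) Fin.castSucc_lt_succ, mul_one, hs]
  a_braid hm := by
    obtain ⟨h1, h2⟩ := C.a_tau_a hm
    have h3 : cellTau cell 0 * cell 1 (initialSet m 1) * cellTau cell 0 *
        cell 1 (initialSet m 1) = cellTau cell 0 *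
          (cell 1 (initialSet m 1) * cellTau cell 0 * cell 1 (initialSet m 1)) := by noncomm_ring
    rw [h3, h1, ← mul_assoc, ← h2, h1]
  extra hm := by
    obtain ⟨h1, h2⟩ := C.a_tau_a hm
    have h3 := C.rank_two ⟨0, hm⟩ rfl
    have h4 := C.quad ⟨0, hm⟩
    have h5 : cellTau cell 0 = cell (simpleRefl ⟨0, hm⟩) ∅ := by rw [cellTau, dif_pos hm]
    rw [← h5] at h3 h4
    rw [h3, h1, mul_assoc, h4]
    simp only [mul_add, add_mul, mul_one, one_mul, smul_mul_assoc, mul_smul_comm]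
    module

end CellSystem

end CellSystem

section CellNormalForm

variable {K A : Type*} [Field K] [Ring A] [Algebra K A]

lemma eq_one_of_forall_not_isDescent {m : ℕ} {w : Equiv.Perm (Fin (m + 1))}
    (h : ∀ i, ¬ IsDescent i w) : w = 1 := by
  have h1 : StrictMono w.symm := Fin.strictMono_iff_lt_succ.mpr fun i =>
    lt_of_le_of_ne (not_lt.mp (h i)) fun h' => Fin.castSucc_lt_succ.ne (w.symm.injective h')
  have h2 : h1.orderIsoOfSurjective _ w.symm.surjective = OrderIso.refl _ := Subsingleton.elim _ _
  have h3 : w.symm = 1 := Equiv.ext fun x => congrArg (fun g : _ ≃o _ => g x) h2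
  rw [← Equiv.symm_symm w, h3]
  rfl

lemma isUnit_tauProd {q : K} {m : ℕ} {a : A} {τ : ℕ → A} (H : MirRel q m a τ) (r d : ℕ)
    (h : r + d ≤ m) : IsUnit (tauProd τ r d) := by
  induction d generalizing r with
  | zero => exact isUnit_one
  | succ d ih => exact (H.isUnit_tau (by omega)).mul (ih (r + 1) (by omega))

namespace CellSystem

variable {q : K} {m : ℕ} {cell : Equiv.Perm (Fin (m + 1)) → Finset (Fin (m + 1)) → A}

/-- Multiplication by `τ r * ⋯ * τ (k - 1)` moves position `k` down to `r` in the cells of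
`{0, …, k - 1}` and `{0, …, k}` simultaneously. -/
lemma tauProd_mul_cell (C : CellSystem q cell) {k : ℕ} (hk : k ≤ m) (d r : ℕ) (hr : r + d = k) :
    ∃ g : Equiv.Perm (Fin (m + 1)), (∀ j, j.1 < r → g.symm j = j) ∧
      Admissible g ((initialSet m (k + 1)).erase ⟨r, by omega⟩) ∧
      tauProd (cellTau cell) r d * cell 1 (initialSet m k) =
        cell g ((initialSet m (k + 1)).erase ⟨r, by omega⟩) ∧
      tauProd (cellTau cell) r d * cell 1 (initialSet m (k + 1)) =
        cell g (initialSet m (k + 1)) := by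
  induction d generalizing r with
  | zero =>
    have h1 : (initialSet m (k + 1)).erase ⟨r, by omega⟩ = initialSet m k := by
      ext x
      rw [Finset.mem_erase, mem_initialSet, mem_initialSet, ne_eq, Fin.ext_iff]
      simp only
      omega
    rw [h1]
    exact ⟨1, fun _ _ => rfl, admissible_initialSet _ _, one_mul _, one_mul _⟩
  | succ d ih =>
    obtain ⟨g, h1, h2, h3, h4⟩ := ih (r + 1) (by omega)
    set i : Fin m := ⟨r, by omega⟩ with hi
    have hlt : g.symm i.castSucc < g.symm i.succ := by
      rw [h1 i.castSucc (by rw [Fin.val_castSucc]; simp [hi])]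
      by_contra hc
      have h5 : (g.symm i.succ).1 < r + 1 := by
        have h5 : (g.symm i.succ).1 ≤ r := Fin.le_def.mp (not_lt.mp hc)
        omega
      have h6 := g.symm.injective (h1 _ h5)
      rw [h6, Fin.val_succ] at h5
      simp [hi] at h5
    have h5 : moveSet (simpleRefl i) ((initialSet m (k + 1)).erase ⟨r + 1, by omega⟩) =
        (initialSet m (k + 1)).erase ⟨r, by omega⟩ := by
      rw [show (⟨r + 1, by omega⟩ : Fin (m + 1)) = i.succ from rfl, moveSet_erase,
        moveSet_initialSet (by simp only [hi]; omega), simpleRefl_succ]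
      rfl
    refine ⟨simpleRefl i * g, fun j hj => ?_, ?_, ?_, ?_⟩
    · rw [mul_symm_apply, simpleRefl_symm, simpleRefl_of_ne, h1 _ (by omega)]
      · rintro rfl
        rw [Fin.val_castSucc] at hj
        exact lt_irrefl _ hj
      · rintro rfl
        rw [Fin.val_succ] at hj
        simp only [hi] at hj
        omega
    · rw [← h5]
      exact h2.moveSet_of_lt hlt
    · rw [tauProd, mul_assoc, h3, ← h5, ← C.asc i g _ h2 hlt, ← cellTau_coe cell i]
    · rw [tauProd, mul_assoc, h4, ← moveSet_initialSet (i := i) (k := k + 1)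
        (by simp only [hi]; omega), ← C.asc i g _ (admissible_initialSet _ _) hlt, ← cellTau_coe cell i,
        moveSet_initialSet (by simp only [hi]; omega)]

/-- The element `flagElt k` is the characteristic function of the `(f, f, v)` with `v ∈ f_k`: the
two satisfy the same recursion, in which the unit `tauProd 0 k` can be cancelled. -/
lemma flagElt_eq_cell (C : CellSystem q cell) {k : ℕ} (hk : k ≤ m + 1) :
    flagElt q (cell 1 (initialSet m 1)) (cellTau cell) k = cell 1 (initialSet m k) := by
  have H := C.mirRel
  induction k with
  | zero => rw [flagElt_zero, initialSet_zero, C.one]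
  | succ k ih =>
    obtain ⟨g, -, h2, h3, h4⟩ := C.tauProd_mul_cell (k := k) (by omega) k 0 (by omega)
    have h5 := H.a_mul_tauProd_mul_flagElt (k := k) (by omega)
    have h6 : (0 : Fin (m + 1)) ∉ (initialSet m (k + 1)).erase ⟨0, by omega⟩ := by simp
    have h7 : insert 0 ((initialSet m (k + 1)).erase ⟨0, by omega⟩) = initialSet m (k + 1) :=
      Finset.insert_erase (by simp)
    rw [ih (by omega), mul_assoc, h3, C.a_mul _ _ h2, if_neg h6, h7, ← h4,
      ← (H.tauProd_comm_flagElt (r := 0) (d := k) (k := k + 1) (by omega) hk).eq] at h5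
    exact ((isUnit_tauProd H 0 k (by omega)).mul_left_cancel h5).symm

/-- The cells are the normal forms of the algebra that they span. -/
theorem normalElt_eq_cell (C : CellSystem q cell) {w : Equiv.Perm (Fin (m + 1))}
    {β : Finset (Fin (m + 1))} (hβ : Admissible w β) :
    normalElt q (cell 1 (initialSet m 1)) (cellTau cell) w β = cell w β := by
  have H := C.mirRel
  induction hw : weight w using Nat.strong_induction_on generalizing w β with
  | _ N ih =>
    subst hw
    have peel : ∀ {i : Fin m} {β : Finset (Fin (m + 1))}, Admissible w β → IsGood i w β →
        normalElt q (cell 1 (initialSet m 1)) (cellTau cell) w β = cell w β := by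
      intro i β hβ hi
      have h1 := hβ.moveSet hi.2
      have h2 : (simpleRefl i * w).symm i.castSucc < (simpleRefl i * w).symm i.succ := by
        simpa [IsDescent] using hi.1
      rw [normalElt_peel H hi, ih _ (weight_lt hi.1) h1 rfl, cellTau_coe, C.asc _ _ _ h1 h2,
        simpleRefl_mul_mul, moveSet_simpleRefl_twice]
    by_cases hex : ∃ i, IsGood i w β
    · obtain ⟨i, hi⟩ := hex
      exact peel hβ hi
    · obtain ⟨k, hk, rfl⟩ := exists_eq_initialSet (β := β) fun i h => by
        by_contra h'
        exact hex ⟨i, hβ.isDescent h' h, fun h'' => absurd h'' h'⟩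
      rw [← flagElt_mul_normalElt_empty H w hk, C.flagElt_eq_cell hk, ← C.initial_mul w k hk]
      congr 1
      by_cases hd : ∃ i, IsDescent i w
      · obtain ⟨i, hi⟩ := hd
        exact peel (admissible_empty _) (isGood_empty hi)
      · rw [eq_one_of_forall_not_isDescent (not_exists.mp hd), normalElt_one_empty, C.one]

end CellSystem

end CellNormalForm

/-! ### The cells of the generic algebra -/

section GenericCells

lemma smul_eq_evalCard_smul {F : Type*} [Field F] [Finite F] {n : ℕ} (r : BaseRing)
    (x : MirabolicAt F n) : r • x = MirabolicAt.evalCard F r • x := by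
  rw [Algebra.smul_def, Algebra.smul_def]
  rfl

lemma evalCard_qBase (F : Type*) [Field F] [Finite F] :
    MirabolicAt.evalCard F qBase = (Nat.card F : ℂ) := by
  simp [MirabolicAt.evalCard, qBase]

/-- The family of the cells `cellFn`, one for each prime power, in `R_n`. -/
noncomputable def cellFamily {n : ℕ} (w : Equiv.Perm (Fin n)) (β : Finset (Fin n)) :
    mirabolicHecke n :=
  ⟨fun s => cellFn s.field w β, by
    classical
    have h : (fun s : PrimePower => cellFn s.field w β) =
        ∑ β' : Finset (Fin n) with β' ⊆ β ∧ Admissible w β', orbitFamily w β' := by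
      funext s
      rw [Finset.sum_apply, cellFn]
      refine Finset.sum_congr (Finset.filter_congr_decidable _ _ _).symm fun _ _ => rfl
    rw [h]
    refine sum_mem fun β' hβ' => Algebra.subset_adjoin ?_
    exact ⟨w, β', (Finset.mem_filter.mp hβ').2.2, rfl⟩⟩

lemma mirabolicHecke_ext {n : ℕ} {x y : mirabolicHecke n}
    (h : ∀ s, (x : ∀ s : PrimePower, MirabolicAt s.field n) s =
      (y : ∀ s : PrimePower, MirabolicAt s.field n) s) : x = y :=
  Subtype.ext (funext h)

lemma coe_cellFamily {n : ℕ} (w : Equiv.Perm (Fin n)) (β : Finset (Fin n)) (s : PrimePower) :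
    (cellFamily w β : ∀ s : PrimePower, MirabolicAt s.field n) s = cellFn s.field w β := rfl

/-- The canonical map from `R_n` to the generic algebra. -/
noncomputable def toMir (n : ℕ) : mirabolicHecke n →+* Mir n :=
  ((Mir.toTensor n).symm : _ →+* Mir n).comp
    (Algebra.TensorProduct.includeRight : mirabolicHecke n →ₐ[BaseRing]
      BaseField ⊗[BaseRing] mirabolicHecke n).toRingHom

lemma toMir_apply {n : ℕ} (x : mirabolicHecke n) :
    toMir n x = (Mir.toTensor n).symm (1 ⊗ₜ[BaseRing] x) := rfl

lemma toMir_smul {n : ℕ} (r : BaseRing) (x : mirabolicHecke n) :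
    toMir n (r • x) = algebraMap BaseRing BaseField r • toMir n x := by
  rw [toMir_apply, toMir_apply, ← map_smul, ← TensorProduct.smul_tmul, TensorProduct.smul_tmul',
    Algebra.smul_def, smul_eq_mul]

/-- The cell indexed by `(w, β)` in the generic algebra. -/
noncomputable def cellMir {n : ℕ} (w : Equiv.Perm (Fin n)) (β : Finset (Fin n)) : Mir n :=
  toMir n (cellFamily w β)

lemma q_ne_zero : q ≠ 0 := by
  rw [q, ne_eq, FaithfulSMul.algebraMap_eq_zero_iff]
  exact (LaurentPolynomial.isUnit_T 1).ne_zero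

/-- The multiplication rules hold in each factor of `R_n`, and thus in the generic algebra. -/
theorem cellSystem_cellMir (m : ℕ) :
    CellSystem q (cellMir : Equiv.Perm (Fin (m + 1)) → Finset (Fin (m + 1)) → Mir (m + 1)) where
  q_ne := q_ne_zero
  one := by
    rw [cellMir, ← map_one (toMir (m + 1))]
    exact congrArg _ (mirabolicHecke_ext fun s => cellFn_one_empty (F := s.field) (m := m))
  quad i := by
    have h : cellFamily (simpleRefl i) ∅ * cellFamily (simpleRefl i) ∅ =
        (qBase - 1) • cellFamily (simpleRefl i) ∅ + qBase • 1 := by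
      refine mirabolicHecke_ext fun s => ?_
      have h1 := cellFn_simpleRefl_mul_self (F := s.field) i
      have h2 : ((qBase - 1 : BaseRing) • cellFn s.field (simpleRefl i) ∅ + qBase • 1) =
          cellFn s.field (simpleRefl i) ∅ * cellFn s.field (simpleRefl i) ∅ := by
        rw [h1, smul_eq_evalCard_smul, smul_eq_evalCard_smul, map_sub, evalCard_qBase, map_one]
      exact h2.symm
    rw [cellMir, ← map_mul, h, map_add, toMir_smul, toMir_smul, map_sub, map_one, map_one]
    rfl
  asc i w β hβ h := by
    rw [cellMir, cellMir, ← map_mul]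
    exact congrArg _ (mirabolicHecke_ext fun s => cellFn_simpleRefl_mul_cellFn i hβ h)
  a_mul w β hβ := by
    rw [cellMir, cellMir, ← map_mul]
    have h : cellFamily 1 (initialSet m 1) * cellFamily w β =
        if 0 ∈ β then qBase • cellFamily w β else cellFamily w (insert 0 β) := by
      refine mirabolicHecke_ext fun s => ?_
      have h1 := cellFn_one_one_mul (F := s.field) hβ
      refine h1.trans ?_
      split_ifs
      · rw [← evalCard_qBase, ← smul_eq_evalCard_smul]
        rfl
      · rfl
    rw [h]
    split_ifs
    · rw [toMir_smul]
      rfl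
    · rfl
  initial_mul w k hk := by
    rw [cellMir, cellMir, ← map_mul]
    exact congrArg _ (mirabolicHecke_ext fun s => cellFn_initialSet_mul w hk)
  rank_two i hi := by
    have h : (cellFamily (simpleRefl i) ∅ + 1) * cellFamily 1 (initialSet m 1) *
        (cellFamily (simpleRefl i) ∅ + 1) =
          (cellFamily 1 (initialSet m 2) + qBase • 1) * (cellFamily (simpleRefl i) ∅ + 1) := by
      refine mirabolicHecke_ext fun s => ?_
      refine (cellFn_rank_two (F := s.field) hi).trans ?_
      rw [← evalCard_qBase, ← smul_eq_evalCard_smul]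
      rfl
    have h' := congrArg (toMir (m + 1)) h
    simp only [map_mul, map_add, map_one, toMir_smul] at h'
    exact h'

/-- The family of the characteristic functions of the orbits indexed by `(w, β)`, in `R_n`. -/
noncomputable def orbitElt {n : ℕ} (w : Equiv.Perm (Fin n)) (β : Finset (Fin n))
    (h : Admissible w β) : mirabolicHecke n :=
  ⟨orbitFamily w β, Algebra.subset_adjoin ⟨w, β, h, rfl⟩⟩

lemma stdBasis_eq {n : ℕ} (w : Equiv.Perm (Fin n)) (β : Finset (Fin n)) (h : Admissible w β) :
    stdBasis w β h = toMir n (orbitElt w β h) := rfl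

lemma stdBasis_empty {n : ℕ} (w : Equiv.Perm (Fin n)) (h : Admissible w ∅) :
    stdBasis w ∅ h = cellMir w ∅ := by
  exact congrArg (toMir n) (mirabolicHecke_ext fun s => (cellFn_empty (F := s.field) w).symm)

lemma mT_eq {m : ℕ} (i : Fin m) (h : i.1 + 1 ∈ Set.Ico 1 (m + 1)) :
    (mT ⟨i.1 + 1, h⟩ : Mir (m + 1)) = cellMir (simpleRefl i) ∅ := by
  exact stdBasis_empty (simpleRefl i) (admissible_empty _)

lemma mT₀_add_one (m : ℕ) : mT₀ (m + 1) + 1 = cellMir 1 (initialSet m 1) := by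
  classical
  have h1 : (1 : Mir (m + 1)) = toMir (m + 1) 1 := (map_one _).symm
  have h0 := map_add (toMir (m + 1)) (orbitElt (1 : Equiv.Perm (Fin (m + 1)))
    (initialSet m 1) (admissible_initialSet _ _)) 1
  have h5 : ({k | k.1 = 0} : Finset (Fin (m + 1))) = initialSet m 1 := by
    ext x
    simp
  have h8 : mT₀ (m + 1) = stdBasis 1 (initialSet m 1) (admissible_initialSet _ _) := by
    simp only [mT₀, h5]
  rw [h8, h1, stdBasis_eq, ← h0]
  refine congrArg (toMir (m + 1)) ?_
  refine mirabolicHecke_ext fun s => ?_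
  rw [coe_cellFamily, cellFn]
  have h2 : Finset.univ.filter (fun β' : Finset (Fin (m + 1)) =>
      β' ⊆ initialSet m 1 ∧ Admissible 1 β') = {initialSet m 1, ∅} := by
    have h3 : initialSet m 1 = {0} := by
      ext x
      rw [mem_initialSet, Finset.mem_singleton, Fin.ext_iff, Fin.val_zero]
      omega
    ext β'
    rw [Finset.mem_filter, h3, Finset.subset_singleton_iff, Finset.mem_insert,
      Finset.mem_singleton]
    constructor
    · rintro ⟨-, h | h, -⟩
      · exact Or.inr h
      · exact Or.inl h
    · rintro (rfl | rfl)
      · exact ⟨Finset.mem_univ _, Or.inr rfl, h3 ▸ admissible_initialSet 1 1⟩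
      · exact ⟨Finset.mem_univ _, Or.inl rfl, admissible_empty _⟩
  have h4 : initialSet m 1 ≠ ∅ := Finset.ne_empty_of_mem (a := 0) (by simp)
  have h6 : orbitFunction s.field (m + 1) 1 ∅ = 1 := by
    rw [← cellFn_empty, cellFn_one_empty]
  have h7 := Finset.sum_pair (f := orbitFunction s.field (m + 1) 1) h4
  rw [h6, ← h2] at h7
  refine Eq.trans ?_ (h7.symm.trans ?_)
  · rfl
  · exact Finset.sum_congr (Finset.filter_congr_decidable _ _ _) fun _ _ => rfl

end GenericCells

/-! ### Linear independence of the cells -/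

section Independence

/-- A Laurent polynomial that vanishes at all prime powers is zero. -/
lemma eq_zero_of_evalCard_eq_zero {r : BaseRing}
    (h : ∀ s : PrimePower, MirabolicAt.evalCard s.field r = 0) : r = 0 := by
  obtain ⟨d, p, hp⟩ := LaurentPolynomial.exists_T_pow r
  have h1 : p = 0 := by
    refine Polynomial.eq_zero_of_infinite_isRoot p ?_
    refine Set.infinite_of_injective_forall_mem (f := fun k : ℕ => ((2 ^ (k + 1) : ℕ) : ℂ))
      (fun j k hjk => ?_) fun k => Set.mem_ofPred.mpr ?_
    · have h2 := Nat.pow_right_injective le_rfl (Nat.cast_injective hjk)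
      omega
    · have h2 := h ⟨2, k + 1, Nat.prime_two, k.succ_pos⟩
      have h3 := congrArg
        (MirabolicAt.evalCard (PrimePower.field ⟨2, k + 1, Nat.prime_two, k.succ_pos⟩)) hp
      rw [map_mul, h2, zero_mul, MirabolicAt.evalCard, LaurentPolynomial.eval₂_toLaurent,
        Units.val_mk0, GaloisField.card _ _ (Nat.succ_ne_zero k), Polynomial.eval₂_id] at h3
      exact h3
  rw [h1, map_zero] at hp
  exact (LaurentPolynomial.isUnit_T (d : ℤ)).mul_left_eq_zero.mp hp.symm

/-- The index set of the orbits. -/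
abbrev OrbitIndex (n : ℕ) : Type :=
  {p : Equiv.Perm (Fin n) × Finset (Fin n) // Admissible p.1 p.2}

open Classical in
noncomputable instance (n : ℕ) : Fintype (OrbitIndex n) := Fintype.ofFinite _

/-- Triples in standard form lie in exactly one of the orbits. -/
lemma Adapted.inOrbit_sum_iff {F : Type*} [Field F] {n : ℕ}
    {b : Module.Basis (Fin n) F (Fin n → F)} {w : Equiv.Perm (Fin n)} {f f' : CompleteFlag F n}
    (h : Adapted b w f f') {β : Finset (Fin n)} (hβ : Admissible w β) {w' : Equiv.Perm (Fin n)}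
    {β' : Finset (Fin n)} (hβ' : Admissible w' β') :
    InOrbit w' β' f f' (∑ i ∈ β, b i) ↔ w' = w ∧ β' = β := by
  have h0 : InOrbit w β f f' (∑ i ∈ β, b i) := Mirabolic.inOrbit_iff.mpr ⟨b, h, rfl⟩
  constructor
  · intro h1
    obtain ⟨b', hb', -⟩ := Mirabolic.inOrbit_iff.mp h1
    obtain rfl := h.perm_eq hb'
    exact ⟨rfl, ((h.inOrbit_iff hβ').mp h1).symm.trans ((h.inOrbit_iff hβ).mp h0)⟩
  · rintro ⟨rfl, rfl⟩
    exact h0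

/-- At each prime power the coefficient of an orbit is read off from a triple of that orbit. -/
lemma linearIndependent_orbitElt (n : ℕ) :
    LinearIndependent BaseRing fun p : OrbitIndex n => orbitElt p.1.1 p.1.2 p.2 := by
  classical
  rw [Fintype.linearIndependent_iff]
  intro c hc p
  refine eq_zero_of_evalCard_eq_zero fun s => ?_
  set b := Pi.basisFun s.field (Fin n)
  have hb : Adapted b p.1.1 (flagOf b) (flagOf (b.reindex p.1.1.symm)) := ⟨rfl, rfl⟩
  have h1 := congrArg (fun x : mirabolicHecke n =>
    (x : ∀ s : PrimePower, MirabolicAt s.field n) s) hc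
  simp only [AddSubmonoidClass.coe_finsetSum, Finset.sum_apply] at h1
  have h2 : ∀ p' : OrbitIndex n, ((c p' • orbitElt p'.1.1 p'.1.2 p'.2 : mirabolicHecke n) :
      ∀ s : PrimePower, MirabolicAt s.field n) s =
        MirabolicAt.evalCard s.field (c p') • orbitFunction s.field n p'.1.1 p'.1.2 :=
    fun p' => smul_eq_evalCard_smul _ _
  simp only [h2] at h1
  have h3 := congrArg (fun x : MirabolicAt s.field n =>
    x.val (flagOf b) (flagOf (b.reindex p.1.1.symm)) (∑ i ∈ p.1.2, b i)) h1
  simp only [MirabolicAt.val_sum, MirabolicAt.val_smul, orbitFunction_val] at h3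
  rw [Finset.sum_eq_single p, if_pos ((hb.inOrbit_sum_iff p.2 p.2).mpr ⟨rfl, rfl⟩), mul_one] at h3
  · exact h3
  · intro p' _ hp'
    rw [if_neg, mul_zero]
    intro h4
    obtain ⟨h5, h6⟩ := (hb.inOrbit_sum_iff p.2 p'.2).mp h4
    exact hp' (Subtype.ext (Prod.ext h5 h6))
  · exact fun h => absurd (Finset.mem_univ _) h

lemma linearIndependent_stdBasis (n : ℕ) :
    LinearIndependent BaseField fun p : OrbitIndex n => stdBasis p.1.1 p.1.2 p.2 := by
  have := IsLocalization.flat BaseField (nonZeroDivisors BaseRing)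
  have h := Module.Flat.linearIndependent_one_tmul (S := BaseField) (linearIndependent_orbitElt n)
  exact h.map' ((Mir.toTensor n).symm.toLinearMap) (LinearMap.ker_eq_bot.mpr
    (Mir.toTensor n).symm.injective)

lemma stdBasis_mem_span_cellMir {n : ℕ} (w : Equiv.Perm (Fin n)) (β : Finset (Fin n))
    (h : Admissible w β) :
    stdBasis w β h ∈ Submodule.span BaseField
      (Set.range fun p : OrbitIndex n => (cellMir p.1.1 p.1.2 : Mir n)) := by
  classical
  induction β using Finset.strongInduction with
  | H β ih =>
    have h1 : cellFamily w β = ∑ β' ∈ β.powerset,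
        if h' : Admissible w β' then orbitElt w β' h' else 0 := by
      refine mirabolicHecke_ext fun s => ?_
      rw [coe_cellFamily, cellFn, AddSubmonoidClass.coe_finsetSum, Finset.sum_apply]
      have h2 : ∀ β' : Finset (Fin n), ((if h' : Admissible w β' then orbitElt w β' h' else 0 :
          mirabolicHecke n) : ∀ s : PrimePower, MirabolicAt s.field n) s =
            if Admissible w β' then orbitFunction s.field n w β' else 0 := by
        intro β'
        split_ifs <;> rfl
      simp only [h2]
      rw [← Finset.sum_filter]
      refine Finset.sum_congr ?_ fun _ _ => rfl
      ext β'
      simp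
    have h2 := congrArg (toMir n) h1
    rw [map_sum, ← Finset.insert_erase (Finset.mem_powerset_self β),
      Finset.sum_insert (Finset.notMem_erase _ _), dif_pos h] at h2
    rw [stdBasis_eq, ← sub_eq_of_eq_add h2]
    refine Submodule.sub_mem _ (Submodule.subset_span ⟨⟨(w, β), h⟩, rfl⟩)
      (Submodule.sum_mem _ fun β' hβ' => ?_)
    rw [Finset.mem_erase, Finset.mem_powerset] at hβ'
    split_ifs with h3
    · exact ih β' (hβ'.2.ssubset_of_ne hβ'.1) h3
    · rw [map_zero]
      exact Submodule.zero_mem _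

/-- The cells are related to the basis of the characteristic functions by a unitriangular
matrix. -/
lemma linearIndependent_cellMir (n : ℕ) :
    LinearIndependent BaseField fun p : OrbitIndex n => (cellMir p.1.1 p.1.2 : Mir n) := by
  rw [linearIndependent_iff_card_le_finrank_span,
    ← finrank_span_eq_card (linearIndependent_stdBasis n)]
  have : Module.Finite BaseField (Submodule.span BaseField
      (Set.range fun p : OrbitIndex n => (cellMir p.1.1 p.1.2 : Mir n))) :=
    Module.Finite.span_of_finite _ (Set.finite_range _)
  refine Submodule.finrank_mono (Submodule.span_le.mpr ?_)
  rintro _ ⟨p, rfl⟩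
  exact stdBasis_mem_span_cellMir _ _ _

end Independence

/-! ### Presented algebras -/

section Presented

variable {R : Type*} [CommRing R] {n : ℕ} {A : Type*} [Ring A] [Algebra R A]

/-- The elements `t i` satisfy the relations of the Iwahori-Hecke algebra. -/
structure IsHeckeFamily (q : R) (t : Set.Ico 1 n → A) : Prop where
  quadratic : ∀ i, t i * t i = (q - 1) • t i + q • 1
  braid : ∀ i j, j.1 = i.1 + 1 → t i * t j * t i = t j * t i * t j
  comm : ∀ i j, i.1 + 2 ≤ j.1 → t i * t j = t j * t i

lemma forall_heckeRel_iff {q : R} {x : A} {t : Set.Ico 1 n → A} :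
    (∀ a b, HeckeRel q n a b → FreeAlgebra.lift R (family x t) a =
      FreeAlgebra.lift R (family x t) b) ↔ IsHeckeFamily q t := by
  constructor
  · intro h
    refine ⟨fun i => ?_, fun i j hij => ?_, fun i j hij => ?_⟩
    · simpa [family, sq] using h _ _ (.quadratic i)
    · simpa [family] using h _ _ (.braid i j hij)
    · simpa [family] using h _ _ (.comm i j (Or.inl hij))
  · rintro ⟨h1, h2, h3⟩ _ _ h
    cases h with
    | quadratic i => simpa [family, sq] using h1 i
    | braid i j hij => simpa [family] using h2 i j hij
    | comm i j hij =>
      rcases hij with hij | hij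
      · simpa [family] using h3 i j hij
      · simpa [family] using (h3 j i hij).symm

lemma satisfies_newRel_iff {q : R} {x : A} {t : Set.Ico 1 n → A} :
    Satisfies (NewRel q n) x t ↔ IsHeckeFamily q t ∧ x * x = x ∧
      (∀ i, 2 ≤ i.1 → x * t i = t i * x) ∧
      (∀ i, i.1 = 1 → x * t i * x * t i = t i * x * t i * x) ∧
      (∀ i, i.1 = 1 → x * t i * x * t i =
        t i * x * t i - x * t i * x + t i * x + x * t i + x - t i - 1) := by
  constructor
  · intro h
    refine ⟨forall_heckeRel_iff.mp fun a b hab => h a b (.hecke a b hab), ?_, fun i hi => ?_,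
      fun i hi => ?_, fun i hi => ?_⟩
    · simpa [family, sq] using h _ _ .idem
    · simpa [family] using h _ _ (.e_comm i hi)
    · simpa [family] using h _ _ (.e_braid i hi)
    · simpa [family] using h _ _ (.extra i hi)
  · rintro ⟨h1, h2, h3, h4, h5⟩ _ _ h
    cases h with
    | hecke _ _ h => exact forall_heckeRel_iff.mpr h1 _ _ h
    | idem => simpa [family, sq] using h2
    | e_comm i hi => simpa [family] using h3 i hi
    | e_braid i hi => simpa [family] using h4 i hi
    | extra i hi => simpa [family] using h5 i hi

lemma satisfies_solomonRel_iff {q : R} {x : A} {t : Set.Ico 1 n → A} :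
    Satisfies (SolomonRel q n) x t ↔ IsHeckeFamily q t ∧ x * x = (q - 2) • x + (q - 1) • 1 ∧
      (∀ i, 2 ≤ i.1 → x * t i = t i * x) ∧
      (∀ i, i.1 = 1 → x * t i * x * t i =
        (q - 1) • (t i * x * t i + t i * x) - x * t i * x) ∧
      (∀ i, i.1 = 1 → t i * x * t i * x =
        (q - 1) • (t i * x * t i + x * t i) - x * t i * x) := by
  constructor
  · intro h
    refine ⟨forall_heckeRel_iff.mp fun a b hab => h a b (.hecke a b hab), ?_, fun i hi => ?_,
      fun i hi => ?_, fun i hi => ?_⟩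
    · simpa [family, sq] using h _ _ .zero_quadratic
    · simpa [family] using h _ _ (.zero_comm i hi)
    · simpa only [family, map_mul, map_sub, map_add, map_smul, FreeAlgebra.lift_ι_apply]
        using h _ _ (.zero_one i hi)
    · simpa only [family, map_mul, map_sub, map_add, map_smul, FreeAlgebra.lift_ι_apply]
        using h _ _ (.one_zero i hi)
  · rintro ⟨h1, h2, h3, h4, h5⟩ _ _ h
    cases h with
    | hecke _ _ h => exact forall_heckeRel_iff.mpr h1 _ _ h
    | zero_quadratic => simpa [family, sq] using h2
    | zero_comm i hi => simpa [family] using h3 i hi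
    | zero_one i hi =>
      simpa only [family, map_mul, map_sub, map_add, map_smul, FreeAlgebra.lift_ι_apply]
        using h4 i hi
    | one_zero i hi =>
      simpa only [family, map_mul, map_sub, map_add, map_smul, FreeAlgebra.lift_ι_apply]
        using h5 i hi

lemma satisfies_cyclotomicRel_iff {q : R} {u : Fin 2 → R} (h1 : u 0 = 1) (h0 : u 1 = 0) {x : A}
    {t : Set.Ico 1 n → A} :
    Satisfies (CyclotomicRel q u n) x t ↔ IsHeckeFamily q t ∧ x * x = x ∧
      (∀ i, 2 ≤ i.1 → x * t i = t i * x) ∧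
      (∀ i, i.1 = 1 → x * t i * x * t i = t i * x * t i * x) := by
  have key : FreeAlgebra.lift R (family x t)
      (List.ofFn fun k : Fin 2 => fX R n - algebraMap R (FreeAlgebra R (Gen n)) (u k)).prod =
        x * x - x := by
    simp [List.ofFn_succ, h1, h0, family, sub_mul]
  constructor
  · intro h
    refine ⟨forall_heckeRel_iff.mp fun a b hab => h a b (.hecke a b hab), ?_, fun i hi => ?_,
      fun i hi => ?_⟩
    · have := h _ _ .cyclotomic
      rw [key, map_zero] at this
      exact sub_eq_zero.mp this
    · simpa [family] using h _ _ (.X_comm i hi)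
    · simpa [family] using h _ _ (.X_braid i hi)
  · rintro ⟨h1, h2, h3, h4⟩ _ _ h
    cases h with
    | hecke _ _ h => exact forall_heckeRel_iff.mpr h1 _ _ h
    | cyclotomic => rw [key, map_zero, sub_eq_zero.mpr h2]
    | X_comm i hi => simpa [family] using h3 i hi
    | X_braid i hi => simpa [family] using h4 i hi

variable (r : Relations R n)

lemma lift_family_gen : FreeAlgebra.lift R (family (Presented.gen r .X)
    (fun i => Presented.gen r (.T i))) = RingQuot.mkAlgHom R r := by
  ext g
  cases g <;> simp [family, Presented.gen]

lemma Presented.satisfies_gen : Satisfies r (Presented.gen r .X)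
    (fun i => Presented.gen r (.T i)) := by
  intro a b h
  rw [lift_family_gen]
  exact RingQuot.mkAlgHom_rel R h

lemma Presented.adjoin_gen : Algebra.adjoin R (Set.range (Presented.gen r)) = ⊤ := by
  have h1 : Set.range (Presented.gen r) = RingQuot.mkAlgHom R r '' Set.range (FreeAlgebra.ι R) := by
    rw [← Set.range_comp]
    rfl
  rw [h1, ← AlgHom.map_adjoin, FreeAlgebra.adjoin_range_ι, Algebra.map_top]
  exact (AlgHom.range_eq_top _).mpr (RingQuot.mkAlgHom_surjective R r)

variable {r}

/-- The homomorphism from a presented algebra that is given by elements satisfying the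
relations. -/
def Presented.lift {x : A} {t : Set.Ico 1 n → A} (h : Satisfies r x t) : Presented r →ₐ[R] A :=
  RingQuot.liftAlgHom R ⟨FreeAlgebra.lift R (family x t), fun a b hab => h a b hab⟩

lemma Presented.lift_gen {x : A} {t : Set.Ico 1 n → A} (h : Satisfies r x t) (g : Gen n) :
    Presented.lift h (Presented.gen r g) = family x t g := by
  rw [Presented.lift, Presented.gen, RingQuot.liftAlgHom_mkAlgHom_apply, FreeAlgebra.lift_ι_apply]

lemma Presented.algHom_ext {f g : Presented r →ₐ[R] A}
    (h : ∀ x, f (Presented.gen r x) = g (Presented.gen r x)) : f = g := by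
  refine RingQuot.ringQuot_ext' _ _ _ ?_
  ext x
  exact h x

end Presented

section NewRelations

variable {K A : Type*} [Field K] [Ring A] [Algebra K A] {m : ℕ}

/-- The generators `t 1, …, t m`, numbered from `0`, with the value `0` for `i ≥ m`. -/
def shiftFamily (t : Set.Ico 1 (m + 1) → A) (i : ℕ) : A :=
  if h : i < m then t ⟨i + 1, by simp, by simpa using h⟩ else 0

lemma shiftFamily_of_lt (t : Set.Ico 1 (m + 1) → A) {i : ℕ} (h : i < m) :
    shiftFamily t i = t ⟨i + 1, by simp, by simpa using h⟩ := dif_pos h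

lemma shiftFamily_pred (t : Set.Ico 1 (m + 1) → A) (i : Set.Ico 1 (m + 1)) :
    shiftFamily t (i.1 - 1) = t i := by
  have h1 := i.2.1
  have h2 := i.2.2
  rw [shiftFamily_of_lt t (by omega)]
  congr 1
  exact Subtype.ext (Nat.sub_add_cancel h1)

/-- The new relations for `e` are the relations `MirRel` for `a = q e`. -/
lemma satisfies_newRel_iff_mirRel {q : K} (hq : q ≠ 0) {e : A} {t : Set.Ico 1 (m + 1) → A} :
    Satisfies (NewRel q (m + 1)) e t ↔ MirRel q m (q • e) (shiftFamily t) := by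
  have hq2 : q ^ 2 ≠ 0 := pow_ne_zero 2 hq
  rw [satisfies_newRel_iff]
  constructor
  · rintro ⟨⟨h1, h2, h3⟩, h4, h5, h6, h7⟩
    refine ⟨hq, fun i hi => ?_, fun i hi => ?_, fun i j hij hj => ?_, ?_, fun i h hi => ?_,
      fun hm => ?_, fun hm => ?_⟩
    · rw [shiftFamily_of_lt t hi, h1]
    · rw [shiftFamily_of_lt t hi, shiftFamily_of_lt t (by omega)]
      exact h2 _ _ rfl
    · rw [shiftFamily_of_lt t hj, shiftFamily_of_lt t (by omega)]
      exact h3 _ _ (by simp only; omega)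
    · rw [smul_mul_smul_comm, h4, smul_smul]
    · rw [shiftFamily_of_lt t hi, smul_mul_assoc, mul_smul_comm, h5 _ (by simp only; omega)]
    · rw [shiftFamily_of_lt t hm]
      have h8 := h6 ⟨0 + 1, by simp, by simpa using hm⟩ rfl
      simp only [smul_mul_assoc, mul_smul_comm, h8]
    · rw [shiftFamily_of_lt t hm]
      have h8 := h7 ⟨0 + 1, by simp, by simpa using hm⟩ rfl
      simp only [smul_mul_assoc, mul_smul_comm, h8, mul_add, add_mul, mul_one,
        one_mul]
      module
  · intro H
    have pred_lt : ∀ i : Set.Ico 1 (m + 1), i.1 - 1 < m := fun i => by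
      have h1 := i.2.1
      have h2 := i.2.2
      omega
    refine ⟨⟨fun i => ?_, fun i j hij => ?_, fun i j hij => ?_⟩, ?_, fun i hi => ?_,
      fun i hi => ?_, fun i hi => ?_⟩
    · have := H.quad _ (pred_lt i)
      rwa [shiftFamily_pred] at this
    · have h1 := i.2.1
      have := H.braid (i.1 - 1) (by have := pred_lt j; omega)
      rwa [show i.1 - 1 + 1 = j.1 - 1 by omega, shiftFamily_pred, shiftFamily_pred] at this
    · have h1 := i.2.1
      have := H.comm (i.1 - 1) (j.1 - 1) (by omega) (pred_lt j)
      rwa [shiftFamily_pred, shiftFamily_pred] at this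
    · have := H.idem
      rw [smul_mul_smul_comm, smul_smul] at this
      exact smul_right_injective A (mul_ne_zero hq hq) this
    · have := H.a_comm (i.1 - 1) (by omega) (pred_lt i)
      rw [shiftFamily_pred, smul_mul_assoc, mul_smul_comm] at this
      exact smul_right_injective A hq this
    · have := H.a_braid (by have := pred_lt i; omega)
      rw [show 0 = i.1 - 1 by omega, shiftFamily_pred] at this
      simp only [smul_mul_assoc, mul_smul_comm, smul_smul] at this
      exact smul_right_injective A (mul_ne_zero hq hq) this
    · have := H.extra (by have := pred_lt i; omega)
      rw [show 0 = i.1 - 1 by omega, shiftFamily_pred] at this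
      refine smul_right_injective A hq2 ?_
      simp only
      rw [← sub_eq_zero] at this ⊢
      rw [← this]
      simp only [smul_mul_assoc, mul_smul_comm, mul_add, add_mul, mul_one, one_mul]
      module

end NewRelations

/-! ### The presentation of the mirabolic Hecke algebra -/

section Presentation

section Naturality

variable {K A B : Type*} [Field K] [Ring A] [Algebra K A] [Ring B] [Algebra K B] (f : A →ₐ[K] B)
  (q : K) (a : A) (τ : ℕ → A)

lemma map_conjA (j : ℕ) : f (conjA q a τ j) = conjA q (f a) (f ∘ τ) j := by
  induction j with
  | zero => rfl
  | succ j ih => simp [conjA, ih]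

lemma map_conjProd (r d : ℕ) : f (conjProd q a τ r d) = conjProd q (f a) (f ∘ τ) r d := by
  induction d generalizing r with
  | zero => exact map_one f
  | succ d ih => simp [conjProd, ih, map_conjA]

lemma map_normalElt {m : ℕ} (w : Equiv.Perm (Fin (m + 1))) (β : Finset (Fin (m + 1))) :
    f (normalElt q a τ w β) = normalElt q (f a) (f ∘ τ) w β := by
  induction hw : weight w using Nat.strong_induction_on generalizing w β with
  | _ N ih =>
    subst hw
    rw [normalElt.eq_def, normalElt.eq_def q (f a)]
    split_ifs with h1 h2
    · rw [map_mul, ih _ (weight_lt h1.choose_spec.1) _ _ rfl]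
      rfl
    · rw [map_mul, map_mul, ih _ (weight_lt h2.choose_spec) _ _ rfl, flagElt, map_conjProd]
      rfl
    · exact map_conjProd f q a τ _ _

end Naturality

lemma q_smul_mE (m : ℕ) : q • mE (m + 1) = cellMir 1 (initialSet m 1) := by
  rw [mE, smul_inv_smul₀ q_ne_zero, mT₀_add_one]

lemma shiftFamily_mT (m : ℕ) :
    shiftFamily (fun i => (mT i : Mir (m + 1))) = cellTau cellMir := by
  funext i
  by_cases h : i < m
  · rw [shiftFamily_of_lt _ h, cellTau, dif_pos h]
    exact mT_eq ⟨i, h⟩ _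
  · rw [shiftFamily, cellTau, dif_neg h, dif_neg h]

lemma satisfies_newRel_mir (m : ℕ) :
    Satisfies (NewRel q (m + 1)) (mE (m + 1)) (fun i => mT i) := by
  rw [satisfies_newRel_iff_mirRel q_ne_zero, q_smul_mE, shiftFamily_mT]
  exact (cellSystem_cellMir m).mirRel

/-- The homomorphism from the presented algebra to the mirabolic Hecke algebra. -/
noncomputable def presentedToMir (m : ℕ) :
    Presented (NewRel q (m + 1)) →ₐ[BaseField] Mir (m + 1) :=
  Presented.lift (satisfies_newRel_mir m)

lemma presentedToMir_X (m : ℕ) : presentedToMir m (Presented.gen _ .X) = mE (m + 1) :=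
  Presented.lift_gen _ _

lemma presentedToMir_T (m : ℕ) (i : Set.Ico 1 (m + 1)) :
    presentedToMir m (Presented.gen _ (.T i)) = mT i :=
  Presented.lift_gen _ _

lemma presentedToMir_normalElt {m : ℕ} {w : Equiv.Perm (Fin (m + 1))}
    {β : Finset (Fin (m + 1))} (hβ : Admissible w β) :
    presentedToMir m (normalElt q (q • Presented.gen _ .X)
      (shiftFamily fun i => Presented.gen _ (.T i)) w β) = cellMir w β := by
  have h : presentedToMir m ∘ (shiftFamily fun i => Presented.gen _ (.T i)) =
      shiftFamily fun i => (mT i : Mir (m + 1)) := by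
    funext i
    by_cases hi : i < m
    · rw [Function.comp_apply, shiftFamily_of_lt _ hi, shiftFamily_of_lt _ hi, presentedToMir_T]
    · rw [Function.comp_apply, shiftFamily, shiftFamily, dif_neg hi, dif_neg hi, map_zero]
  rw [map_normalElt, map_smul, presentedToMir_X, h, q_smul_mE, shiftFamily_mT]
  exact (cellSystem_cellMir m).normalElt_eq_cell hβ

/-- The normal forms span the presented algebra, and their images are linearly independent. -/
lemma presentedToMir_injective (m : ℕ) : Function.Injective (presentedToMir m) := by
  have H := (satisfies_newRel_iff_mirRel q_ne_zero).mp
    (Presented.satisfies_gen (NewRel q (m + 1)))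
  have hgen : Algebra.adjoin BaseField (insert (q • Presented.gen (NewRel q (m + 1)) .X)
      (Set.range fun i : Fin m => shiftFamily
        (fun i => Presented.gen (NewRel q (m + 1)) (.T i)) i)) = ⊤ := by
    rw [eq_top_iff, ← Presented.adjoin_gen, Algebra.adjoin_le_iff]
    rintro _ ⟨x, rfl⟩
    cases x with
    | X =>
      have h := Subalgebra.smul_mem _ (Algebra.subset_adjoin (R := BaseField)
        (Set.mem_insert (q • Presented.gen (NewRel q (m + 1)) .X)
          (Set.range fun i : Fin m => shiftFamily
            (fun i => Presented.gen (NewRel q (m + 1)) (.T i)) i))) q⁻¹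
      rwa [inv_smul_smul₀ q_ne_zero] at h
    | T i =>
      have h1 := i.2.1
      have h2 := i.2.2
      exact Algebra.subset_adjoin (Set.mem_insert_of_mem _
        ⟨⟨i.1 - 1, by omega⟩, shiftFamily_pred _ i⟩)
  rw [injective_iff_map_eq_zero]
  intro x hx
  have hspan : x ∈ Submodule.span BaseField (Set.range fun p : OrbitIndex (m + 1) =>
      normalElt q (q • Presented.gen (NewRel q (m + 1)) .X)
        (shiftFamily fun i => Presented.gen (NewRel q (m + 1)) (.T i)) p.1.1 p.1.2) := by
    have h := normalSpan_eq_top H hgen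
    have hx : x ∈ normalSpan q (q • Presented.gen (NewRel q (m + 1)) .X)
        (shiftFamily fun i => Presented.gen (NewRel q (m + 1)) (.T i)) m := h ▸ Submodule.mem_top
    refine Submodule.span_mono ?_ hx
    intro y hy
    obtain ⟨w, β, hβ, rfl⟩ := Set.mem_ofPred.mp hy
    exact ⟨⟨(w, β), hβ⟩, rfl⟩
  obtain ⟨c, rfl⟩ := (Submodule.mem_span_range_iff_exists_fun _).mp hspan
  rw [map_sum] at hx
  have h1 : ∑ p : OrbitIndex (m + 1), c p • (cellMir p.1.1 p.1.2 : Mir (m + 1)) = 0 := by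
    rw [← hx]
    refine Finset.sum_congr rfl fun p _ => ?_
    rw [map_smul, presentedToMir_normalElt p.2]
  have h2 := Fintype.linearIndependent_iff.mp (linearIndependent_cellMir (m + 1)) c h1
  simp [h2]

lemma presentedToMir_surjective (m : ℕ) : Function.Surjective (presentedToMir m) := by
  have hcell : ∀ p : OrbitIndex (m + 1),
      (cellMir p.1.1 p.1.2 : Mir (m + 1)) ∈ (presentedToMir m).range :=
    fun p => ⟨_, presentedToMir_normalElt p.2⟩
  have horb : ∀ w β (h : Admissible w β), stdBasis w β h ∈ (presentedToMir m).range := by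
    intro w β h
    have h1 : Submodule.span BaseField
        (Set.range fun p : OrbitIndex (m + 1) => (cellMir p.1.1 p.1.2 : Mir (m + 1))) ≤
          Subalgebra.toSubmodule (presentedToMir m).range :=
      Submodule.span_le.mpr (by rintro _ ⟨p, rfl⟩; exact hcell p)
    exact h1 (stdBasis_mem_span_cellMir w β h)
  have hR : ∀ x : mirabolicHecke (m + 1), toMir (m + 1) x ∈ (presentedToMir m).range := by
    rintro ⟨x, hx⟩
    induction hx using Algebra.adjoin_induction with
    | mem x hx =>
      obtain ⟨w, β, h, rfl⟩ := Set.mem_ofPred.mp hx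
      exact horb w β h
    | algebraMap r =>
      have h := toMir_smul r (1 : mirabolicHecke (m + 1))
      rw [map_one, Algebra.smul_def, mul_one] at h
      have h2 := Subalgebra.smul_mem _ (one_mem (presentedToMir m).range)
        (algebraMap BaseRing BaseField r)
      rw [← h] at h2
      exact h2
    | add x y hx hy h1 h2 =>
      have h3 := add_mem h1 h2
      rw [← map_add] at h3
      exact h3
    | mul x y hx hy h1 h2 =>
      have h3 := mul_mem h1 h2
      rw [← map_mul] at h3
      exact h3
  intro y
  obtain ⟨z, rfl⟩ := (Mir.toTensor (m + 1)).symm.surjective y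
  change _ ∈ (presentedToMir m).range
  induction z using TensorProduct.induction_on with
  | zero =>
    rw [map_zero]
    exact zero_mem _
  | tmul c x =>
    have h := Subalgebra.smul_mem _ (hR x) c
    rw [toMir_apply, ← map_smul, TensorProduct.smul_tmul', smul_eq_mul, mul_one] at h
    exact h
  | add x y hx hy =>
    rw [map_add]
    exact add_mem hx hy

/-- The new relations are a presentation of the mirabolic Hecke algebra. -/
noncomputable def presentedEquivMir (m : ℕ) :
    Presented (NewRel q (m + 1)) ≃ₐ[BaseField] Mir (m + 1) :=
  AlgEquiv.ofBijective (presentedToMir m) ⟨presentedToMir_injective m, presentedToMir_surjective m⟩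

end Presentation

/-! ### Equivalence with Solomon's relations -/

section Solomon

variable {K A : Type*} [Field K] [Ring A] [Algebra K A] {q : K} {n : ℕ}

lemma solomon_quadratic_sub (e : A) :
    (q • e - 1) * (q • e - 1) - ((q - 2) • (q • e - 1) + (q - 1) • 1) =
      q ^ 2 • (e * e - e) := by
  simp only [mul_sub, sub_mul, smul_mul_assoc, mul_smul_comm, one_mul, mul_one]
  module

lemma solomon_zero_one_sub (e : A) {T : A} (hT : T * T = (q - 1) • T + q • 1) :
    (q • e - 1) * T * (q • e - 1) * T - ((q - 1) • (T * (q • e - 1) * T + T * (q • e - 1)) -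
      (q • e - 1) * T * (q • e - 1)) =
        q ^ 2 • (e * T * e * T - (T * e * T - e * T * e + T * e + e * T + e - T - 1)) := by
  simp only [mul_sub, sub_mul, smul_mul_assoc, mul_smul_comm, one_mul, mul_one, mul_assoc, hT,
    mul_add, smul_sub]
  module

lemma solomon_one_zero_sub (e : A) {T : A} (hT : T * T = (q - 1) • T + q • 1) :
    T * (q • e - 1) * T * (q • e - 1) - ((q - 1) • (T * (q • e - 1) * T + (q • e - 1) * T) -
      (q • e - 1) * T * (q • e - 1)) =
        q ^ 2 • (T * e * T * e - (T * e * T - e * T * e + T * e + e * T + e - T - 1)) := by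
  have hT' : T * (T * e) = (q - 1) • (T * e) + q • e := by
    rw [← mul_assoc, hT, add_mul, smul_mul_assoc, smul_mul_assoc, one_mul]
  simp only [mul_sub, sub_mul, smul_mul_assoc, mul_smul_comm, one_mul, mul_one, mul_assoc]
  rw [hT, hT']
  module

/-- Under `e = q⁻¹ (T₀ + 1)`, the new relations and Solomon's relations are equivalent. -/
theorem satisfies_newRel_iff_solomonRel (hq : q ≠ 0) {t₀ : A} {t : Set.Ico 1 n → A} :
    Satisfies (NewRel q n) (q⁻¹ • (t₀ + 1)) t ↔ Satisfies (SolomonRel q n) t₀ t := by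
  rw [satisfies_newRel_iff, satisfies_solomonRel_iff]
  generalize he : q⁻¹ • (t₀ + 1) = e
  obtain rfl : t₀ = q • e - 1 := by rw [← he, smul_inv_smul₀ hq, add_sub_cancel_right]
  have hq2 : q ^ 2 ≠ 0 := pow_ne_zero 2 hq
  refine and_congr_right fun hH => and_congr ?_ (and_congr ?_ ?_)
  · rw [← sub_eq_zero, ← sub_eq_zero (a := (q • e - 1) * _), solomon_quadratic_sub,
      smul_eq_zero_iff_right hq2]
  · refine forall₂_congr fun i _ => ?_
    rw [sub_mul, mul_sub, smul_mul_assoc, mul_smul_comm, one_mul, mul_one, sub_left_inj]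
    exact (smul_right_injective A hq).eq_iff.symm
  · have h1 : ∀ i, ((q • e - 1) * t i * (q • e - 1) * t i = (q - 1) • (t i * (q • e - 1) * t i +
        t i * (q • e - 1)) - (q • e - 1) * t i * (q • e - 1)) ↔ e * t i * e * t i =
          t i * e * t i - e * t i * e + t i * e + e * t i + e - t i - 1 := by
      intro i
      rw [← sub_eq_zero, solomon_zero_one_sub e (hH.quadratic i), smul_eq_zero_iff_right hq2,
        sub_eq_zero]
    have h2 : ∀ i, (t i * (q • e - 1) * t i * (q • e - 1) = (q - 1) • (t i * (q • e - 1) * t i +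
        (q • e - 1) * t i) - (q • e - 1) * t i * (q • e - 1)) ↔ t i * e * t i * e =
          t i * e * t i - e * t i * e + t i * e + e * t i + e - t i - 1 := by
      intro i
      rw [← sub_eq_zero, solomon_one_zero_sub e (hH.quadratic i), smul_eq_zero_iff_right hq2,
        sub_eq_zero]
    simp only [h1, h2]
    constructor
    · rintro ⟨h3, h4⟩
      exact ⟨h4, fun i hi => (h3 i hi).symm.trans (h4 i hi)⟩
    · rintro ⟨h4, h5⟩
      exact ⟨fun i hi => (h4 i hi).trans (h5 i hi).symm, h4⟩

end Solomon

/-! ### The central idempotent -/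

section Idempotent

variable {K A : Type*} [Field K] [Ring A] [Algebra K A]

/-- The element `1 - X + T - XT - TX + XTX - TXT + XTXT`. -/
def unnormalizedIdempotent (X T : A) : A :=
  1 - X + T - X * T - T * X + X * T * X - T * X * T + X * T * X * T

lemma unnormalizedIdempotent_eq_zero_iff {X T : A} : unnormalizedIdempotent X T = 0 ↔
    X * T * X * T = T * X * T - X * T * X + T * X + X * T + X - T - 1 := by
  rw [← sub_eq_zero (a := X * T * X * T), unnormalizedIdempotent]
  apply Eq.congr_left
  abel

lemma map_unnormalizedIdempotent {B : Type*} [Ring B] [Algebra K B] (f : A →ₐ[K] B) (X T : A) :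
    f (unnormalizedIdempotent X T) = unnormalizedIdempotent (f X) (f T) := by
  simp [unnormalizedIdempotent]

variable {q : K} {X T : A}

lemma X_mul_unnormalizedIdempotent (hX : X * X = X) : X * unnormalizedIdempotent X T = 0 := by
  have h : ∀ y, X * (X * y) = X * y := fun y => by rw [← mul_assoc, hX]
  simp only [unnormalizedIdempotent, mul_add, mul_sub, mul_one, mul_assoc, hX, h]
  abel

lemma unnormalizedIdempotent_mul_X (hX : X * X = X)
    (hXT : X * T * X * T = T * X * T * X) : unnormalizedIdempotent X T * X = 0 := by
  have h1 : X * T * X * T * X = X * T * X * T := by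
    rw [hXT, mul_assoc (T * X * T), hX]
  rw [unnormalizedIdempotent]
  simp only [add_mul, sub_mul, one_mul]
  rw [h1, hXT]
  simp only [mul_assoc, hX]
  abel

lemma unnormalizedIdempotent_mul_T (hT : T * T = (q - 1) • T + q • 1) :
    unnormalizedIdempotent X T * T = q • unnormalizedIdempotent X T := by
  simp only [unnormalizedIdempotent, add_mul, sub_mul, one_mul, mul_assoc, hT, mul_add,
    mul_smul_comm, mul_one]
  module

lemma T_mul_unnormalizedIdempotent (hT : T * T = (q - 1) • T + q • 1)
    (hXT : X * T * X * T = T * X * T * X) :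
    T * unnormalizedIdempotent X T = q • unnormalizedIdempotent X T := by
  have h : ∀ y, T * (T * y) = (q - 1) • (T * y) + q • y := fun y => by
    rw [← mul_assoc, hT, add_mul, smul_mul_assoc, smul_mul_assoc, one_mul]
  rw [unnormalizedIdempotent, hXT]
  simp only [mul_add, mul_sub, mul_one, mul_assoc, h]
  rw [hT]
  simp only [mul_assoc] at hXT
  rw [← hXT]
  module

lemma unnormalizedIdempotent_mul_self (hT : T * T = (q - 1) • T + q • 1) (hX : X * X = X)
    (hXT : X * T * X * T = T * X * T * X) :
    unnormalizedIdempotent X T * unnormalizedIdempotent X T =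
      (q + 1) • unnormalizedIdempotent X T := by
  have h1 := X_mul_unnormalizedIdempotent (T := T) hX
  have h2 := T_mul_unnormalizedIdempotent hT hXT
  nth_rw 1 [unnormalizedIdempotent]
  simp only [add_mul, sub_mul, one_mul, mul_assoc, h1, h2, mul_smul_comm, mul_zero, smul_zero]
  module

end Idempotent

section Cyclotomic

variable {n : ℕ}

/-- The canonical map from `H_n(1, 0)` to the generic algebra. -/
noncomputable def toCyc (n : ℕ) : CyclotomicHecke oneZero n →+* Cyc n :=
  ((GenericCyclotomicHecke.toTensor oneZero n).symm : _ →+* Cyc n).comp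
    (Algebra.TensorProduct.includeRight : CyclotomicHecke oneZero n →ₐ[BaseRing]
      BaseField ⊗[BaseRing] CyclotomicHecke oneZero n).toRingHom

lemma toCyc_apply (x : CyclotomicHecke oneZero n) :
    toCyc n x = (GenericCyclotomicHecke.toTensor oneZero n).symm (1 ⊗ₜ[BaseRing] x) := rfl

lemma toCyc_smul (r : BaseRing) (x : CyclotomicHecke oneZero n) :
    toCyc n (r • x) = algebraMap BaseRing BaseField r • toCyc n x := by
  rw [toCyc_apply, toCyc_apply, ← map_smul, ← TensorProduct.smul_tmul, TensorProduct.smul_tmul',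
    Algebra.smul_def, smul_eq_mul]

lemma constants_zero : constants oneZero 0 = 1 := by simp [constants, oneZero]

lemma constants_one : constants oneZero 1 = 0 := by simp [constants, oneZero]

/-- The defining relations of `ℋ_n(1, 0)`. -/
lemma cyc_relations (n : ℕ) : IsHeckeFamily q (fun i : Set.Ico 1 n => cT i) ∧
    cX n * cX n = cX n ∧ (∀ i : Set.Ico 1 n, 2 ≤ i.1 → cX n * cT i = cT i * cX n) ∧
    (∀ i : Set.Ico 1 n, i.1 = 1 → cX n * cT i * cX n * cT i = cT i * cX n * cT i * cX n) := by
  obtain ⟨⟨h1, h2, h3⟩, h4, h5, h6⟩ :=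
    (satisfies_cyclotomicRel_iff constants_zero constants_one).mp
      (Presented.satisfies_gen (CyclotomicRel qBase (constants oneZero) n))
  have key : ∀ {x y}, x = y → toCyc n x = toCyc n y := fun h => congrArg _ h
  refine ⟨⟨fun i => ?_, fun i j hij => ?_, fun i j hij => ?_⟩, ?_, fun i hi => ?_, fun i hi => ?_⟩
  · have h := key (h1 i)
    rw [map_mul, map_add, toCyc_smul, toCyc_smul, map_sub, map_one, map_one] at h
    exact h
  · have h := key (h2 i j hij)
    simp only [map_mul] at h
    exact h
  · have h := key (h3 i j hij)
    simp only [map_mul] at h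
    exact h
  · have h := key h4
    simp only [map_mul] at h
    exact h
  · have h := key (h5 i hi)
    simp only [map_mul] at h
    exact h
  · have h := key (h6 i hi)
    simp only [map_mul] at h
    exact h

lemma adjoin_cycGen (n : ℕ) : Algebra.adjoin BaseField
    (Set.range (cycGen oneZero : Gen n → Cyc n)) = ⊤ := by
  rw [eq_top_iff]
  rintro y -
  have h1 : ∀ x : CyclotomicHecke oneZero n, toCyc n x ∈
      Algebra.adjoin BaseField (Set.range (cycGen oneZero : Gen n → Cyc n)) := by
    intro x
    have hx : x ∈ Algebra.adjoin BaseRing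
        (Set.range (Presented.gen (CyclotomicRel qBase (constants oneZero) n))) := by
      rw [Presented.adjoin_gen]
      exact Algebra.mem_top
    induction hx using Algebra.adjoin_induction with
    | mem x hx =>
      obtain ⟨g, rfl⟩ := hx
      exact Algebra.subset_adjoin ⟨g, rfl⟩
    | algebraMap r =>
      rw [Algebra.algebraMap_eq_smul_one, toCyc_smul, map_one]
      exact Subalgebra.smul_mem _ (one_mem _) _
    | add x y _ _ h1 h2 =>
      rw [map_add]
      exact add_mem h1 h2
    | mul x y _ _ h1 h2 =>
      rw [map_mul]
      exact mul_mem h1 h2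
  obtain ⟨z, rfl⟩ := (GenericCyclotomicHecke.toTensor oneZero n).symm.surjective y
  induction z using TensorProduct.induction_on with
  | zero =>
    rw [map_zero]
    exact zero_mem _
  | tmul c x =>
    have h := Subalgebra.smul_mem _ (h1 x) c
    rw [toCyc_apply, ← map_smul, TensorProduct.smul_tmul', smul_eq_mul, mul_one] at h
    exact h
  | add x y hx hy =>
    rw [map_add]
    exact add_mem hx hy

/-- Elements satisfying the relations of `H_n(1, 0)` define a homomorphism from the generic
algebra. -/
lemma exists_cyc_algHom {B : Type*} [Ring B] [Algebra BaseField B] {x : B}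
    {t : Set.Ico 1 n → B} (h1 : IsHeckeFamily q t) (h2 : x * x = x)
    (h3 : ∀ i, 2 ≤ i.1 → x * t i = t i * x)
    (h4 : ∀ i, i.1 = 1 → x * t i * x * t i = t i * x * t i * x) :
    ∃ f : Cyc n →ₐ[BaseField] B, f (cX n) = x ∧ ∀ i, f (cT i) = t i := by
  let _ : Algebra BaseRing B := Algebra.compHom B (algebraMap BaseRing BaseField)
  have : IsScalarTower BaseRing BaseField B := IsScalarTower.of_algebraMap_eq fun _ => rfl
  have hH : IsHeckeFamily qBase t := by
    refine ⟨fun i => ?_, h1.braid, h1.comm⟩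
    have h5 := h1.quadratic i
    have h6 : q - 1 = algebraMap BaseRing BaseField (qBase - 1) := by rw [map_sub, map_one]; rfl
    rw [h6, q, algebraMap_smul, algebraMap_smul] at h5
    exact h5
  have hs : Satisfies (CyclotomicRel qBase (constants oneZero) n) x t :=
    (satisfies_cyclotomicRel_iff constants_zero constants_one).mpr ⟨hH, h2, h3, h4⟩
  let g : BaseField ⊗[BaseRing] CyclotomicHecke oneZero n →ₐ[BaseField] B :=
    Algebra.TensorProduct.lift (Algebra.ofId BaseField B) (Presented.lift hs)
      fun c y => Algebra.commutes c _
  have hg : ∀ y, g (1 ⊗ₜ[BaseRing] y) = Presented.lift hs y := fun y =>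
    (Algebra.TensorProduct.lift_tmul _ _ _ _ _).trans (by rw [map_one, one_mul])
  exact ⟨g.comp (GenericCyclotomicHecke.toTensor oneZero n).toAlgHom,
    (hg _).trans (Presented.lift_gen hs .X), fun i => (hg _).trans (Presented.lift_gen hs (.T i))⟩

lemma q_add_one_ne_zero : q + 1 ≠ 0 := by
  have h : q + 1 = algebraMap BaseRing BaseField (qBase + 1) := by rw [map_add, map_one]; rfl
  rw [h, ne_eq, FaithfulSMul.algebraMap_eq_zero_iff]
  intro h0
  have h1 := congrArg (MirabolicAt.evalCard (ZMod 2)) h0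
  rw [map_add, map_one, map_zero, evalCard_qBase, Nat.card_zmod] at h1
  norm_num at h1

lemma yEmptyTwo_eq : yEmptyTwo = (q + 1)⁻¹ • unnormalizedIdempotent (cX 2) cT₁ := rfl

lemma cX_mul_yEmptyTwo : cX 2 * yEmptyTwo = 0 := by
  rw [yEmptyTwo_eq, mul_smul_comm, X_mul_unnormalizedIdempotent (cyc_relations 2).2.1, smul_zero]

lemma cT₁_mul_yEmptyTwo : cT₁ * yEmptyTwo = q • yEmptyTwo := by
  obtain ⟨h1, h2, -, h3⟩ := cyc_relations 2
  rw [yEmptyTwo_eq, mul_smul_comm, T_mul_unnormalizedIdempotent (h1.quadratic _) (h3 _ rfl),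
    smul_comm]

lemma isIdempotentElem_yEmptyTwo : IsIdempotentElem yEmptyTwo := by
  obtain ⟨h1, h2, -, h3⟩ := cyc_relations 2
  rw [IsIdempotentElem, yEmptyTwo_eq, smul_mul_smul_comm,
    unnormalizedIdempotent_mul_self (h1.quadratic _) h2 (h3 _ rfl), smul_smul, mul_assoc,
    inv_mul_cancel₀ q_add_one_ne_zero, mul_one]

lemma yEmptyTwo_mem_center : yEmptyTwo ∈ Subalgebra.center BaseField (Cyc 2) := by
  obtain ⟨h1, h2, -, h3⟩ := cyc_relations 2
  have h : Algebra.adjoin BaseField (Set.range (cycGen oneZero : Gen 2 → Cyc 2)) ≤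
      Subalgebra.centralizer BaseField {yEmptyTwo} := by
    rw [Algebra.adjoin_le_iff]
    rintro _ ⟨g, rfl⟩
    rw [SetLike.mem_coe, Subalgebra.mem_centralizer_iff]
    rintro _ rfl
    cases g with
    | X =>
      refine Eq.trans ?_ cX_mul_yEmptyTwo.symm
      change yEmptyTwo * cX 2 = 0
      rw [yEmptyTwo_eq, smul_mul_assoc, unnormalizedIdempotent_mul_X h2 (h3 _ rfl), smul_zero]
    | T i =>
      have hi1 := i.2.1
      have hi2 := i.2.2
      have hi : i.1 = 1 := by omega
      obtain rfl : i = ⟨1, le_rfl, one_lt_two⟩ := Subtype.ext hi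
      refine Eq.trans ?_ cT₁_mul_yEmptyTwo.symm
      change yEmptyTwo * cT₁ = _
      rw [yEmptyTwo_eq, smul_mul_assoc, unnormalizedIdempotent_mul_T (h1.quadratic _), smul_comm]
  rw [adjoin_cycGen] at h
  rw [Subalgebra.mem_center_iff]
  intro b
  exact ((Subalgebra.mem_centralizer_iff _).mp (h Algebra.mem_top) _ rfl).symm

lemma yEmptyTwo_ne_zero : yEmptyTwo ≠ 0 := by
  obtain ⟨f, h1, h2⟩ := exists_cyc_algHom (n := 2) (B := BaseField) (x := 0) (t := fun _ => q)
    ⟨fun i => by simp only [smul_eq_mul]; ring, fun i j hij => rfl, fun i j hij => rfl⟩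
    (zero_mul 0) (fun i hi => by simp) (fun i hi => by simp)
  intro h
  have h3 := congrArg f h
  rw [map_zero, yEmptyTwo_eq, map_smul, map_unnormalizedIdempotent, h1, h2,
    smul_eq_zero_iff_right (inv_ne_zero q_add_one_ne_zero), unnormalizedIdempotent] at h3
  refine q_add_one_ne_zero ?_
  rw [← h3]
  ring

end Cyclotomic

/-! ### The mirabolic Hecke algebra as a quotient of the cyclotomic Hecke algebra -/

section Quotient

variable {n : ℕ}

lemma genericCycMap_cycGen (hn : 2 ≤ n) (g : Gen 2) :
    genericCycMap oneZero hn (cycGen oneZero g) = cycGen oneZero (g.castLE hn) := by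
  have h : cycMap oneZero hn (Presented.gen _ g) =
      Presented.gen (CyclotomicRel qBase (constants oneZero) n) (g.castLE hn) := by
    rw [cycMap, Presented.gen, RingQuot.liftAlgHom_mkAlgHom_apply, FreeAlgebra.lift_ι_apply]
  have h2 := congrArg (toCyc n) h
  exact h2

lemma genericCycMap_yEmptyTwo (hn : 2 ≤ n) : genericCycMap oneZero hn yEmptyTwo =
    (q + 1)⁻¹ • unnormalizedIdempotent (cX n) (cT ⟨1, le_rfl, hn⟩) := by
  rw [yEmptyTwo_eq, map_smul, map_unnormalizedIdempotent]
  congr 2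
  · exact genericCycMap_cycGen hn .X
  · exact genericCycMap_cycGen hn (.T ⟨1, le_rfl, one_lt_two⟩)

lemma eq_of_val_eq_one (hn : 2 ≤ n) {i : Set.Ico 1 n} (hi : i.1 = 1) :
    i = ⟨1, le_rfl, hn⟩ := Subtype.ext hi

/-- The new relations are those of `ℋ_n(1, 0)` together with the relation `extra`, which says that
the image of `y_{(∅, 2)}` is zero. -/
theorem exists_quotientEquivPresented (hn : 2 ≤ n) :
    ∃ ψ : (idealEmptyTwo n hn).ringCon.Quotient ≃ₐ[BaseField] Presented (NewRel q n),
      ψ ((idealEmptyTwo n hn).ringCon.mk' (cX n)) = Presented.gen _ .X ∧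
      ∀ i, ψ ((idealEmptyTwo n hn).ringCon.mk' (cT i)) = Presented.gen _ (.T i) := by
  obtain ⟨h1, h2, h3, h4, h5⟩ :=
    satisfies_newRel_iff.mp (Presented.satisfies_gen (NewRel q n))
  obtain ⟨f, hfX, hfT⟩ := exists_cyc_algHom h1 h2 h3 h4
  have hy : genericCycMap oneZero hn yEmptyTwo ∈ TwoSidedIdeal.ker f := by
    rw [TwoSidedIdeal.mem_ker, genericCycMap_yEmptyTwo, map_smul, map_unnormalizedIdempotent, hfX,
      hfT, unnormalizedIdempotent_eq_zero_iff.mpr (h5 _ rfl), smul_zero]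
  have hker : (idealEmptyTwo n hn).ringCon ≤ RingCon.ker f.toRingHom := by
    have h6 : idealEmptyTwo n hn ≤ TwoSidedIdeal.ker f :=
      TwoSidedIdeal.span_le.mpr (Set.singleton_subset_iff.mpr hy)
    intro x y hxy
    have h7 := (TwoSidedIdeal.mem_ker f).mp (h6 ((TwoSidedIdeal.rel_iff _ x y).mp hxy))
    rw [map_sub] at h7
    exact sub_eq_zero.mp h7
  let F := (idealEmptyTwo n hn).ringCon.liftₐ f hker
  let π := (idealEmptyTwo n hn).ringCon.mkₐ BaseField
  have hF : ∀ x, F (π x) = f x := fun x => RingCon.liftₐ_mk _ f hker x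
  have hπ : Satisfies (NewRel q n) (π (cX n)) (fun i => π (cT i)) := by
    obtain ⟨⟨c1, c2, c3⟩, c4, c5, c6⟩ := cyc_relations n
    rw [satisfies_newRel_iff]
    have hy0 : unnormalizedIdempotent (π (cX n)) (π (cT ⟨1, le_rfl, hn⟩)) = 0 := by
      have h6 : π (genericCycMap oneZero hn yEmptyTwo) = 0 := by
        have h7 : genericCycMap oneZero hn yEmptyTwo ∈ idealEmptyTwo n hn :=
          TwoSidedIdeal.subset_span rfl
        exact (RingCon.eq _).mpr h7
      rw [genericCycMap_yEmptyTwo, map_smul, map_unnormalizedIdempotent,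
        smul_eq_zero_iff_right (inv_ne_zero q_add_one_ne_zero)] at h6
      exact h6
    refine ⟨⟨fun i => ?_, fun i j hij => ?_, fun i j hij => ?_⟩, ?_, fun i hi => ?_,
      fun i hi => ?_, fun i hi => ?_⟩
    · rw [← map_mul, c1, map_add, map_smul, map_smul, map_one]
    · simp only [← map_mul, c2 i j hij]
    · simp only [← map_mul, c3 i j hij]
    · rw [← map_mul, c4]
    · simp only [← map_mul, c5 i hi]
    · simp only [← map_mul, c6 i hi]
    · obtain rfl := eq_of_val_eq_one hn hi
      exact unnormalizedIdempotent_eq_zero_iff.mp hy0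
  have hFG : F.comp (Presented.lift hπ) = AlgHom.id _ _ := by
    refine Presented.algHom_ext fun x => ?_
    rw [AlgHom.comp_apply, Presented.lift_gen]
    cases x with
    | X => exact (hF _).trans hfX
    | T i => exact (hF _).trans (hfT i)
  have hGF : (Presented.lift hπ).comp F = AlgHom.id _ _ := by
    have h6 : ((Presented.lift hπ).comp F).comp π = π := by
      refine AlgHom.ext_of_adjoin_eq_top (adjoin_cycGen n) ?_
      rintro _ ⟨g, rfl⟩
      rw [AlgHom.comp_apply, AlgHom.comp_apply, hF]
      cases g with
      | X =>
        change Presented.lift hπ (f (cX n)) = _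
        rw [hfX, Presented.lift_gen]
        rfl
      | T i =>
        change Presented.lift hπ (f (cT i)) = _
        rw [hfT, Presented.lift_gen]
        rfl
    refine AlgHom.ext fun x => ?_
    obtain ⟨x, rfl⟩ := RingCon.mkₐ_surjective (α := BaseField) (idealEmptyTwo n hn).ringCon x
    exact DFunLike.congr_fun h6 x
  exact ⟨AlgEquiv.ofAlgHom F (Presented.lift hπ) hFG hGF, (hF _).trans hfX,
    fun i => (hF _).trans (hfT i)⟩

end Quotient

end Mirabolic

theorem mainTheorem1 :
    -- the elements `e, T_1, …, T_{n-1}` and the new relations are a presentation of `ℛ_n`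
    (∀ n : ℕ, 1 ≤ n →
      ∃ φ : Mirabolic.Presented (Mirabolic.NewRel Mirabolic.q n) ≃ₐ[Mirabolic.BaseField]
          Mirabolic.Mir n,
        φ (Mirabolic.Presented.gen _ .X) = Mirabolic.mE n ∧
        ∀ i, φ (Mirabolic.Presented.gen _ (.T i)) = Mirabolic.mT i) ∧
    -- the new relations for `e = 𝐪⁻¹ (T_0 + 1)` are equivalent to Solomon's relations for `T_0`
    (∀ (n : ℕ) (A : Type*) [Ring A] [Algebra Mirabolic.BaseField A]
        (t₀ : A) (t : Set.Ico 1 n → A),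
      Mirabolic.Satisfies (Mirabolic.NewRel Mirabolic.q n) (Mirabolic.q⁻¹ • (t₀ + 1)) t ↔
        Mirabolic.Satisfies (Mirabolic.SolomonRel Mirabolic.q n) t₀ t) ∧
    -- `y_{(∅,2)}` is the central idempotent of `ℋ_2(1,0)` that corresponds to the
    -- one-dimensional representation `X ↦ 0`, `T_1 ↦ 𝐪`
    (Mirabolic.yEmptyTwo ∈ Subalgebra.center Mirabolic.BaseField (Mirabolic.Cyc 2) ∧
      IsIdempotentElem Mirabolic.yEmptyTwo ∧ Mirabolic.yEmptyTwo ≠ 0 ∧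
      Mirabolic.cX 2 * Mirabolic.yEmptyTwo = 0 ∧
      Mirabolic.cT₁ * Mirabolic.yEmptyTwo = Mirabolic.q • Mirabolic.yEmptyTwo) ∧
    -- `ℛ_n` is the quotient of `ℋ_n(1,0)` by the two-sided ideal generated by `y_{(∅,2)}`
    (∀ (n : ℕ) (hn : 2 ≤ n),
      ∃ ψ : (Mirabolic.idealEmptyTwo n hn).ringCon.Quotient ≃ₐ[Mirabolic.BaseField]
          Mirabolic.Mir n,
        ψ ((Mirabolic.idealEmptyTwo n hn).ringCon.mk' (Mirabolic.cX n)) = Mirabolic.mE n ∧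
        ∀ i, ψ ((Mirabolic.idealEmptyTwo n hn).ringCon.mk' (Mirabolic.cT i)) =
          Mirabolic.mT i) := by
  have part1 : ∀ n : ℕ, 1 ≤ n →
      ∃ φ : Mirabolic.Presented (Mirabolic.NewRel Mirabolic.q n) ≃ₐ[Mirabolic.BaseField]
          Mirabolic.Mir n,
        φ (Mirabolic.Presented.gen _ .X) = Mirabolic.mE n ∧
        ∀ i, φ (Mirabolic.Presented.gen _ (.T i)) = Mirabolic.mT i := by
    rintro (_ | m) hn
    · exact absurd hn (by norm_num)
    · exact ⟨Mirabolic.presentedEquivMir m, Mirabolic.presentedToMir_X m,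
        Mirabolic.presentedToMir_T m⟩
  refine ⟨part1, ?_, ⟨Mirabolic.yEmptyTwo_mem_center, Mirabolic.isIdempotentElem_yEmptyTwo,
    Mirabolic.yEmptyTwo_ne_zero, Mirabolic.cX_mul_yEmptyTwo, Mirabolic.cT₁_mul_yEmptyTwo⟩, ?_⟩
  · intro n A _ _ t₀ t
    exact Mirabolic.satisfies_newRel_iff_solomonRel Mirabolic.q_ne_zero
  · intro n hn
    obtain ⟨φ, h1, h2⟩ := part1 n (one_le_two.trans hn)
    obtain ⟨ψ, h3, h4⟩ := Mirabolic.exists_quotientEquivPresented hn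
    exact ⟨ψ.trans φ, by rw [AlgEquiv.trans_apply, h3, h1],
      fun i => by rw [AlgEquiv.trans_apply, h4, h2]⟩
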